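/- Let $0<q<1$, let $\ell\ge 1$ be an integer, and put $[x]:=(q^x-q^{-x})/(q-q^{-1})$. Consider the odd-dimensional quantum sphere $S^{2\ell+1}_q$ with generators $z_1,\dots,z_{\ell+1}$ of its coordinate $*$-algebra. **The left regular representation.** A Gelfand–Tsetlin (GT) tableau is an array of integers $\mathbf r=(r_{i,j})_{i,j\ge 1,\ i+j\le \ell+2}$ with $r_{1,\ell+1}=0$ and $r_{i,j}\ge r_{i+1,j}\ge r_{i,j+1}$ for all $i,j\geq 1$ with $i+j\le\ell+1$; put $r_{i,j}=0$ out of range. Let $\mathcal H$ be the Hilbert space with orthonormal basis $|n,h;\mathbf r\rangle$, where $n,h\in\mathbb N=\{0,1,2,\dots\}$ and $\mathbf r$ is a GT tableau with $(r_{1,1},\dots,r_{1,\ell})=(n+h,h,\dots,h)$. For $1\le i\le\ell+1$ let $\Gamma^{(i)}$ be the set of $m=(m_1,\dots,m_i)$ with $1\le m_k\le \ell+2-k$, and let $\mathbf r^{(m)}$ be obtained from $\mathbf r$ by adding $1$ to the entries $r_{k,m_k}$, $1\le k\le i$, and then, if $m_1=\ell+1$, subtracting $1$ from all entries. Put $$C_q(i,\mathbf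 r,m)=q^{\frac12\left(1+m_1-2m_i-r_{1,m_1}+2r_{i,m_i}-r_{i,\ell+2-i}+\sum_{k=1}^{\ell+1-i}(r_{i+1,k}-r_{i,k})\right)}\prod_{k=1}^{i-1}\mathrm{sign}(m_k-m_{k+1})$$ $$\times\Big\{\prod_{k=1}^{i-1}\ \prod_{\substack{1\le j\le \ell+2-k\\ j\ne m_k}}\frac{[r_{k,j}-r_{k+1,m_{k+1}}-j+m_{k+1}]}{[r_{k,j}-r_{k,m_k}-j+m_k]}\prod_{\substack{1\le j\le \ell+1-k\\ j\ne m_{k+1}}}\frac{[r_{k+1,j}-r_{k,m_k}-j+m_k-1]}{[r_{k+1,j}-r_{k+1,m_{k+1}}-j+m_{k+1}-1]}\Big\}^{1/2}\left(\frac{\prod_{k=1}^{\ell+1-i}[r_{i+1,k}-r_{i,m_i}-k+m_i-1]}{\prod_{1\le k\le\ell+2-i,\,k\ne m_i}[r_{i,k}-r_{i,m_i}-k+m_i]}\right)^{1/2}$$ with the convention $\mathrm{sign}(0):=-1$. The left regular representation $\pi$ is given on the generators by the bounded operators $\pi(z_1),\dots,\pi(z_{\ell+1})$ on $\mathcal H$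 with $$\pi(z_{\ell+2-i})^*|n,h;\mathbf r\rangle=q^{-\frac12(\ell+h)}\frac{[n+1]^{1/2}}{[n+h+\ell+1]^{1/2}}\sum_{m\in\Gamma^{(i)},\,m_1=1}q^{\ell+h}q^{1-i}C_q(i,\mathbf r,m)\,|n+1,h;\mathbf r^{(m)}\rangle$$ $$\qquad+\,q^{-\frac12 n}\frac{[h+\ell-1]^{1/2}}{[n+h+\ell-1]^{1/2}}\sum_{m\in\Gamma^{(i)},\,m_1=\ell+1}q^{1-i}C_q(i,\mathbf r,m)\,|n,h-1;\mathbf r^{(m)}\rangle ,\qquad 1\le i\le \ell+1,$$ where the summands whose label is not a label of a basis vector are set to zero (and $0/0:=0$, which occurs only for $\ell=1$, $n=h=0$). These formulas determine unique bounded operators. **The symbol representation.** Let $\hat{\mathcal H}$ be the Hilbert space with orthonormal basis $|n,h;\mathbf a,\mathbf b\rangle\!\rangle$, where $n\in\mathbb N$, $h\in\mathbb Z$, $\mathbf a=(a_1,\dots,a_{\ell-1})\in\mathbb Z^{\ell-1}$, $\mathbf b=(b_0,\dots,b_{\ell-1})\in\mathbb Z^{\ell}$, $0\le a_1\le\dots\le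 a_{\ell-1}\le n$ and $b_0\le\dots\le b_{\ell-1}\le h$; put $b_\ell:=h$. For $1\le i\le\ell+1$ let $\underline i=(0,\dots,0,1,\dots,1)\in\{0,1\}^\ell$ with $i-1$ zeros. Define commuting representations of $\mathcal A(S^1)$ (generator $u$) and, for $2\le i\le \ell+1$, of the coordinate algebra $\mathcal A(S^2_q)$ of the equatorial Podleś sphere (generators $A,B$) by $$\rho_1(u)|n,h;\mathbf a,\mathbf b\rangle\!\rangle=|n,h+1;\mathbf a,\mathbf b+\underline 1\rangle\!\rangle,\qquad \rho_i(A)|n,h;\mathbf a,\mathbf b\rangle\!\rangle=q^{b_{i-1}-b_{i-2}}|n,h;\mathbf a,\mathbf b\rangle\!\rangle,$$ $$\rho_i(B)|n,h;\mathbf a,\mathbf b\rangle\!\rangle=\sqrt{1-q^{2(b_{i-1}-b_{i-2}+1)}}\;|n,h+1;\mathbf a,\mathbf b+\underline i\rangle\!\rangle .$$ The symbol representation $\rho$ is obtained by applying $\rho_1\otimes\dots\otimes\rho_{\ell+1}$ to $z_1\mapsto u\otimes A^{\otimes\ell}$, $z_i\mapsto 1^{\otimes(i-1)}\otimes B\otimes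 A^{\otimes(\ell+1-i)}$ ($2\le i\le \ell+1$) and multiplying the factors, so that $\rho(z_1)=\rho_1(u)\rho_2(A)\cdots\rho_{\ell+1}(A)$ and $\rho(z_i)=\rho_i(B)\rho_{i+1}(A)\cdots\rho_{\ell+1}(A)$. Let $W:\mathcal H\to\hat{\mathcal H}$ be the isometry $W|n,h;\mathbf r\rangle=|n,h;\mathbf a(\mathbf r),\mathbf b(\mathbf r)\rangle\!\rangle$ with $a_j(\mathbf r)=r_{\ell+1-j,1}-h$ and $b_k(\mathbf r)=h-r_{\ell+1-k,k+1}$. A *shift operator* (with respect to a given orthonormal basis) is a bounded operator whose matrix in that basis has at most one nonzero element in each row and in each column; its matrix elements are its *weights*. That the weights are bounded by $q^h$ means that the matrix elements in the column of $|n,h;\mathbf r\rangle$ have modulus at most $q^h$. **Theorem.** For all $i=1,\dots,\ell+1$ the operator $\pi(z_i)-W^*\rho(z_i)W$ is a finite sum of shift operators on $\mathcal H$ with weights bounded by $q^h$. **Corollary.** For $N\in\mathbb N$ let $\mathcal H_N\subset\mathcal H$ be the closed linear span of the vectors $|n+N,n;\mathbf r\rangle$, $n\ge 0$, and for $1\le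 i,j\le\ell+1$ let $p_{ij}=z_i^*z_j$ be the generators of $\mathcal A(\mathbb{CP}^\ell_q)$, with $\pi(p_{ij})=\pi(z_i)^*\pi(z_j)$ and $\rho(p_{ij})=\rho(z_i)^*\rho(z_j)$. Then $\pi(p_{ij})$ and $W^*\rho(p_{ij})W$ leave $\mathcal H_N$ invariant, and on $\mathcal H_N$ the operator $T=\pi(p_{ij})-W^*\rho(p_{ij})W$ is a finite sum of shift operators with weights bounded by $q^n$ (in the column of $|n+N,n;\mathbf r\rangle$). Moreover, let $D$ be the operator with $D|n,h;\mathbf r\rangle=-(h+1)|n,h;\mathbf r\rangle$ if $n=0$ and $D|n,h;\mathbf r\rangle=(n+h+1)|n,h;\mathbf r\rangle$ if $n>0$. Then $T$ is a rapid decay matrix (if the basis of $\mathcal H_N$ is enumerated as $(e_s)_{s\in\mathbb N}$ by increasing eigenvalues of $|D|$, then $s^\alpha t^\beta\langle e_s,Te_t\rangle\to 0$ as $(s,t)\to\infty$ for all $\alpha,\beta\in\mathbb N$), and $T$ is a smoothing operator for $D$: for every $k\in\mathbb N$ the operator $|D|^kT$ is bounded and lies in the domain of all powers of the derivation $\delta=[|D|,\,\cdot\,]$.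 -/

import Mathlib

open Filter Topology
open scoped InnerProductSpace ENNReal

noncomputable section

namespace QSphere

/-! ## The Hilbert space `ℓ²(ι)` and elementary operators on it -/

/-- The Hilbert space with orthonormal basis indexed by `ι`. -/
abbrev L2 (ι : Type) : Type := lp (fun _ : ι => ℂ) 2

open Classical in
/-- The basis vector of `L2 ι` with label `x`. -/
def ket {ι : Type} (x : ι) : L2 ι := lp.single 2 x (1 : ℂ)

theorem ket_orthonormal (ι : Type) : Orthonormal ℂ (ket : ι → L2 ι) := by
  classical
  rw [orthonormal_iff_ite]
  intro x y
  unfold ket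
  rw [lp.inner_single_left]
  by_cases h : x = y
  · subst h; simp
  · simp [h]

/-- The isometry `ket x ↦ ket (f x)` attached to an injective map of labels. -/
def shiftIsometry {ι κ : Type} (f : ι → κ) (hf : Function.Injective f) : L2 ι →L[ℂ] L2 κ :=
  ((ket_orthonormal κ).comp f hf).orthogonalFamily.linearIsometry.toContinuousLinearMap

theorem shiftIsometry_ket {ι κ : Type} (f : ι → κ) (hf : Function.Injective f) (x : ι) :
    shiftIsometry f hf (ket x) = ket (f x) := by
  classical
  unfold shiftIsometry
  have h := ((ket_orthonormal κ).comp f hf).orthogonalFamily.linearIsometry_apply_single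
    (i := x) (1 : ℂ)
  have e : (ket x : L2 ι) = lp.single 2 x (1 : ℂ) := by unfold ket; congr
  rw [e]
  refine h.trans ?_
  simp

/-- The diagonal operator `ket x ↦ w x • ket x`, for weights of modulus at most one. -/
def diagonalOp {ι : Type} (w : ι → ℝ) (hw : ∀ x, |w x| ≤ 1) : L2 ι →L[ℂ] L2 ι :=
  lp.mapCLM 2 (fun x => (w x : ℂ) • ContinuousLinearMap.id ℂ ℂ) zero_le_one (fun x => by
    rw [norm_smul]
    simpa using hw x)

theorem diagonalOp_ket {ι : Type} (w : ι → ℝ) (hw : ∀ x, |w x| ≤ 1) (x : ι) :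
    diagonalOp w hw (ket x) = (w x : ℂ) • ket x := by
  classical
  ext y
  simp only [diagonalOp, ket, lp.mapCLM_apply_coe, lp.coeFn_smul, Pi.smul_apply]
  by_cases h : y = x
  · subst h; simp
  · simp [h]

/-! ## Shift operators, rapid decay matrices, smoothing operators -/

section Operators

variable {ι : Type} {E : Type} [NormedAddCommGroup E] [InnerProductSpace ℂ E]

/-- `S` is a shift operator in the basis `e`: its matrix has at most one nonzero element in each
row and at most one nonzero element in each column. -/
def IsShift (e : ι → E) (S : E →L[ℂ] E) : Prop :=
  (∀ y, {x | inner ℂ (e y) (S (e x)) ≠ 0}.Subsingleton) ∧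
  (∀ x, {y | inner ℂ (e y) (S (e x)) ≠ 0}.Subsingleton)

/-- `T` is a finite sum of shift operators whose weights (matrix elements) are bounded by `w`,
evaluated at the label of the vector the shift acts on. -/
def IsSumOfShifts (e : ι → E) (w : ι → ℝ) (T : E →L[ℂ] E) : Prop :=
  ∃ (K : ℕ) (S : Fin K → (E →L[ℂ] E)),
    (∀ k, IsShift e (S k) ∧ ∀ y x, ‖inner ℂ (e y) (S k (e x))‖ ≤ w x) ∧ T = ∑ k, S k

/-- `T` is a rapid decay matrix relative to the basis `e` of eigenvectors of an operator with
eigenvalues `μ`, the basis being enumerated by increasing eigenvalues. -/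
def IsRapidDecay (e : ι → E) (μ : ι → ℝ) (T : E →L[ℂ] E) : Prop :=
  ∀ ε : ℕ ≃ ι, Monotone (fun s => μ (ε s)) → ∀ a b : ℕ,
    Tendsto (fun p : ℕ × ℕ => (p.1 : ℝ) ^ a * (p.2 : ℝ) ^ b *
      ‖inner ℂ (e (ε p.1)) (T (e (ε p.2)))‖) cofinite (𝓝 0)

/-- `v` is in the domain of the selfadjoint operator `M` that is diagonal in the orthonormal
basis `e` with eigenvalues `μ`, and `M v = w`. -/
def IsDiagApply (e : ι → E) (μ : ι → ℝ) (v w : E) : Prop :=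
  ∀ x, inner ℂ (e x) w = (μ x : ℂ) * inner ℂ (e x) v

/-- For `M` diagonal as above: `T` preserves the domain of `M`, and the commutator `M T - T M` on
that domain extends to the bounded operator `S`; that is, `T` is in the domain of
`δ = [M, ·]` and `δ T = S`. -/
def IsDelta (e : ι → E) (μ : ι → ℝ) (T S : E →L[ℂ] E) : Prop :=
  ∀ v w, IsDiagApply e μ v w → IsDiagApply e μ (T v) (S v + T w)

/-- Operators of order zero: `T` is in the domain of all powers of `δ`. -/
def IsOrderZero (e : ι → E) (μ : ι → ℝ) (T : E →L[ℂ] E) : Prop :=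
  ∃ S : ℕ → (E →L[ℂ] E), S 0 = T ∧ ∀ j, IsDelta e μ (S j) (S (j + 1))

/-- Smoothing operators: `M ^ k T` is (everywhere defined, bounded and) of order zero for all
`k`. -/
def IsSmoothing (e : ι → E) (μ : ι → ℝ) (T : E →L[ℂ] E) : Prop :=
  ∃ R : ℕ → (E →L[ℂ] E), R 0 = T ∧ (∀ k v, IsDiagApply e μ (R k v) (R (k + 1) v)) ∧
    ∀ k, IsOrderZero e μ (R k)

end Operators

/-! ## Gelfand–Tsetlin tableaux and the Hilbert space of the sphere -/

/-- `r` is a Gelfand–Tsetlin tableau with `ℓ + 1` rows: row `i` is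
`r i 1, …, r i (ℓ + 2 - i)` for `1 ≤ i ≤ ℓ + 1`, entries out of range are `0`, and the top right
corner is `0`. -/
structure IsGT (ℓ : ℕ) (r : ℕ → ℕ → ℤ) : Prop where
  out_of_range : ∀ i j, ¬ (1 ≤ i ∧ 1 ≤ j ∧ i + j ≤ ℓ + 2) → r i j = 0
  le_up : ∀ i j, 1 ≤ i → 1 ≤ j → i + j ≤ ℓ + 1 → r (i + 1) j ≤ r i j
  up_right_le : ∀ i j, 1 ≤ i → 1 ≤ j → i + j ≤ ℓ + 1 → r i (j + 1) ≤ r (i + 1) j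
  corner : r 1 (ℓ + 1) = 0

/-- The labels `(n, h; r)`: `r` is a Gelfand–Tsetlin tableau with Young tableau
`(r 1 1, …, r 1 ℓ) = (n + h, h, …, h)`. -/
@[ext]
structure Label (ℓ : ℕ) where
  n : ℕ
  h : ℕ
  r : ℕ → ℕ → ℤ
  gt : IsGT ℓ r
  top_first : r 1 1 = n + h
  top : ∀ j, 2 ≤ j → j ≤ ℓ → r 1 j = h

/-- The Hilbert space with orthonormal basis `|n, h; r⟩`. -/
abbrev H (ℓ : ℕ) : Type := L2 (Label ℓ)

open Classical in
/-- The vector `|n, h; r⟩`, set to zero if `(n, h; r)` is not a label. -/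
def ketOf (ℓ : ℕ) (n h : ℤ) (r : ℕ → ℕ → ℤ) : H ℓ :=
  if hx : ∃ x : Label ℓ, (x.n : ℤ) = n ∧ (x.h : ℤ) = h ∧ x.r = r then ket hx.choose else 0

/-! ## The left regular representation -/

/-- The `q`-integer `[x]`. -/
def qInt (q : ℝ) (x : ℤ) : ℝ := (q ^ x - q ^ (-x)) / (q - q⁻¹)

/-- The set `Γ⁽ⁱ⁾` of tuples `(m 1, …, m i)` with `1 ≤ m k ≤ ℓ + 2 - k`; the entry `m (t + 1)` is
stored at position `t`. -/
def Gam (ℓ i : ℕ) : Finset (Fin i → ℕ) :=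
  Fintype.piFinset fun t : Fin i => Finset.Icc 1 (ℓ + 1 - (t : ℕ))

/-- The entry `m k`, for `1 ≤ k ≤ i`. -/
def entry {i : ℕ} (m : Fin i → ℕ) (k : ℕ) : ℕ :=
  if hk : 1 ≤ k ∧ k ≤ i then m ⟨k - 1, by omega⟩ else 0

/-- The array `r⁽ᵐ⁾`. -/
def move (ℓ i : ℕ) (m : ℕ → ℕ) (r : ℕ → ℕ → ℤ) : ℕ → ℕ → ℤ := fun a b =>
  if 1 ≤ a ∧ 1 ≤ b ∧ a + b ≤ ℓ + 2 then
    (if m 1 = ℓ + 1 then -1 else 0) + (if a ≤ i ∧ b = m a then r a b + 1 else r a b)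
  else 0

/-- The exponent of `q ^ (1/2)` in the Clebsch–Gordan coefficient. -/
def cgExponent (ℓ i : ℕ) (r : ℕ → ℕ → ℤ) (m : ℕ → ℕ) : ℤ :=
  1 + m 1 - 2 * m i - r 1 (m 1) + 2 * r i (m i) - r i (ℓ + 2 - i)
    + ∑ k ∈ Finset.Icc 1 (ℓ + 1 - i), (r (i + 1) k - r i k)

/-- The Clebsch–Gordan coefficient `C_q(i, r, m)`. The sign of `0` is `-1` here. -/
def cg (ℓ : ℕ) (q : ℝ) (i : ℕ) (r : ℕ → ℕ → ℤ) (m : ℕ → ℕ) : ℝ :=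
  q ^ ((cgExponent ℓ i r m : ℝ) / 2) *
  (∏ k ∈ Finset.Icc 1 (i - 1), if m (k + 1) < m k then (1 : ℝ) else -1) *
  √(∏ k ∈ Finset.Icc 1 (i - 1),
      (∏ j ∈ (Finset.Icc 1 (ℓ + 2 - k)).erase (m k),
        qInt q (r k j - r (k + 1) (m (k + 1)) - j + m (k + 1)) /
          qInt q (r k j - r k (m k) - j + m k)) *
      (∏ j ∈ (Finset.Icc 1 (ℓ + 1 - k)).erase (m (k + 1)),
        qInt q (r (k + 1) j - r k (m k) - j + m k - 1) /
          qInt q (r (k + 1) j - r (k + 1) (m (k + 1)) - j + m (k + 1) - 1))) *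
  √((∏ k ∈ Finset.Icc 1 (ℓ + 1 - i), qInt q (r (i + 1) k - r i (m i) - k + m i - 1)) /
      ∏ k ∈ (Finset.Icc 1 (ℓ + 2 - i)).erase (m i), qInt q (r i k - r i (m i) - k + m i))

/-- The vector `π(z_{ℓ+2-i}^*) |n, h; r⟩`, for `1 ≤ i ≤ ℓ + 1`. -/
def zStarKet (ℓ : ℕ) (q : ℝ) (i : ℕ) (x : Label ℓ) : H ℓ :=
  ((q ^ (-((ℓ : ℝ) + x.h) / 2) * (√(qInt q (x.n + 1)) / √(qInt q (x.n + x.h + ℓ + 1))) : ℝ) : ℂ) •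
    ∑ m ∈ (Gam ℓ i).filter (fun m => entry m 1 = 1),
      ((q ^ (ℓ + x.h) * q ^ (1 - (i : ℤ)) * cg ℓ q i x.r (entry m) : ℝ) : ℂ) •
        ketOf ℓ (x.n + 1) x.h (move ℓ i (entry m) x.r)
  + ((q ^ (-(x.n : ℝ) / 2) *
      (√(qInt q (x.h + ℓ - 1)) / √(qInt q (x.n + x.h + ℓ - 1))) : ℝ) : ℂ) •
    ∑ m ∈ (Gam ℓ i).filter (fun m => entry m 1 = ℓ + 1),
      ((q ^ (1 - (i : ℤ)) * cg ℓ q i x.r (entry m) : ℝ) : ℂ) •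
        ketOf ℓ x.n (x.h - 1) (move ℓ i (entry m) x.r)

/-- `π` is the family of bounded operators `π(z_1), …, π(z_{ℓ+1})` (with `π j` standing for
`π(z_{j+1})`) of the left regular representation: the adjoints `π(z_{ℓ+2-i}^*)` act on the basis
by the explicit formula. -/
def IsLeftRegular (ℓ : ℕ) (q : ℝ) (π : Fin (ℓ + 1) → (H ℓ →L[ℂ] H ℓ)) : Prop :=
  ∀ (j : Fin (ℓ + 1)) (x : Label ℓ),
    ContinuousLinearMap.adjoint (π j) (ket x) = zStarKet ℓ q (ℓ + 1 - (j : ℕ)) x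

/-! ## The symbol representation -/

/-- The set `Λ` of labels `(n, h; a, b)` with `a = (a 1, …, a (ℓ-1))`, `b = (b 0, …, b (ℓ-1))`,
`0 ≤ a 1 ≤ … ≤ a (ℓ-1) ≤ n` and `b 0 ≤ … ≤ b (ℓ-1) ≤ h`. The tuples are stored as sequences,
continued by `a 0 = 0`, `a j = n` and `b j = h` for `j ≥ ℓ`. -/
@[ext]
structure Lam (ℓ : ℕ) where
  n : ℕ
  h : ℤ
  a : ℕ → ℤ
  b : ℕ → ℤ
  a_zero : a 0 = 0
  a_top : ∀ j, ℓ ≤ j → a j = n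
  a_mono : Monotone a
  b_top : ∀ j, ℓ ≤ j → b j = h
  b_mono : Monotone b

/-- The Hilbert space with orthonormal basis `|n, h; a, b⟫`, `(n, h; a, b) ∈ Λ`. -/
abbrev HHat (ℓ : ℕ) : Type := L2 (Lam ℓ)

/-- `(n, h; a, b) ↦ (n, h + 1; a, b + i)` for the array `i = (0, …, 0, 1, …, 1)` with `i - 1`
zeros, that is, `b k` is raised for `i - 1 ≤ k`. -/
def Lam.raise {ℓ : ℕ} (i : ℕ) (x : Lam ℓ) : Lam ℓ where
  n := x.n
  h := x.h + 1
  a := x.a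
  b := fun k => if i ≤ k + 1 ∨ ℓ ≤ k then x.b k + 1 else x.b k
  a_zero := x.a_zero
  a_top := x.a_top
  a_mono := x.a_mono
  b_top := fun j hj => by simp [hj, x.b_top j hj]
  b_mono := fun s t hst => by
    have h := x.b_mono hst
    dsimp only
    split_ifs <;> omega

theorem Lam.raise_injective {ℓ : ℕ} (i : ℕ) :
    Function.Injective (Lam.raise i : Lam ℓ → Lam ℓ) := by
  intro x y h
  have h1 := congrArg Lam.n h
  have h2 := congrArg Lam.h h
  have h3 := congrArg Lam.a h
  have h4 := congrArg Lam.b h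
  simp only [Lam.raise] at h1 h2 h3 h4
  ext k
  · exact h1
  · omega
  · rw [h3]
  · have := congrFun h4 k
    split_ifs at this <;> omega

/-- `ρ_1(u)`. -/
def rhoU (ℓ : ℕ) : HHat ℓ →L[ℂ] HHat ℓ := shiftIsometry (Lam.raise 1) (Lam.raise_injective 1)

theorem Lam.abs_zpow_le {ℓ : ℕ} {q : ℝ} (hq : q ∈ Set.Ioo (0 : ℝ) 1) (i : ℕ) (x : Lam ℓ) :
    |q ^ (x.b (i - 1) - x.b (i - 2))| ≤ 1 := by
  have h : x.b (i - 2) ≤ x.b (i - 1) := x.b_mono (by omega)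
  rw [abs_of_pos (zpow_pos hq.1 _)]
  obtain ⟨k, hk⟩ := Int.eq_ofNat_of_zero_le (sub_nonneg.2 h)
  rw [hk, zpow_natCast]
  exact pow_le_one₀ hq.1.le hq.2.le

/-- `ρ_i(A)`, for `2 ≤ i ≤ ℓ + 1`. -/
def rhoA (ℓ : ℕ) {q : ℝ} (hq : q ∈ Set.Ioo (0 : ℝ) 1) (i : ℕ) : HHat ℓ →L[ℂ] HHat ℓ :=
  diagonalOp (fun x : Lam ℓ => q ^ (x.b (i - 1) - x.b (i - 2))) (Lam.abs_zpow_le hq i)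

theorem Lam.abs_sqrt_le {ℓ : ℕ} {q : ℝ} (hq : q ∈ Set.Ioo (0 : ℝ) 1) (i : ℕ) (x : Lam ℓ) :
    |√(1 - q ^ (2 * (x.b (i - 1) - x.b (i - 2) + 1)))| ≤ 1 := by
  rw [abs_of_nonneg (Real.sqrt_nonneg _)]
  refine Real.sqrt_le_one.2 ?_
  linarith [zpow_pos hq.1 (2 * (x.b (i - 1) - x.b (i - 2) + 1))]

/-- `ρ_i(B)`, for `2 ≤ i ≤ ℓ + 1`. -/
def rhoB (ℓ : ℕ) {q : ℝ} (hq : q ∈ Set.Ioo (0 : ℝ) 1) (i : ℕ) : HHat ℓ →L[ℂ] HHat ℓ :=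
  shiftIsometry (Lam.raise i) (Lam.raise_injective i) ∘L
    diagonalOp (fun x : Lam ℓ => √(1 - q ^ (2 * (x.b (i - 1) - x.b (i - 2) + 1))))
      (Lam.abs_sqrt_le hq i)

/-- The image under `ρ_k` of the `k`-th tensor factor of
`φ(z_i) = 1 ⊗ ⋯ ⊗ 1 ⊗ (u or B) ⊗ A ⊗ ⋯ ⊗ A`: the factors before the `i`-th are `1`, the `i`-th is
`u` for `i = 1` and `B` for `i ≥ 2`, and the later ones are `A`. -/
def rhoFactor (ℓ : ℕ) {q : ℝ} (hq : q ∈ Set.Ioo (0 : ℝ) 1) (i k : ℕ) :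
    HHat ℓ →L[ℂ] HHat ℓ :=
  if k < i then 1
  else if k = i then (if i = 1 then rhoU ℓ else rhoB ℓ hq i)
  else rhoA ℓ hq k

/-- `ρ(z_i)`: the product of the images under `ρ_1, …, ρ_{ℓ+1}` of the tensor factors of
`φ(z_i)`, for `1 ≤ i ≤ ℓ + 1`. -/
def rho (ℓ : ℕ) {q : ℝ} (hq : q ∈ Set.Ioo (0 : ℝ) 1) (i : ℕ) : HHat ℓ →L[ℂ] HHat ℓ :=
  ((List.range (ℓ + 1)).map fun k => rhoFactor ℓ hq i (k + 1)).prod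

/-! ## The isometry `W` -/

theorem IsGT.le_top {ℓ : ℕ} {r : ℕ → ℕ → ℤ} (hr : IsGT ℓ r) (i j : ℕ) (hj : 1 ≤ j)
    (hij : i + 1 + j ≤ ℓ + 2) : r (i + 1) j ≤ r 1 j := by
  induction i with
  | zero => exact le_rfl
  | succ i ih => exact (hr.le_up (i + 1) j (by omega) hj (by omega)).trans (ih (by omega))

theorem IsGT.top_le {ℓ : ℕ} {r : ℕ → ℕ → ℤ} (hr : IsGT ℓ r) (i j : ℕ) (hj : 1 ≤ j)
    (hij : i + 1 + j ≤ ℓ + 2) : r 1 (i + j) ≤ r (i + 1) j := by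
  induction i generalizing j with
  | zero => simp
  | succ i ih =>
    have h1 := ih (j + 1) (by omega) (by omega)
    have h2 := hr.up_right_le (i + 1) j (by omega) hj (by omega)
    have e : i + 1 + j = i + (j + 1) := by omega
    rw [e]
    exact h1.trans h2

/-- `(n, h; r) ↦ (n, h; a(r), b(r))` with `a_j = r_{ℓ+1-j,1} - h` and `b_k = h - r_{ℓ+1-k,k+1}`. -/
def Label.toLam {ℓ : ℕ} (x : Label ℓ) : Lam ℓ where
  n := x.n
  h := x.h
  a := fun j => if ℓ ≤ j then x.n else if j = 0 then 0 else x.r (ℓ + 1 - j) 1 - x.h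
  b := fun k => if ℓ ≤ k then x.h else x.h - x.r (ℓ + 1 - k) (k + 1)
  a_zero := by
    by_cases h : ℓ = 0
    · subst h
      have h1 := x.top_first
      have h2 := x.gt.corner
      simp only [zero_add] at h2
      simp only [le_refl, if_true]
      omega
    · simp [h]
  a_top := fun j hj => by simp [hj]
  a_mono := by
    refine monotone_nat_of_le_succ fun j => ?_
    have h1 := x.top_first
    by_cases hj : ℓ ≤ j
    · simp [hj, Nat.le_succ_of_le hj]
    · by_cases hj' : ℓ ≤ j + 1
      · have hℓ : ℓ = j + 1 := by omega
        subst hℓ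
        have h2 := x.gt.le_top 1 1 le_rfl
        by_cases h0 : j = 0
        · simp [h0]
        · have e : j + 1 + 1 - j = 1 + 1 := by omega
          simp only [hj, h0, if_false, le_refl, if_true, e]
          have := h2 (by omega)
          omega
      · by_cases h0 : j = 0
        · subst h0
          have h2 := x.gt.top_le (ℓ - 1) 1 le_rfl (by omega)
          have h3 := x.top ℓ (by omega) le_rfl
          have e1 : ℓ - 1 + 1 = ℓ := by omega
          have e2 : ℓ + 1 - (0 + 1) = ℓ := by omega
          rw [e1] at h2
          simp only [hj, hj', if_false, if_true, e2]
          simp only [zero_add, one_ne_zero, if_false]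
          omega
        · have h2 := x.gt.le_up (ℓ - j) 1 (by omega) le_rfl (by omega)
          have e1 : ℓ - j + 1 = ℓ + 1 - j := by omega
          have e2 : ℓ + 1 - (j + 1) = ℓ - j := by omega
          rw [e1] at h2
          have h0' : j + 1 ≠ 0 := by omega
          simp only [hj, hj', h0, h0', if_false, e2]
          omega
  b_top := fun j hj => by simp [hj]
  b_mono := by
    refine monotone_nat_of_le_succ fun k => ?_
    by_cases hk : ℓ ≤ k
    · simp [hk, Nat.le_succ_of_le hk]
    · have h2 := x.gt.up_right_le (ℓ - k) (k + 1) (by omega) (by omega) (by omega)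
      have e1 : ℓ - k + 1 = ℓ + 1 - k := by omega
      rw [e1] at h2
      by_cases hk' : ℓ ≤ k + 1
      · have hℓ : ℓ = k + 1 := by omega
        subst hℓ
        have h3 := x.gt.corner
        have e2 : k + 1 - k = 1 := by omega
        rw [e2] at h2
        simp only [hk, if_false, le_refl, if_true]
        omega
      · have e2 : ℓ + 1 - (k + 1) = ℓ - k := by omega
        simp only [hk, hk', if_false, e2]
        omega

theorem Label.toLam_injective (ℓ : ℕ) : Function.Injective (Label.toLam : Label ℓ → Lam ℓ) := by
  intro x y hxy
  have hn : x.n = y.n := congrArg Lam.n hxy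
  have hh : (x.h : ℤ) = y.h := congrArg Lam.h hxy
  have ha := congrArg Lam.a hxy
  have hb := congrArg Lam.b hxy
  simp only [Label.toLam] at ha hb
  ext i j
  · exact hn
  · exact_mod_cast hh
  · by_cases hr : 1 ≤ i ∧ 1 ≤ j ∧ i + j ≤ ℓ + 2
    · obtain ⟨hi, hj, hij⟩ := hr
      by_cases hd : i + j = ℓ + 2
      · by_cases h1 : i = 1
        · have e : j = ℓ + 1 := by omega
          rw [h1, e, x.gt.corner, y.gt.corner]
        · have h2 := congrFun hb (j - 1)
          have e1 : ¬ ℓ ≤ j - 1 := by omega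
          have e2 : ℓ + 1 - (j - 1) = i := by omega
          have e3 : j - 1 + 1 = j := by omega
          simp only [e1, if_false, e2, e3] at h2
          omega
      · by_cases hj1 : j = 1
        · subst hj1
          by_cases h1 : i = 1
          · rw [h1, x.top_first, y.top_first, hn, hh]
          · have h2 := congrFun ha (ℓ + 1 - i)
            have e1 : ¬ ℓ ≤ ℓ + 1 - i := by omega
            have e2 : ¬ ℓ + 1 - i = 0 := by omega
            have e3 : ℓ + 1 - (ℓ + 1 - i) = i := by omega
            simp only [e1, e2, if_false, e3] at h2
            omega
        · obtain ⟨i, rfl⟩ : ∃ k, i = k + 1 := ⟨i - 1, by omega⟩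
          have a1 := x.gt.le_top i j hj (by omega)
          have a2 := x.gt.top_le i j hj (by omega)
          have a3 := x.top j (by omega) (by omega)
          have a4 := x.top (i + j) (by omega) (by omega)
          have b1 := y.gt.le_top i j hj (by omega)
          have b2 := y.gt.top_le i j hj (by omega)
          have b3 := y.top j (by omega) (by omega)
          have b4 := y.top (i + j) (by omega) (by omega)
          omega
    · rw [x.gt.out_of_range i j hr, y.gt.out_of_range i j hr]

/-- The isometry `W |n, h; r⟩ = |n, h; a(r), b(r)⟫`. -/
def W (ℓ : ℕ) : H ℓ →L[ℂ] HHat ℓ := shiftIsometry Label.toLam (Label.toLam_injective ℓ)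

/-! ## The Dirac operator and the subspaces `H_N` -/

/-- The eigenvalue of the optimal Dirac operator `D` on `|n, h; r⟩`. -/
def diracEigenvalue {ℓ : ℕ} (x : Label ℓ) : ℝ :=
  if x.n = 0 then -((x.h : ℝ) + 1) else (x.n : ℝ) + x.h + 1

/-- The labels `(h + N, h; r)` of the basis of `H_N`. -/
abbrev LabelN (ℓ N : ℕ) : Type := {x : Label ℓ // x.n = x.h + N}

/-- The closed linear span `H_N` of the vectors `|h + N, h; r⟩`. -/
def HN (ℓ N : ℕ) : Submodule ℂ (H ℓ) :=
  (Submodule.span ℂ (Set.range fun x : LabelN ℓ N => (ket x.1 : H ℓ))).topologicalClosure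

/-- The basis vectors `|h + N, h; r⟩` as elements of `H_N`. -/
def ketN {ℓ N : ℕ} (x : LabelN ℓ N) : HN ℓ N :=
  ⟨ket x.1, Submodule.le_topologicalClosure _ (Submodule.subset_span ⟨x, rfl⟩)⟩

end QSphere

end

/-!
Raising a tableau along a tuple `m` keeps it a tableau only if `m` raises entries at the two ends of
the rows, because all interior entries of a label `(n, h; r)` equal `h`. In the Clebsch–Gordan
coefficient of such a tuple the `q`-integers of the interior entries telescope
(`row_factor_eq`, `last_factor_eq`), and each row contributes a fixed number of quotients of
`q`-integers. For `x ≠ 0` the size of `[x]` is `q ^ (-|x|)` up to bounded factors, so a coefficient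
has a definite order as a power of `q`. The contributions of consecutive rows to this order cancel
(`Label.cost`), except where `m` passes from first to last entries (`Label.gain`). The result is that every tuple
raising some first entry, in a row with at least two entries, has a coefficient of order `q ^ h`
(`abs_coefUp_le`, `abs_coefDown_le`). The only remaining tuple raises the last entry of every row
`1, …, i`. It moves the label exactly as the symbol of `z_{ℓ+2-i}^*` does, and there every quotient
of `q`-integers is a power of `q` times a number close to one, apart from one factor
`1 - q ^ (2 x)` that also occurs in the symbol. So the coefficient differs from the weight of the
symbol by `O(q ^ h)` (`abs_coefDown_sub_le`). Hence `π(z_i) - W^* ρ(z_i) W` is a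
finite sum of shift operators with weights `O(q ^ h)`. A shift operator with weights at most
`C q ^ h` is a sum of finitely many with weights at most `q ^ h`, which removes the constants
(`exists_sum_of_mem_shiftClass`).

For the products `z_i^* z_j`, the sums of shift operators that change `n - h` by a fixed `d` and `h`
by a bounded amount form classes stable under sums, products and adjoints (`shiftClass`). Writing
`π(z_i)^* π(z_j) - S_i^* S_j = (π(z_i)^* - S_i^*) π(z_j) + S_i^* (π(z_j) - S_j)` with
`S_i = W^* ρ(z_i) W` gives a difference with weights `O(q ^ h)`. Moreover
`S_i^* S_j = W^* ρ(z_i)^* ρ(z_j) W`, since the range of `W` is invariant under `ρ(z_j)` (`W_symb`).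
These products have `d = 0`, so they preserve `H_N`. There `|D|` has the eigenvalue `2 h + N + 1`.
The number of labels with given `h` grows polynomially, whereas the weights decrease exponentially:
this is rapid decay (`isRapidDecay_restr`). Multiplication by `|D|` and the commutator with `|D|`
multiply the matrix elements by functions that grow at most linearly in `h`, and therefore preserve
rapidly decreasing weights (`exists_schur_mul`), so the difference is smoothing.
-/

noncomputable section

namespace QSphere

/-! ### `q`-integers -/

/-- The function `x ↦ 1 - q ^ (2 x)`, by which a `q`-integer deviates from a power of `q`. -/
def qPhi (q : ℝ) (x : ℤ) : ℝ := 1 - q ^ (2 * x)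

theorem qInt_neg (q : ℝ) (x : ℤ) : qInt q (-x) = -qInt q x := by
  simp only [qInt, neg_neg]
  ring

/-- For large `x` the factor `qPhi q x` is close to one, so `[x]` has the order `q ^ (-x)`. -/
theorem qInt_eq {q : ℝ} (hq : q ∈ Set.Ioo (0 : ℝ) 1) (x : ℤ) :
    qInt q x = (q⁻¹ - q)⁻¹ * q ^ (-x) * qPhi q x := by
  have h0 : q ≠ 0 := hq.1.ne'
  have h1 : q ^ (-x) * q ^ (2 * x) = q ^ x := by
    rw [← zpow_add₀ h0]
    congr 1
    ring
  have h2 : (q - q⁻¹)⁻¹ = -(q⁻¹ - q)⁻¹ := by rw [← neg_sub, inv_neg]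
  rw [qInt, qPhi, div_eq_mul_inv, h2, mul_assoc, mul_sub, h1]
  ring

theorem inv_sub_pos {q : ℝ} (hq : q ∈ Set.Ioo (0 : ℝ) 1) : 0 < q⁻¹ - q := by
  have := (one_lt_inv₀ hq.1).2 hq.2
  linarith [hq.2]

theorem qInt_div_qInt {q : ℝ} (hq : q ∈ Set.Ioo (0 : ℝ) 1) (a c : ℤ) :
    qInt q a / qInt q c = q ^ (c - a) * (qPhi q a / qPhi q c) := by
  have h0 : q ≠ 0 := hq.1.ne'
  have hk : (q⁻¹ - q)⁻¹ ≠ 0 := (inv_pos.2 (inv_sub_pos hq)).ne'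
  rw [qInt_eq hq a, qInt_eq hq c, mul_div_mul_comm, mul_div_mul_comm, div_self hk, one_mul,
    ← zpow_sub₀ h0]
  congr 2
  ring

theorem zpow_le_one_of_nonneg {q : ℝ} (hq : q ∈ Set.Ioo (0 : ℝ) 1) {x : ℤ} (hx : 0 ≤ x) :
    q ^ x ≤ 1 := by
  obtain ⟨k, rfl⟩ := Int.eq_ofNat_of_zero_le hx
  simpa using pow_le_one₀ hq.1.le hq.2.le

theorem qPhi_le_one {q : ℝ} (hq : q ∈ Set.Ioo (0 : ℝ) 1) (x : ℤ) : qPhi q x ≤ 1 := by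
  have := zpow_pos hq.1 (2 * x)
  simp only [qPhi]
  linarith

theorem qPhi_nonneg {q : ℝ} (hq : q ∈ Set.Ioo (0 : ℝ) 1) {x : ℤ} (hx : 0 ≤ x) : 0 ≤ qPhi q x :=
  sub_nonneg.2 (zpow_le_one_of_nonneg hq (by omega))

theorem one_sub_zpow_le_qPhi {q : ℝ} (hq : q ∈ Set.Ioo (0 : ℝ) 1) {x s : ℤ} (hx : s ≤ x) :
    1 - q ^ (2 * s) ≤ qPhi q x :=
  sub_le_sub_left (zpow_le_zpow_right_of_le_one₀ hq.1 hq.2.le (by omega)) _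

theorem one_sub_sq_le_qPhi {q : ℝ} (hq : q ∈ Set.Ioo (0 : ℝ) 1) {x : ℤ} (hx : 1 ≤ x) :
    1 - q ^ 2 ≤ qPhi q x := by
  have := one_sub_zpow_le_qPhi hq hx
  simpa using this

theorem one_sub_sq_pos {q : ℝ} (hq : q ∈ Set.Ioo (0 : ℝ) 1) : 0 < 1 - q ^ 2 := by
  have := pow_lt_one₀ hq.1.le hq.2 two_ne_zero
  linarith

theorem qPhi_pos {q : ℝ} (hq : q ∈ Set.Ioo (0 : ℝ) 1) {x : ℤ} (hx : 1 ≤ x) : 0 < qPhi q x :=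
  (one_sub_sq_pos hq).trans_le (one_sub_sq_le_qPhi hq hx)

theorem qInt_pos {q : ℝ} (hq : q ∈ Set.Ioo (0 : ℝ) 1) {x : ℤ} (hx : 1 ≤ x) : 0 < qInt q x := by
  rw [qInt_eq hq]
  exact mul_pos (mul_pos (inv_pos.2 (inv_sub_pos hq)) (zpow_pos hq.1 _)) (qPhi_pos hq hx)

theorem qInt_nonneg {q : ℝ} (hq : q ∈ Set.Ioo (0 : ℝ) 1) {x : ℤ} (hx : 0 ≤ x) :
    0 ≤ qInt q x := by
  rw [qInt_eq hq]
  exact mul_nonneg (mul_pos (inv_pos.2 (inv_sub_pos hq)) (zpow_pos hq.1 _)).le (qPhi_nonneg hq hx)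

theorem qInt_ne_zero {q : ℝ} (hq : q ∈ Set.Ioo (0 : ℝ) 1) {x : ℤ} (hx : x ≠ 0) :
    qInt q x ≠ 0 := by
  rcases lt_or_gt_of_ne hx with h | h
  · rw [← neg_neg x, qInt_neg]
    exact neg_ne_zero.2 (qInt_pos hq (by omega)).ne'
  · exact (qInt_pos hq (by omega)).ne'

/-- The constant bounding `1 / (1 - q ^ (2 x))` for `x ≥ 1`. -/
def qD (q : ℝ) : ℝ := (1 - q ^ 2)⁻¹

theorem one_le_qD {q : ℝ} (hq : q ∈ Set.Ioo (0 : ℝ) 1) : 1 ≤ qD q :=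
  (one_le_inv₀ (one_sub_sq_pos hq)).2 (by nlinarith [hq.1])

/-- A ratio of `q`-integers `[± a] / [± c]` has the order `q ^ (c - a)`. -/
theorem abs_qInt_div_le {q : ℝ} (hq : q ∈ Set.Ioo (0 : ℝ) 1) {a c : ℤ} (a' c' : ℤ)
    (ha : 0 ≤ a' ∧ (a = a' ∨ a = -a')) (hc : 1 ≤ c' ∧ (c = c' ∨ c = -c')) :
    |qInt q a / qInt q c| ≤ qD q * q ^ (c' - a') := by
  have key : |qInt q a / qInt q c| = |qInt q a' / qInt q c'| := by
    rw [abs_div, abs_div]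
    congr 1
    · rcases ha.2 with h | h <;> simp [h, qInt_neg]
    · rcases hc.2 with h | h <;> simp [h, qInt_neg]
  have hp := zpow_pos hq.1 (c' - a')
  rw [key, qInt_div_qInt hq, abs_mul, abs_of_pos hp, mul_comm]
  refine mul_le_mul_of_nonneg_right ?_ hp.le
  rw [abs_of_nonneg (div_nonneg (qPhi_nonneg hq ha.1) (qPhi_pos hq hc.1).le), qD, ← one_div]
  exact div_le_div₀ zero_le_one (qPhi_le_one hq _) (one_sub_sq_pos hq)
    (one_sub_sq_le_qPhi hq hc.1)

/-! ### Telescoping products along the rows of a tableau -/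

/-- A product over a row without one of its ends splits into the other end and the interior. -/
theorem prod_erase_row (p : ℕ) (f : ℕ → ℝ) {m : ℕ} (hm : m = 1 ∨ m = p + 2) :
    ∏ j ∈ (Finset.Icc 1 (p + 2)).erase m, f j =
      f (if m = 1 then p + 2 else 1) * ∏ j ∈ Finset.Icc 2 (p + 1), f j := by
  rcases hm with rfl | rfl
  · have e : (Finset.Icc 1 (p + 2)).erase 1 = insert (p + 2) (Finset.Icc 2 (p + 1)) := by
      ext j
      simp only [Finset.mem_erase, Finset.mem_Icc, Finset.mem_insert]
      omega
    rw [e, Finset.prod_insert (by simp)]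
    simp
  · have e : (Finset.Icc 1 (p + 2)).erase (p + 2) = insert 1 (Finset.Icc 2 (p + 1)) := by
      ext j
      simp only [Finset.mem_erase, Finset.mem_Icc, Finset.mem_insert]
      omega
    rw [e, Finset.prod_insert (by simp)]
    simp

/-- The interior factors of two consecutive rows cancel, except for the first one: the entries of
the lower row are shifted by one position against those of the upper row. -/
theorem prod_telescope (p : ℕ) (f g : ℕ → ℝ)
    (hfg : ∀ j, 3 ≤ j → j ≤ p + 2 → f j ≠ 0 ∧ g j ≠ 0) :
    (∏ j ∈ Finset.Icc 2 (p + 2), f j / g j) * ∏ j ∈ Finset.Icc 2 (p + 1), g (j + 1) / f (j + 1) =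
      f 2 / g 2 := by
  induction p with
  | zero => simp
  | succ p ih =>
    have ih := ih fun j h3 hj => hfg j h3 (by omega)
    obtain ⟨hf, hg⟩ := hfg (p + 1 + 2) (by omega) le_rfl
    rw [Finset.prod_Icc_succ_top (by omega : 2 ≤ p + 2 + 1) fun j => f j / g j,
      Finset.prod_Icc_succ_top (by omega : 2 ≤ p + 1 + 1) fun j => g (j + 1) / f (j + 1), ← ih]
    have e : f (p + 2 + 1) / g (p + 2 + 1) * (g (p + 1 + 1 + 1) / f (p + 1 + 1 + 1)) = 1 := by
      rw [div_mul_div_comm, mul_comm, div_self (mul_ne_zero hg hf)]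
    rw [mul_mul_mul_comm, e, mul_one]

/-- The interior factors of the last raised row cancel against those of the row below it. -/
theorem prod_telescope_last (p : ℕ) (g : ℕ → ℝ)
    (hg : ∀ j, 2 ≤ j → j ≤ p + 2 → g j ≠ 0) :
    (∏ j ∈ Finset.Icc 2 (p + 1), g (j + 1)) / ∏ j ∈ Finset.Icc 2 (p + 2), g j = 1 / g 2 := by
  induction p with
  | zero => simp
  | succ p ih =>
    have ih := ih fun j h3 hj => hg j h3 (by omega)
    rw [Finset.prod_Icc_succ_top (by omega : 2 ≤ p + 1 + 1 + 1),
      Finset.prod_Icc_succ_top (by omega : 2 ≤ p + 1 + 1), ← ih,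
      mul_div_mul_right _ _ (hg _ (by omega) (by omega))]

/-- The contribution of two consecutive rows `u`, `v` to the Clebsch–Gordan coefficient: the
entries equal to `h` telescope, when the raised entries `a`, `b` are at the end of their rows. -/
theorem row_factor_eq (q : ℝ) (p : ℕ) (u v : ℕ → ℤ) (h : ℤ) (a b : ℕ)
    (hu : ∀ j, 2 ≤ j → j ≤ p + 2 → u j = h) (hv : ∀ j, 2 ≤ j → j ≤ p + 1 → v j = h)
    (ha : a = 1 ∨ a = p + 3) (hb : b = 1 ∨ b = p + 2)
    (hne : ∀ j : ℕ, 3 ≤ j → j ≤ p + 2 →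
      qInt q (h - j - (v b - b)) ≠ 0 ∧ qInt q (h - j - (u a - a)) ≠ 0) :
    (∏ j ∈ (Finset.Icc 1 (p + 3)).erase a,
        qInt q (u j - v b - j + b) / qInt q (u j - u a - j + a)) *
      (∏ j ∈ (Finset.Icc 1 (p + 2)).erase b,
        qInt q (v j - u a - j + a - 1) / qInt q (v j - v b - j + b - 1)) =
    qInt q (h - 2 - (v b - b)) / qInt q (h - 2 - (u a - a)) *
      (qInt q ((if a = 1 then u (p + 3) - (p + 3) else u 1 - 1) - (v b - b)) /
        qInt q ((if a = 1 then u (p + 3) - (p + 3) else u 1 - 1) - (u a - a))) *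
      (qInt q ((if b = 1 then v (p + 2) - (p + 2) else v 1 - 1) - (u a - a) - 1) /
        qInt q ((if b = 1 then v (p + 2) - (p + 2) else v 1 - 1) - (v b - b) - 1)) := by
  rw [prod_erase_row (p + 1) _ ha, prod_erase_row p _ hb]
  have e1 : ∏ j ∈ Finset.Icc 2 (p + 1 + 1),
      qInt q (u j - v b - j + b) / qInt q (u j - u a - j + a) =
      ∏ j ∈ Finset.Icc 2 (p + 2), qInt q (h - j - (v b - b)) / qInt q (h - j - (u a - a)) := by
    refine Finset.prod_congr rfl fun j hj => ?_
    rw [Finset.mem_Icc] at hj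
    rw [hu j hj.1 hj.2]
    congr 2 <;> ring
  have e2 : ∏ j ∈ Finset.Icc 2 (p + 1),
      qInt q (v j - u a - j + a - 1) / qInt q (v j - v b - j + b - 1) =
      ∏ j ∈ Finset.Icc 2 (p + 1), qInt q (h - (j + 1 : ℕ) - (u a - a)) /
        qInt q (h - (j + 1 : ℕ) - (v b - b)) := by
    refine Finset.prod_congr rfl fun j hj => ?_
    rw [Finset.mem_Icc] at hj
    rw [hv j hj.1 hj.2]
    push_cast
    congr 2 <;> ring
  have e3 := prod_telescope p (fun j => qInt q (h - j - (v b - b)))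
    (fun j => qInt q (h - j - (u a - a))) hne
  have e4 : ∀ A B C D : ℝ, (A * B) * (C * D) = (B * D) * A * C := fun A B C D => by ring
  rw [e1, e2, e4, e3]
  push_cast
  congr 2
  · congr 1
    · split_ifs <;> congr 1 <;> ring
    · split_ifs <;> congr 1 <;> ring
  · split_ifs <;> congr 2 <;> ring
  · split_ifs <;> congr 2 <;> ring

/-- The contribution of the last raised row `u` and of the row `v` below it. For `p = 0` the row
`v` has one entry, and the formula uses a virtual first entry `h`. -/
theorem last_factor_eq (q : ℝ) (p : ℕ) (u v : ℕ → ℤ) (h : ℤ) (a : ℕ)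
    (hu : ∀ j, 2 ≤ j → j ≤ p + 1 → u j = h) (hv : ∀ j, 2 ≤ j → j ≤ p → v j = h)
    (ha : a = 1 ∨ a = p + 2)
    (hne : ∀ j : ℕ, 2 ≤ j → j ≤ p + 2 → j = 2 ∨ j ≤ p + 1 → qInt q (h - j - (u a - a)) ≠ 0) :
    (∏ j ∈ Finset.Icc 1 (p + 1), qInt q (v j - u a - j + a - 1)) /
      (∏ j ∈ (Finset.Icc 1 (p + 2)).erase a, qInt q (u j - u a - j + a)) =
    (qInt q ((if p = 0 then h - 1 else v 1 - 1) - (u a - a) - 1) /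
      qInt q ((if a = 1 then u (p + 2) - (p + 2) else u 1 - 1) - (u a - a))) *
    (qInt q (v (p + 1) - (p + 1) - (u a - a) - 1) / qInt q (h - 2 - (u a - a))) := by
  rw [prod_erase_row p _ ha]
  have e0 : qInt q (u (if a = 1 then p + 2 else 1) - u a - (if a = 1 then p + 2 else 1 : ℕ) + a) =
      qInt q ((if a = 1 then u (p + 2) - (p + 2) else u 1 - 1) - (u a - a)) := by
    split_ifs <;> push_cast <;> congr 1 <;> ring
  rw [e0]
  rcases p with _ | p
  · have h2 := hne 2 le_rfl le_rfl (Or.inl rfl)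
    push_cast at h2
    simp only [zero_add, Finset.Icc_self, Finset.prod_singleton, if_true]
    rw [Finset.Icc_eq_empty (by omega), Finset.prod_empty, mul_one]
    have e1 : h - 1 - (u a - a) - 1 = h - 2 - (u a - a) := by ring
    have e2 : v 1 - u a - (1 : ℕ) + a - 1 = v 1 - ((0 : ℕ) + 1) - (u a - a) - 1 := by
      push_cast
      ring
    rw [e1, e2, div_mul_div_comm, mul_comm (qInt q (h - 2 - _)), mul_div_mul_right _ _ h2]
  · have e1 : ∏ j ∈ Finset.Icc 2 (p + 1 + 1), qInt q (u j - u a - j + a) =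
        ∏ j ∈ Finset.Icc 2 (p + 2), qInt q (h - j - (u a - a)) := by
      refine Finset.prod_congr rfl fun j hj => ?_
      rw [Finset.mem_Icc] at hj
      rw [hu j hj.1 hj.2]
      congr 1
      ring
    have e2 : ∏ j ∈ Finset.Icc 1 (p + 1 + 1), qInt q (v j - u a - j + a - 1) =
        (qInt q (v 1 - 1 - (u a - a) - 1) * qInt q (v (p + 2) - (p + 2) - (u a - a) - 1)) *
        ∏ j ∈ Finset.Icc 2 (p + 1), qInt q (h - (j + 1 : ℕ) - (u a - a)) := by
      rw [Finset.prod_Icc_succ_top (by omega),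
        ← Finset.insert_Icc_add_one_left_eq_Icc (by omega : 1 ≤ p + 1),
        Finset.prod_insert (by simp)]
      have e3 : ∏ j ∈ Finset.Icc (1 + 1) (p + 1), qInt q (v j - u a - j + a - 1) =
        ∏ j ∈ Finset.Icc 2 (p + 1), qInt q (h - (j + 1 : ℕ) - (u a - a)) := by
        refine Finset.prod_congr rfl fun j hj => ?_
        rw [Finset.mem_Icc] at hj
        rw [hv j hj.1 hj.2]
        push_cast
        congr 1
        ring
      rw [e3, mul_right_comm]
      push_cast
      congr 2
      · congr 1
        ring
      · congr 1
        ring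
    have e4 := prod_telescope_last p (fun j => qInt q (h - j - (u a - a)))
      fun j h2 hj => hne j h2 (by omega) (by omega)
    rw [e1, e2, mul_comm (qInt q (ite _ _ _ - _)), mul_comm, mul_div_mul_comm, e4]
    have e5 : ¬ p + 1 = 0 := by omega
    simp only [e5, if_false]
    push_cast
    have e6 : v (p + 1 + 1) - ((p : ℤ) + 1 + 1) = v (p + 2) - (p + 2) := by ring_nf
    rw [e6]
    ring

/-! ### The two ends of the rows of a tableau -/

section Rows

variable {ℓ : ℕ}

/-- The excess `r k 1 - h` of the first entry of row `k`; it is zero below the row `ℓ`, as if the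
last row had an additional first entry `h`. -/
def Label.al (x : Label ℓ) (k : ℕ) : ℤ := if k ≤ ℓ then x.r k 1 - x.h else 0

/-- The last entry of row `k`. -/
def Label.dg (x : Label ℓ) (k : ℕ) : ℤ := x.r k (ℓ + 2 - k)

/-- The interior entries of the rows equal `h`, since the top row is `(n + h, h, …, h, 0)`. -/
theorem Label.interior (x : Label ℓ) {k j : ℕ} (hk : 1 ≤ k) (hj : 2 ≤ j) (hkj : k + j ≤ ℓ + 1) :
    x.r k j = x.h := by
  obtain ⟨k, rfl⟩ : ∃ k', k = k' + 1 := ⟨k - 1, by omega⟩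
  have a1 := x.gt.le_top k j (by omega) (by omega)
  have a2 := x.gt.top_le k j (by omega) (by omega)
  rw [x.top j hj (by omega)] at a1
  rw [x.top (k + j) (by omega) (by omega)] at a2
  omega

theorem Label.al_one (hℓ : 1 ≤ ℓ) (x : Label ℓ) : x.al 1 = x.n := by
  simp [Label.al, hℓ, x.top_first]

theorem Label.al_nonneg (x : Label ℓ) {k : ℕ} (hk : 1 ≤ k) : 0 ≤ x.al k := by
  unfold Label.al
  split_ifs with h
  · rcases hk.eq_or_lt with rfl | hk
    · rw [x.top_first]
      omega
    · obtain ⟨k, rfl⟩ : ∃ k', k = k' + 1 := ⟨k - 1, by omega⟩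
      have a2 := x.gt.top_le k 1 le_rfl (by omega)
      rw [x.top (k + 1) (by omega) (by omega)] at a2
      omega
  · exact le_rfl

theorem Label.al_succ_le (x : Label ℓ) {k : ℕ} (hk : 1 ≤ k) : x.al (k + 1) ≤ x.al k := by
  have h0 := x.al_nonneg hk
  by_cases h : k + 1 ≤ ℓ
  · have h1 : k ≤ ℓ := by omega
    have := x.gt.le_up k 1 hk le_rfl (by omega)
    simp only [Label.al, h, h1, if_true]
    omega
  · have e : x.al (k + 1) = 0 := by simp [Label.al, h]
    rw [e]
    exact h0

theorem Label.dg_one (x : Label ℓ) : x.dg 1 = 0 := x.gt.corner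

theorem Label.dg_le_succ (x : Label ℓ) {k : ℕ} (hk : 1 ≤ k) (hk' : k ≤ ℓ) :
    x.dg k ≤ x.dg (k + 1) := by
  have := x.gt.up_right_le k (ℓ + 1 - k) hk (by omega) (by omega)
  have e1 : ℓ + 1 - k + 1 = ℓ + 2 - k := by omega
  have e2 : ℓ + 1 - k = ℓ + 2 - (k + 1) := by omega
  rw [e1] at this
  rw [e2] at this
  exact this

theorem Label.dg_mono (x : Label ℓ) {k j : ℕ} (hk : 1 ≤ k) (hkj : k ≤ j) (hj : j ≤ ℓ + 1) :
    x.dg k ≤ x.dg j := by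
  induction j, hkj using Nat.le_induction with
  | base => exact le_rfl
  | succ j hkj ih => exact (ih (by omega)).trans (x.dg_le_succ (by omega) (by omega))

theorem Label.dg_nonneg (x : Label ℓ) {k : ℕ} (hk : 1 ≤ k) (hk' : k ≤ ℓ + 1) : 0 ≤ x.dg k :=
  x.dg_one.symm.le.trans (x.dg_mono le_rfl hk hk')

theorem Label.dg_le (x : Label ℓ) {k : ℕ} (hk : 1 ≤ k) (hk' : k ≤ ℓ) : x.dg k ≤ x.h := by
  rcases hk.eq_or_lt with rfl | hk
  · rw [x.dg_one]
    omega
  · obtain ⟨k, rfl⟩ : ∃ k', k = k' + 1 := ⟨k - 1, by omega⟩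
    have a1 := x.gt.le_top k (ℓ + 2 - (k + 1)) (by omega) (by omega)
    rwa [x.top _ (by omega) (by omega)] at a1

theorem Label.dg_last_le (hℓ : 1 ≤ ℓ) (x : Label ℓ) : x.dg (ℓ + 1) ≤ x.h + x.al ℓ := by
  have := x.gt.le_up ℓ 1 hℓ le_rfl le_rfl
  have e : ℓ + 2 - (ℓ + 1) = 1 := by omega
  simp only [Label.al, Label.dg, le_refl, if_true, e]
  omega

/-- The shifted first entry `r k 1 - 1`. -/
def Label.posL (x : Label ℓ) (k : ℕ) : ℤ := x.h + x.al k - 1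

/-- The shifted last entry `r k j - j`, `j = ℓ + 2 - k`. -/
def Label.posR (x : Label ℓ) (k : ℕ) : ℤ := x.dg k - (ℓ + 2 - k)

/-- The tuple `m` raises the first entry of the row `k`, which has at least two entries. -/
def Lft (ℓ : ℕ) (m : ℕ → ℕ) (k : ℕ) : Prop := m k = 1 ∧ k ≤ ℓ

open Classical in
/-- The shifted entry of row `k` that is raised by `m`. -/
def Label.chosen (x : Label ℓ) (m : ℕ → ℕ) (k : ℕ) : ℤ :=
  if Lft ℓ m k then x.posL k else x.posR k

open Classical in
/-- The shifted entry at the end of row `k` that is not raised by `m`. -/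
def Label.other (x : Label ℓ) (m : ℕ → ℕ) (k : ℕ) : ℤ :=
  if Lft ℓ m k then x.posR k else x.posL k

/-- The tuple `m = (m 1, …, m i)` raises only entries at the ends of the rows of `x`, and leaves
room for the last entries it raises: below the interior value `h`, or, for the bottom row, below
the first entry of the row above it. -/
structure Admissible (x : Label ℓ) (i : ℕ) (m : ℕ → ℕ) : Prop where
  one_le : 1 ≤ i
  le : i ≤ ℓ + 1
  ends : ∀ k, 1 ≤ k → k ≤ i → m k = 1 ∨ m k = ℓ + 2 - k
  dg_lt : ∀ k, 1 ≤ k → k ≤ i → k ≤ ℓ → m k ≠ 1 → x.dg k < x.h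
  dg_last_lt : i = ℓ + 1 → m ℓ ≠ 1 → x.dg (ℓ + 1) < x.h + x.al ℓ

variable {x : Label ℓ} {i : ℕ} {m : ℕ → ℕ}

theorem Admissible.chosen_eq (hm : Admissible x i m) {k : ℕ} (hk : 1 ≤ k) (hk' : k ≤ i) :
    x.r k (m k) - m k = x.chosen m k := by
  have := hm.le
  by_cases hL : Lft ℓ m k
  · have h2 := hL.2
    simp only [Label.chosen, if_pos hL, hL.1, Label.posL, Label.al, if_pos h2]
    push_cast
    ring
  · have h1 : m k = ℓ + 2 - k := by
      rcases hm.ends k hk hk' with h | h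
      · by_cases h' : k ≤ ℓ
        · exact absurd ⟨h, h'⟩ hL
        · omega
      · exact h
    simp only [Label.chosen, if_neg hL, h1, Label.posR, Label.dg]
    push_cast [show k ≤ ℓ + 2 by omega]
    ring

theorem Label.other_eq (x : Label ℓ) (m : ℕ → ℕ) {k : ℕ} (hk' : k ≤ ℓ) :
    (if m k = 1 then x.r k (ℓ + 2 - k) - (ℓ + 2 - k) else x.r k 1 - 1) = x.other m k := by
  by_cases h : m k = 1
  · simp only [Label.other, Lft, h, hk', and_true, if_true, Label.posR, Label.dg]
  · simp only [Label.other, Lft, h, false_and, if_false, Label.posL, Label.al, hk', if_true]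
    ring

/-- The arguments of the `q`-integers that cancel in the telescoping products do not vanish. -/
theorem Admissible.interior_ne (hm : Admissible x i m) {k : ℕ} (hk : 1 ≤ k) (hk' : k ≤ i)
    (hkℓ : k ≤ ℓ) {j : ℕ} (hj : 2 ≤ j) (hj' : j + k ≤ ℓ + 2) : x.h - j - x.chosen m k ≠ 0 := by
  have h1 := x.al_nonneg hk
  by_cases hL : Lft ℓ m k
  · simp only [Label.chosen, if_pos hL, Label.posL]
    omega
  · have h2 := hm.dg_lt k hk hk' hkℓ fun h => hL ⟨h, hkℓ⟩
    simp only [Label.chosen, if_neg hL, Label.posR]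
    omega

/-- The factor of the Clebsch–Gordan coefficient that depends on the rows `k` and `k + 1`. -/
def rowFactor (ℓ : ℕ) (q : ℝ) (r : ℕ → ℕ → ℤ) (m : ℕ → ℕ) (k : ℕ) : ℝ :=
  (∏ j ∈ (Finset.Icc 1 (ℓ + 2 - k)).erase (m k),
        qInt q (r k j - r (k + 1) (m (k + 1)) - j + m (k + 1)) /
          qInt q (r k j - r k (m k) - j + m k)) *
      (∏ j ∈ (Finset.Icc 1 (ℓ + 1 - k)).erase (m (k + 1)),
        qInt q (r (k + 1) j - r k (m k) - j + m k - 1) /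
          qInt q (r (k + 1) j - r (k + 1) (m (k + 1)) - j + m (k + 1) - 1))

/-- The factor of the Clebsch–Gordan coefficient that depends on the rows `i` and `i + 1`, where
`i` is the last row changed. -/
def lastFactor (ℓ : ℕ) (q : ℝ) (r : ℕ → ℕ → ℤ) (m : ℕ → ℕ) (i : ℕ) : ℝ :=
  (∏ k ∈ Finset.Icc 1 (ℓ + 1 - i), qInt q (r (i + 1) k - r i (m i) - k + m i - 1)) /
      ∏ k ∈ (Finset.Icc 1 (ℓ + 2 - i)).erase (m i), qInt q (r i k - r i (m i) - k + m i)

theorem cg_eq (ℓ : ℕ) (q : ℝ) (i : ℕ) (r : ℕ → ℕ → ℤ) (m : ℕ → ℕ) :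
    cg ℓ q i r m = q ^ ((cgExponent ℓ i r m : ℝ) / 2) *
      (∏ k ∈ Finset.Icc 1 (i - 1), if m (k + 1) < m k then (1 : ℝ) else -1) *
      √(∏ k ∈ Finset.Icc 1 (i - 1), rowFactor ℓ q r m k) * √(lastFactor ℓ q r m i) := rfl

theorem Admissible.rowFactor_eq {q : ℝ} (hq : q ∈ Set.Ioo (0 : ℝ) 1) (hm : Admissible x i m)
    {k : ℕ} (hk : 1 ≤ k) (hki : k + 1 ≤ i) (hkℓ : k + 1 ≤ ℓ) :
    rowFactor ℓ q x.r m k =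
      qInt q (x.h - 2 - x.chosen m (k + 1)) / qInt q (x.h - 2 - x.chosen m k) *
      (qInt q (x.other m k - x.chosen m (k + 1)) / qInt q (x.other m k - x.chosen m k)) *
      (qInt q (x.other m (k + 1) - x.chosen m k - 1) /
        qInt q (x.other m (k + 1) - x.chosen m (k + 1) - 1)) := by
  obtain ⟨p, hp⟩ : ∃ p, ℓ = k + p + 1 := ⟨ℓ - k - 1, by omega⟩
  have e1 : ℓ + 2 - k = p + 3 := by omega
  have e2 : ℓ + 1 - k = p + 2 := by omega
  have e2' : ℓ + 2 - (k + 1) = p + 2 := by omega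
  have c1 := hm.chosen_eq hk (by omega)
  have c2 := hm.chosen_eq (k := k + 1) (by omega) hki
  have o1 := x.other_eq m (k := k) (by omega)
  have o2 := x.other_eq m hkℓ
  have h1 := hm.ends k hk (by omega)
  have h2 := hm.ends (k + 1) (by omega) hki
  rw [e1] at h1 o1
  rw [e2'] at h2 o2
  have e3 : (ℓ : ℤ) + 2 - k = p + 3 := by omega
  have e4 : (ℓ : ℤ) + 2 - (k + 1 : ℕ) = p + 2 := by omega
  rw [e3] at o1
  rw [e4] at o2
  have key := row_factor_eq q p (x.r k) (x.r (k + 1)) x.h (m k) (m (k + 1))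
    (fun j hj hj' => x.interior hk hj (by omega))
    (fun j hj hj' => x.interior (by omega) hj (by omega)) h1 h2
    (fun j hj hj' => by
      rw [c1, c2]
      exact ⟨qInt_ne_zero hq (hm.interior_ne (by omega) hki hkℓ (by omega) (by omega)),
        qInt_ne_zero hq (hm.interior_ne hk (by omega) (by omega) (by omega) (by omega))⟩)
  rw [c1, c2, o1, o2] at key
  rw [rowFactor, e1, e2]
  exact key

/-- Row `ℓ` has two entries and row `ℓ + 1` has one, so only one quotient is left. -/
theorem Admissible.rowFactor_last (q : ℝ) (hℓ : 1 ≤ ℓ) (hm : Admissible x i m) (hi : i = ℓ + 1) :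
    rowFactor ℓ q x.r m ℓ =
      qInt q (x.other m ℓ - x.chosen m (ℓ + 1)) / qInt q (x.other m ℓ - x.chosen m ℓ) := by
  subst hi
  have e1 : ℓ + 2 - ℓ = 0 + 2 := by omega
  have e2 : ℓ + 1 - ℓ = 1 := by omega
  have c1 := hm.chosen_eq hℓ (by omega)
  have c2 := hm.chosen_eq (k := ℓ + 1) (by omega) le_rfl
  have o1 := x.other_eq m (k := ℓ) le_rfl
  have h1 := hm.ends ℓ hℓ (by omega)
  have h2 : m (ℓ + 1) = 1 := by
    have := hm.ends (ℓ + 1) (by omega) le_rfl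
    omega
  have e3 : (Finset.Icc 1 1).erase (m (ℓ + 1)) = ∅ := by simp [h2]
  rw [e1] at h1 o1
  rw [rowFactor, e1, e2, e3, Finset.prod_empty, mul_one, prod_erase_row 0 _ h1,
    Finset.Icc_eq_empty (by omega), Finset.prod_empty, mul_one, ← c1, ← c2, ← o1]
  have e4 : (ℓ : ℤ) + 2 - ℓ = 2 := by omega
  rw [e4]
  split_ifs <;> push_cast <;> congr 2 <;> ring

theorem Admissible.lastFactor_eq {q : ℝ} (hq : q ∈ Set.Ioo (0 : ℝ) 1) (hm : Admissible x i m)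
    (hi : i ≤ ℓ) :
    lastFactor ℓ q x.r m i =
      qInt q (x.posL (i + 1) - x.chosen m i - 1) / qInt q (x.other m i - x.chosen m i) *
      (qInt q (x.posR (i + 1) - x.chosen m i - 1) / qInt q (x.h - 2 - x.chosen m i)) := by
  have hi1 := hm.one_le
  obtain ⟨p, hp⟩ : ∃ p, ℓ = i + p := ⟨ℓ - i, by omega⟩
  have e1 : ℓ + 2 - i = p + 2 := by omega
  have e2 : ℓ + 1 - i = p + 1 := by omega
  have c1 := hm.chosen_eq hi1 le_rfl
  have o1 := x.other_eq m hi
  have h1 := hm.ends i hi1 le_rfl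
  rw [e1] at h1 o1
  have e3 : (ℓ : ℤ) + 2 - i = p + 2 := by omega
  rw [e3] at o1
  have key := last_factor_eq q p (x.r i) (x.r (i + 1)) x.h (m i)
    (fun j hj hj' => x.interior hi1 hj (by omega))
    (fun j hj hj' => x.interior (by omega) hj (by omega)) h1
    (fun j hj hj' _ => by
      rw [c1]
      exact qInt_ne_zero hq (hm.interior_ne hi1 le_rfl hi hj (by omega)))
  have e5 : (if p = 0 then (x.h : ℤ) - 1 else x.r (i + 1) 1 - 1) = x.posL (i + 1) := by
    simp only [Label.posL, Label.al]
    by_cases h : p = 0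
    · have : ¬ i + 1 ≤ ℓ := by omega
      simp [h, this]
    · have : i + 1 ≤ ℓ := by omega
      simp only [h, if_false, this, if_true]
      ring
  have e6 : x.r (i + 1) (p + 1) - ((p : ℤ) + 1) = x.posR (i + 1) := by
    have e7 : ℓ + 2 - (i + 1) = p + 1 := by omega
    simp only [Label.posR, Label.dg, e7]
    omega
  rw [c1, o1, e5, e6] at key
  rw [lastFactor, e1, e2]
  exact key

theorem Admissible.lastFactor_bottom (q : ℝ) (hm : Admissible x i m) (hi : i = ℓ + 1) :
    lastFactor ℓ q x.r m i = 1 := by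
  subst hi
  have h2 : m (ℓ + 1) = 1 := by
    have := hm.ends (ℓ + 1) (by omega) le_rfl
    omega
  simp [lastFactor, h2]

theorem Label.sum_sub_eq (x : Label ℓ) {i : ℕ} (hi1 : 1 ≤ i) (hi : i ≤ ℓ) :
    ∑ k ∈ Finset.Icc 1 (ℓ + 1 - i), (x.r (i + 1) k - x.r i k) =
      x.al (i + 1) - x.al i + x.dg (i + 1) - x.h := by
  obtain ⟨p, hp⟩ : ∃ p, ℓ = i + p := ⟨ℓ - i, by omega⟩
  have e2 : ℓ + 1 - i = p + 1 := by omega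
  have e7 : ℓ + 2 - (i + 1) = p + 1 := by omega
  rw [e2]
  rcases p with _ | p
  · have : ¬ i + 1 ≤ ℓ := by omega
    simp only [zero_add, Finset.Icc_self, Finset.sum_singleton, Label.al, this, if_false, hi,
      if_true, Label.dg, e7]
    ring
  · have h1 : i + 1 ≤ ℓ := by omega
    rw [Finset.sum_Icc_succ_top (by omega),
        ← Finset.insert_Icc_add_one_left_eq_Icc (by omega : 1 ≤ p + 1),
        Finset.sum_insert (by simp), Finset.sum_eq_zero,
        x.interior (k := i) (j := p + 1 + 1) hi1 (by omega) (by omega)]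
    · simp only [Label.al, h1, hi, if_true, Label.dg, e7]
      ring
    · intro j hj
      rw [Finset.mem_Icc] at hj
      rw [x.interior (by omega) (by omega) (by omega), x.interior hi1 (by omega) (by omega),
        sub_self]

end Rows

/-! ### Half-integral powers of `q` -/

/-- The power `q ^ (e / 2)`. -/
def halfPow (q : ℝ) (e : ℤ) : ℝ := q ^ ((e : ℝ) / 2)

section HalfPow

variable {q : ℝ}

theorem halfPow_pos (hq : q ∈ Set.Ioo (0 : ℝ) 1) (e : ℤ) : 0 < halfPow q e :=
  Real.rpow_pos_of_pos hq.1 _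

theorem halfPow_mul (hq : q ∈ Set.Ioo (0 : ℝ) 1) (e f : ℤ) :
    halfPow q e * halfPow q f = halfPow q (e + f) := by
  rw [halfPow, halfPow, halfPow, ← Real.rpow_add hq.1]
  congr 1
  push_cast
  ring

theorem zpow_eq_halfPow (q : ℝ) (e : ℤ) : q ^ e = halfPow q (2 * e) := by
  rw [halfPow, ← Real.rpow_intCast]
  congr 1
  push_cast
  ring

theorem pow_eq_halfPow (q : ℝ) (e : ℕ) : q ^ e = halfPow q (2 * e) := by
  rw [← zpow_eq_halfPow, zpow_natCast]

theorem sqrt_zpow (hq : q ∈ Set.Ioo (0 : ℝ) 1) (e : ℤ) : √(q ^ e) = halfPow q e := by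
  rw [zpow_eq_halfPow, two_mul, ← halfPow_mul hq, Real.sqrt_mul_self (halfPow_pos hq e).le]

theorem halfPow_le (hq : q ∈ Set.Ioo (0 : ℝ) 1) {e f : ℤ} (hef : f ≤ e) :
    halfPow q e ≤ halfPow q f := by
  have : (f : ℝ) ≤ e := by exact_mod_cast hef
  exact Real.rpow_le_rpow_of_exponent_ge hq.1 hq.2.le (by linarith)

theorem sqrt_le_of_abs_le (hq : q ∈ Set.Ioo (0 : ℝ) 1) {a K : ℝ} {e : ℤ} (hK : 0 ≤ K)
    (ha : |a| ≤ K * q ^ e) : √a ≤ √K * halfPow q e := by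
  rw [← sqrt_zpow hq, ← Real.sqrt_mul hK]
  exact Real.sqrt_le_sqrt ((le_abs_self a).trans ha)

end HalfPow

/-! ### The size of the Clebsch–Gordan coefficients -/

section Bounds

variable {ℓ : ℕ} {x : Label ℓ} {i : ℕ} {m : ℕ → ℕ} {q : ℝ}

theorem abs_mul_three_le {a b c D p₁ p₂ p₃ : ℝ} (ha : |a| ≤ D * p₁) (hb : |b| ≤ D * p₂)
    (hc : |c| ≤ D * p₃) : |a * b * c| ≤ D ^ 3 * (p₁ * p₂ * p₃) := by
  rw [abs_mul, abs_mul]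
  have h1 := mul_le_mul ha hb (abs_nonneg _) ((abs_nonneg _).trans ha)
  exact (mul_le_mul h1 hc (abs_nonneg _)
    ((mul_nonneg (abs_nonneg a) (abs_nonneg b)).trans h1)).trans (le_of_eq (by ring))

open Classical in
/-- The number `|h - 2 - A|`, where `A` is the shifted entry of row `k` that is raised by `m`. It is
the order of the `q`-integer of row `k` that survives the telescoping, and cancels again between
consecutive rows. -/
def Label.cost (x : Label ℓ) (m : ℕ → ℕ) (k : ℕ) : ℤ :=
  if Lft ℓ m k then x.al k + 1 else x.h - x.dg k + ℓ - k

open Classical in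
/-- A lower bound for the order that the row factors gain by the change from first to last entries,
if `m` raises the last entry of row `k` and the first entry of some row above it. -/
def Label.gain (x : Label ℓ) (m : ℕ → ℕ) (k : ℕ) : ℤ :=
  if ¬ Lft ℓ m k ∧ ∃ j, 1 ≤ j ∧ j < k ∧ Lft ℓ m j then 2 * (x.h - x.dg k) else 0

theorem Label.gain_of_lft (x : Label ℓ) {k : ℕ} (h : Lft ℓ m k) : x.gain m k = 0 := by
  simp [Label.gain, h]

theorem Label.gain_nonneg (x : Label ℓ) {k : ℕ} (hk : 1 ≤ k) (hk' : k ≤ ℓ) :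
    0 ≤ x.gain m k := by
  unfold Label.gain
  have := x.dg_le hk hk'
  split_ifs <;> omega

theorem Label.gain_succ_of_lft (x : Label ℓ) {k : ℕ} (hk : 1 ≤ k) (h : Lft ℓ m k)
    (h' : ¬ Lft ℓ m (k + 1)) : x.gain m (k + 1) = 2 * (x.h - x.dg (k + 1)) :=
  if_pos ⟨h', k, hk, by omega, h⟩

theorem Label.gain_succ_of_not_lft (x : Label ℓ) {k : ℕ} (hk : 1 ≤ k) (hk' : k ≤ ℓ)
    (h : ¬ Lft ℓ m k) (h' : ¬ Lft ℓ m (k + 1)) : x.gain m (k + 1) ≤ x.gain m k := by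
  have h1 := x.dg_le_succ hk hk'
  by_cases hj : ∃ j, 1 ≤ j ∧ j < k ∧ Lft ℓ m j
  · have hj' : ∃ j, 1 ≤ j ∧ j < k + 1 ∧ Lft ℓ m j := by
      obtain ⟨j, a, b, c⟩ := hj
      exact ⟨j, a, by omega, c⟩
    rw [Label.gain, Label.gain, if_pos ⟨h', hj'⟩, if_pos ⟨h, hj⟩]
    omega
  · have hj' : ¬ ∃ j, 1 ≤ j ∧ j < k + 1 ∧ Lft ℓ m j := by
      rintro ⟨j, a, b, c⟩
      rcases (Nat.lt_succ_iff_lt_or_eq.1 b) with b | rfl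
      · exact hj ⟨j, a, b, c⟩
      · exact h c
    rw [Label.gain, Label.gain, if_neg fun H => hj' H.2, if_neg fun H => hj H.2]

/-- The order of a row factor, found separately for each choice of the ends that `m` raises in the
rows `k` and `k + 1`. -/
theorem Admissible.abs_rowFactor_le (hq : q ∈ Set.Ioo (0 : ℝ) 1) (hm : Admissible x i m)
    {k : ℕ} (hk : 1 ≤ k) (hki : k + 1 ≤ i) (hkℓ : k + 1 ≤ ℓ) :
    |rowFactor ℓ q x.r m k| ≤ qD q ^ 3 *
      q ^ (x.cost m k - x.cost m (k + 1) + (x.gain m (k + 1) - x.gain m k)) := by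
  have hq0 : q ≠ 0 := hq.1.ne'
  have hD : 0 ≤ qD q ^ 3 := pow_nonneg (zero_le_one.trans (one_le_qD hq)) 3
  rw [hm.rowFactor_eq hq hk hki hkℓ]
  have a0 := x.al_nonneg (k := k + 1) (by omega)
  have a1 := x.al_succ_le hk
  have d1 := x.dg_le_succ hk (by omega)
  have d2 := x.dg_le (k := k + 1) (by omega) hkℓ
  have g0 := x.gain_nonneg (m := m) hk (by omega)
  have lt1 := hm.dg_lt k hk (by omega) (by omega)
  have lt2 := hm.dg_lt (k + 1) (by omega) hki hkℓ
  have fin : ∀ {X : ℝ} {a b c e : ℤ}, |X| ≤ qD q ^ 3 * (q ^ a * q ^ b * q ^ c) → e ≤ a + b + c →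
      |X| ≤ qD q ^ 3 * q ^ e := by
    intro X a b c e hX he
    refine hX.trans (mul_le_mul_of_nonneg_left ?_ hD)
    rw [← zpow_add₀ hq0, ← zpow_add₀ hq0]
    exact zpow_le_zpow_right_of_le_one₀ hq.1 hq.2.le he
  by_cases h : Lft ℓ m k <;> by_cases h' : Lft ℓ m (k + 1)
  · rw [x.gain_of_lft h, x.gain_of_lft h']
    simp only [Label.chosen, Label.other, Label.cost, if_pos h, if_pos h', Label.posL, Label.posR]
    exact fin (abs_mul_three_le
      (abs_qInt_div_le hq (x.al (k + 1) + 1) (x.al k + 1) (by omega) (by omega))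
      (abs_qInt_div_le hq (x.h + x.al (k + 1) - 1 - x.dg k + (ℓ + 2 - k))
        (x.h + x.al k - 1 - x.dg k + (ℓ + 2 - k)) (by omega) (by omega))
      (abs_qInt_div_le hq (x.h + x.al k - x.dg (k + 1) + (ℓ + 1 - k))
        (x.h + x.al (k + 1) - x.dg (k + 1) + (ℓ + 1 - k)) (by omega) (by omega)))
      (by omega)
  · rw [x.gain_of_lft h, x.gain_succ_of_lft hk h h']
    have lt2 := lt2 fun H => h' ⟨H, hkℓ⟩
    simp only [Label.chosen, Label.other, Label.cost, if_pos h, if_neg h', Label.posL, Label.posR]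
    exact fin (abs_mul_three_le
      (abs_qInt_div_le hq (x.h - x.dg (k + 1) + ℓ - (k + 1)) (x.al k + 1) (by omega) (by omega))
      (abs_qInt_div_le hq (x.dg (k + 1) - x.dg k + 1)
        (x.h + x.al k - 1 - x.dg k + (ℓ + 2 - k)) (by omega) (by omega))
      (abs_qInt_div_le hq (x.al k - x.al (k + 1) + 1)
        (x.h + x.al (k + 1) - x.dg (k + 1) + (ℓ + 1 - k) - 2) (by omega) (by omega)))
      (by omega)
  · rw [x.gain_of_lft h']
    have lt1 := lt1 fun H => h ⟨H, by omega⟩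
    simp only [Label.chosen, Label.other, Label.cost, if_neg h, if_pos h', Label.posL, Label.posR]
    exact fin (abs_mul_three_le
      (abs_qInt_div_le hq (x.al (k + 1) + 1) (x.h - x.dg k + ℓ - k) (by omega) (by omega))
      (abs_qInt_div_le hq (x.al k - x.al (k + 1))
        (x.h + x.al k - 1 - x.dg k + (ℓ + 2 - k)) (by omega) (by omega))
      (abs_qInt_div_le hq (x.dg (k + 1) - x.dg k)
        (x.h + x.al (k + 1) - x.dg (k + 1) + (ℓ + 1 - k)) (by omega) (by omega)))
      (by omega)
  · have g1 := x.gain_succ_of_not_lft hk (by omega) h h'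
    have lt1 := lt1 fun H => h ⟨H, by omega⟩
    have lt2 := lt2 fun H => h' ⟨H, hkℓ⟩
    simp only [Label.chosen, Label.other, Label.cost, if_neg h, if_neg h', Label.posL, Label.posR]
    exact fin (abs_mul_three_le
      (abs_qInt_div_le hq (x.h - x.dg (k + 1) + ℓ - (k + 1)) (x.h - x.dg k + ℓ - k)
        (by omega) (by omega))
      (abs_qInt_div_le hq (x.h + x.al k - x.dg (k + 1) + (ℓ - k))
        (x.h + x.al k - 1 - x.dg k + (ℓ + 2 - k)) (by omega) (by omega))
      (abs_qInt_div_le hq (x.h + x.al (k + 1) - x.dg k + (ℓ - k))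
        (x.h + x.al (k + 1) - x.dg (k + 1) + (ℓ + 1 - k) - 2) (by omega) (by omega)))
      (by omega)

theorem Admissible.abs_prod_rowFactor_le (hq : q ∈ Set.Ioo (0 : ℝ) 1) (hm : Admissible x i m)
    {k : ℕ} (hki : k + 1 ≤ i) (hkℓ : k + 1 ≤ ℓ) :
    |∏ j ∈ Finset.Icc 1 k, rowFactor ℓ q x.r m j| ≤ (qD q ^ 3) ^ k *
      q ^ (x.cost m 1 - x.cost m (k + 1) + x.gain m (k + 1)) := by
  induction k with
  | zero =>
    have : x.gain m 1 = 0 := if_neg fun H => by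
      obtain ⟨j, h1, h2, -⟩ := H.2
      omega
    simp [this]
  | succ k ih =>
    have ih := ih (by omega) (by omega)
    have h := hm.abs_rowFactor_le hq (k := k + 1) (by omega) hki hkℓ
    rw [Finset.prod_Icc_succ_top (by omega), abs_mul]
    refine (mul_le_mul ih h (abs_nonneg _) ((abs_nonneg _).trans ih)).trans (le_of_eq ?_)
    rw [mul_mul_mul_comm, ← pow_succ, ← zpow_add₀ hq.1.ne']
    congr 2
    ring

open Classical in
theorem Admissible.abs_prod_rowFactor_bottom_le (hq : q ∈ Set.Ioo (0 : ℝ) 1) (hℓ : 1 ≤ ℓ)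
    (hm : Admissible x i m) (hi : i = ℓ + 1) :
    |∏ j ∈ Finset.Icc 1 ℓ, rowFactor ℓ q x.r m j| ≤ (qD q ^ 3) ^ ℓ *
      q ^ (x.cost m 1 - x.cost m ℓ + x.gain m ℓ +
        if Lft ℓ m ℓ then x.h + x.al ℓ - x.dg (ℓ + 1) else x.dg (ℓ + 1) - x.dg ℓ + 1) := by
  have hD := one_le_qD hq
  obtain ⟨p, hp⟩ : ∃ p, ℓ = p + 1 := ⟨ℓ - 1, by omega⟩
  have h1 := hm.abs_prod_rowFactor_le hq (k := p) (by omega) (by omega)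
  rw [← hp] at h1
  have e : Finset.Icc 1 ℓ = insert ℓ (Finset.Icc 1 p) := by
    ext j
    simp only [Finset.mem_Icc, Finset.mem_insert]
    omega
  have a0 := x.al_nonneg hℓ
  have d1 := x.dg_le_succ hℓ le_rfl
  have d2 := x.dg_le hℓ le_rfl
  have d3 := x.dg_last_le hℓ
  have lt1 := hm.dg_lt ℓ hℓ (by omega) le_rfl
  have h2 : |rowFactor ℓ q x.r m ℓ| ≤ qD q ^ 3 * q ^
      (if Lft ℓ m ℓ then x.h + x.al ℓ - x.dg (ℓ + 1) else x.dg (ℓ + 1) - x.dg ℓ + 1) := by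
    have h3 : ∀ {X : ℝ} {e f : ℤ}, |X| ≤ qD q * q ^ e → e = f →
        |X| ≤ qD q ^ 3 * q ^ f := fun hX hf => hf ▸
      hX.trans (mul_le_mul_of_nonneg_right (le_self_pow₀ hD (by omega)) (zpow_pos hq.1 _).le)
    rw [hm.rowFactor_last q hℓ hi]
    have hL' : ¬ Lft ℓ m (ℓ + 1) := fun H => by
      have := H.2
      omega
    by_cases hL : Lft ℓ m ℓ
    · rw [if_pos hL]
      simp only [Label.chosen, Label.other, if_pos hL, if_neg hL', Label.posL, Label.posR]
      exact h3 (abs_qInt_div_le hq (x.dg (ℓ + 1) - x.dg ℓ + 1) (x.h + x.al ℓ - x.dg ℓ + 1)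
        (by omega) (by omega)) (by ring)
    · have lt1 := lt1 fun H => hL ⟨H, le_rfl⟩
      rw [if_neg hL]
      simp only [Label.chosen, Label.other, if_neg hL, if_neg hL', Label.posL, Label.posR]
      exact h3 (abs_qInt_div_le hq (x.h + x.al ℓ - x.dg (ℓ + 1)) (x.h + x.al ℓ - x.dg ℓ + 1)
        (by omega) (by omega)) (by ring)
  rw [e, Finset.prod_insert (by simp [hp]), abs_mul, mul_comm]
  refine (mul_le_mul h1 h2 (abs_nonneg _) ((abs_nonneg _).trans h1)).trans (le_of_eq ?_)
  have e2 : (qD q ^ 3) ^ ℓ = (qD q ^ 3) ^ p * qD q ^ 3 := by rw [hp, pow_succ]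
  rw [mul_mul_mul_comm, e2, ← zpow_add₀ hq.1.ne']

open Classical in
theorem Admissible.abs_lastFactor_le (hq : q ∈ Set.Ioo (0 : ℝ) 1) (hm : Admissible x i m)
    (hi : i ≤ ℓ) :
    |lastFactor ℓ q x.r m i| ≤ qD q ^ 2 * q ^ (x.cost m i +
      if Lft ℓ m i then x.al (i + 1) - x.al i + x.dg (i + 1) - x.dg i - 1
      else x.al i - x.al (i + 1) + x.dg i - x.dg (i + 1) + 1) := by
  have hi1 := hm.one_le
  have a0 := x.al_nonneg (k := i + 1) (by omega)
  have a1 := x.al_succ_le hi1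
  have d1 := x.dg_le_succ hi1 hi
  have d2 := x.dg_le hi1 hi
  have lt1 := hm.dg_lt i hi1 le_rfl hi
  have d3 : x.dg (i + 1) ≤ x.h + x.al i := by
    rcases hi.eq_or_lt with rfl | h
    · exact x.dg_last_le hi1
    · have := x.dg_le (k := i + 1) (by omega) h
      omega
  rw [hm.lastFactor_eq hq hi]
  have fin : ∀ {X Y : ℝ} {a b e : ℤ}, |X| ≤ qD q * q ^ a → |Y| ≤ qD q * q ^ b → e = a + b →
      |X * Y| ≤ qD q ^ 2 * q ^ e := by
    intro X Y a b e hX hY he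
    rw [abs_mul, he, zpow_add₀ hq.1.ne']
    exact (mul_le_mul hX hY (abs_nonneg _) ((abs_nonneg _).trans hX)).trans (le_of_eq (by ring))
  by_cases hL : Lft ℓ m i
  · simp only [Label.chosen, Label.other, if_pos hL, Label.posL, Label.posR, Label.cost]
    exact fin
      (abs_qInt_div_le hq (x.al i - x.al (i + 1) + 1) (x.h + x.al i - x.dg i + (ℓ + 1 - i))
        (by omega) (by omega))
      (abs_qInt_div_le hq (x.h + x.al i - x.dg (i + 1) + (ℓ + 1 - i)) (x.al i + 1)
        (by omega) (by omega))
      (by omega)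
  · have lt1 := lt1 fun H => hL ⟨H, hi⟩
    simp only [Label.chosen, Label.other, if_neg hL, Label.posL, Label.posR, Label.cost]
    exact fin
      (abs_qInt_div_le hq (x.h + x.al (i + 1) - x.dg i + (ℓ - i))
        (x.h + x.al i - x.dg i + (ℓ + 1 - i)) (by omega) (by omega))
      (abs_qInt_div_le hq (x.dg (i + 1) - x.dg i) (x.h - x.dg i + ℓ - i)
        (by omega) (by omega))
      (by omega)

end Bounds

/-! ### The size of the coefficients of the left regular representation -/

section Coefficients

variable {ℓ : ℕ} {x : Label ℓ} {i : ℕ} {m : ℕ → ℕ} {q : ℝ}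

theorem Admissible.eq_of_not_lft (hm : Admissible x i m) {k : ℕ} (hk : 1 ≤ k) (hk' : k ≤ i)
    (hL : ¬ Lft ℓ m k) : m k = ℓ + 2 - k := by
  have := hm.le
  rcases hm.ends k hk hk' with h | h
  · by_cases h' : k ≤ ℓ
    · exact absurd ⟨h, h'⟩ hL
    · omega
  · exact h

theorem Admissible.cgExponent_eq (hm : Admissible x i m) (hi : i ≤ ℓ) :
    cgExponent ℓ i x.r m = 1 - x.chosen m 1 + 2 * x.chosen m i - x.dg i +
      (x.al (i + 1) - x.al i + x.dg (i + 1) - x.h) := by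
  have c1 := hm.chosen_eq le_rfl hm.one_le
  have c2 := hm.chosen_eq hm.one_le le_rfl
  rw [cgExponent, x.sum_sub_eq hm.one_le hi, ← c1, ← c2]
  simp only [Label.dg]
  ring

theorem Admissible.cgExponent_bottom (hm : Admissible x i m) (hi : i = ℓ + 1) :
    cgExponent ℓ i x.r m = 1 - x.chosen m 1 + 2 * x.chosen m i - x.dg i := by
  have c1 := hm.chosen_eq le_rfl hm.one_le
  have c2 := hm.chosen_eq hm.one_le le_rfl
  rw [cgExponent, ← c1, ← c2, Label.dg, Finset.Icc_eq_empty (by omega), Finset.sum_empty]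
  ring

theorem abs_sign_prod_le (m : ℕ → ℕ) (s : Finset ℕ) :
    |∏ k ∈ s, if m (k + 1) < m k then (1 : ℝ) else -1| ≤ 1 := by
  rw [Finset.abs_prod]
  refine (Finset.prod_eq_one fun k _ => ?_).le
  split_ifs <;> simp

theorem sqrt_le_of_abs_le_of_one_le (hq : q ∈ Set.Ioo (0 : ℝ) 1) {a K : ℝ} {e : ℤ} (hK : 1 ≤ K)
    (ha : |a| ≤ K * q ^ e) : √a ≤ K * halfPow q e :=
  (sqrt_le_of_abs_le hq (zero_le_one.trans hK) ha).trans
    (mul_le_mul_of_nonneg_right (Real.sqrt_le_iff.2 ⟨by linarith, by nlinarith⟩)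
      (halfPow_pos hq e).le)

theorem abs_cg_le_of (hq : q ∈ Set.Ioo (0 : ℝ) 1) {r : ℕ → ℕ → ℤ} {K₁ K₂ : ℝ} {e₁ e₂ : ℤ}
    (hK₁ : 1 ≤ K₁) (hK₂ : 1 ≤ K₂)
    (h₁ : |∏ k ∈ Finset.Icc 1 (i - 1), rowFactor ℓ q r m k| ≤ K₁ * q ^ e₁)
    (h₂ : |lastFactor ℓ q r m i| ≤ K₂ * q ^ e₂) :
    |cg ℓ q i r m| ≤ K₁ * K₂ * halfPow q (cgExponent ℓ i r m + e₁ + e₂) := by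
  have hE := (halfPow_pos hq (cgExponent ℓ i r m)).le
  have s1 := sqrt_le_of_abs_le_of_one_le hq hK₁ h₁
  have s2 := sqrt_le_of_abs_le_of_one_le hq hK₂ h₂
  rw [cg_eq, abs_mul, abs_mul, abs_mul, abs_of_nonneg (Real.sqrt_nonneg _),
    abs_of_nonneg (Real.sqrt_nonneg _)]
  change |halfPow q _| * _ * _ * _ ≤ _
  rw [abs_of_nonneg hE, ← halfPow_mul hq, ← halfPow_mul hq]
  calc _ ≤ halfPow q (cgExponent ℓ i r m) * 1 * (K₁ * halfPow q e₁) * (K₂ * halfPow q e₂) := by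
        refine mul_le_mul (mul_le_mul (mul_le_mul_of_nonneg_left (abs_sign_prod_le _ _) hE) s1
          (Real.sqrt_nonneg _) (by linarith)) s2 (Real.sqrt_nonneg _) ?_
        exact mul_nonneg (by linarith) ((Real.sqrt_nonneg _).trans s1)
    _ = _ := by ring

/-- The constant bounding the Clebsch–Gordan coefficients. -/
def cgBound (ℓ : ℕ) (q : ℝ) : ℝ := (qD q ^ 3) ^ ℓ * qD q ^ 2

theorem one_le_cgBound (ℓ : ℕ) (hq : q ∈ Set.Ioo (0 : ℝ) 1) : 1 ≤ cgBound ℓ q :=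
  one_le_mul_of_one_le_of_one_le (one_le_pow₀ (one_le_pow₀ (one_le_qD hq)))
    (one_le_pow₀ (one_le_qD hq))

open Classical in
/-- The order of a Clebsch–Gordan coefficient, for `i ≤ ℓ`. -/
theorem Admissible.abs_cg_le (hq : q ∈ Set.Ioo (0 : ℝ) 1) (hm : Admissible x i m) (hi : i ≤ ℓ) :
    |cg ℓ q i x.r m| ≤ cgBound ℓ q * halfPow q (cgExponent ℓ i x.r m +
      (x.cost m 1 - x.cost m i + x.gain m i) + (x.cost m i +
      if Lft ℓ m i then x.al (i + 1) - x.al i + x.dg (i + 1) - x.dg i - 1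
      else x.al i - x.al (i + 1) + x.dg i - x.dg (i + 1) + 1)) := by
  have hi1 := hm.one_le
  have hD := one_le_qD hq
  have hD3 : 1 ≤ qD q ^ 3 := one_le_pow₀ hD
  have h1 := hm.abs_prod_rowFactor_le hq (k := i - 1) (by omega) (by omega)
  have e : i - 1 + 1 = i := by omega
  rw [e] at h1
  refine abs_cg_le_of hq (one_le_pow₀ hD3) (one_le_pow₀ hD) (h1.trans ?_)
    (hm.abs_lastFactor_le hq hi)
  exact mul_le_mul_of_nonneg_right (pow_le_pow_right₀ hD3 (by omega)) (zpow_pos hq.1 _).le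

open Classical in
/-- The order of a Clebsch–Gordan coefficient, for `i = ℓ + 1`. -/
theorem Admissible.abs_cg_bottom_le (hq : q ∈ Set.Ioo (0 : ℝ) 1) (hℓ : 1 ≤ ℓ)
    (hm : Admissible x i m) (hi : i = ℓ + 1) :
    |cg ℓ q i x.r m| ≤ cgBound ℓ q * halfPow q (cgExponent ℓ i x.r m +
      (x.cost m 1 - x.cost m ℓ + x.gain m ℓ +
        if Lft ℓ m ℓ then x.h + x.al ℓ - x.dg (ℓ + 1) else x.dg (ℓ + 1) - x.dg ℓ + 1) + 0) := by
  have hD := one_le_qD hq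
  have hD3 : 1 ≤ qD q ^ 3 := one_le_pow₀ hD
  have h1 := hm.abs_prod_rowFactor_bottom_le hq hℓ hi
  have e : Finset.Icc 1 ℓ = Finset.Icc 1 (i - 1) := by rw [hi, Nat.add_sub_cancel]
  rw [e] at h1
  refine abs_cg_le_of hq (one_le_pow₀ hD3) (one_le_pow₀ hD) h1 ?_
  rw [hm.lastFactor_bottom q hi, abs_one, zpow_zero, mul_one]
  exact one_le_pow₀ hD

/-- The coefficient of the summand of `π(z_{ℓ+2-i}^*) |n, h; r⟩` with `m 1 = 1`. -/
def coefUp (ℓ : ℕ) (q : ℝ) (i : ℕ) (x : Label ℓ) (m : ℕ → ℕ) : ℝ :=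
  q ^ (-((ℓ : ℝ) + x.h) / 2) * (√(qInt q (x.n + 1)) / √(qInt q (x.n + x.h + ℓ + 1))) *
    (q ^ (ℓ + x.h) * q ^ (1 - (i : ℤ)) * cg ℓ q i x.r m)

/-- The coefficient of the summand of `π(z_{ℓ+2-i}^*) |n, h; r⟩` with `m 1 = ℓ + 1`. -/
def coefDown (ℓ : ℕ) (q : ℝ) (i : ℕ) (x : Label ℓ) (m : ℕ → ℕ) : ℝ :=
  q ^ (-(x.n : ℝ) / 2) * (√(qInt q (x.h + ℓ - 1)) / √(qInt q (x.n + x.h + ℓ - 1))) *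
    (q ^ (1 - (i : ℤ)) * cg ℓ q i x.r m)

theorem sqrt_qInt_div_le (hq : q ∈ Set.Ioo (0 : ℝ) 1) {a c : ℤ} (ha : 0 ≤ a) (hc : 1 ≤ c) :
    √(qInt q a) / √(qInt q c) ≤ qD q * halfPow q (c - a) := by
  rw [← Real.sqrt_div (qInt_nonneg hq ha)]
  exact sqrt_le_of_abs_le_of_one_le hq (one_le_qD hq)
    (abs_qInt_div_le hq a c ⟨ha, Or.inl rfl⟩ ⟨hc, Or.inl rfl⟩)

/-- The order of a Clebsch–Gordan coefficient, in half-integral powers of `q`. If `m` starts with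
first entries, the order is bounded below independently of `x`, since the gain `2 (h - dg i)` of
passing to last entries compensates the loss in `cgExponent`. If `m` starts with last entries and
raises a first entry in some row, the order is at least `2 h` up to a constant. -/
theorem Admissible.exists_cg_le (hq : q ∈ Set.Ioo (0 : ℝ) 1) (hℓ : 1 ≤ ℓ)
    (hm : Admissible x i m) :
    ∃ e : ℤ, |cg ℓ q i x.r m| ≤ cgBound ℓ q * halfPow q e ∧
      (m 1 = 1 → 2 * i - 2 * ℓ - 4 ≤ e) ∧
      (m 1 ≠ 1 → (∃ k, 1 ≤ k ∧ k ≤ i ∧ Lft ℓ m k) → 2 * x.h + 2 * i - 4 ≤ e) := by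
  have hi1 := hm.one_le
  have hi2 := hm.le
  have n1 := x.al_one hℓ
  have L1 : m 1 = 1 → Lft ℓ m 1 := fun h => ⟨h, hℓ⟩
  have R1 : m 1 ≠ 1 → ¬ Lft ℓ m 1 := fun h H => h H.1
  have d1 := x.dg_one
  rcases hi2.lt_or_eq with hi | hi
  · have hi : i ≤ ℓ := by omega
    refine ⟨_, hm.abs_cg_le hq hi, ?_, ?_⟩
    · intro h
      have h := L1 h
      have a1 := x.al_nonneg (k := i + 1) (by omega)
      have d2 := x.dg_le_succ hi1 hi
      rw [hm.cgExponent_eq hi]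
      simp only [Label.cost, Label.chosen, if_pos h, Label.posL, Label.posR]
      by_cases h' : Lft ℓ m i
      · simp only [if_pos h', x.gain_of_lft h']
        omega
      · have g : x.gain m i = 2 * (x.h - x.dg i) := by
          refine if_pos ⟨h', 1, le_rfl, ?_, h⟩
          rcases hi1.eq_or_lt with rfl | h1
          · exact absurd h h'
          · exact h1
        simp only [if_neg h', g]
        omega
    · rintro h ⟨k, hk1, hk2, hk⟩
      have h := R1 h
      have a1 := x.al_nonneg (k := i + 1) (by omega)
      have d2 := x.dg_le_succ hi1 hi
      rw [hm.cgExponent_eq hi]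
      simp only [Label.cost, Label.chosen, if_neg h, Label.posL, Label.posR]
      by_cases h' : Lft ℓ m i
      · simp only [if_pos h', x.gain_of_lft h']
        omega
      · have g : x.gain m i = 2 * (x.h - x.dg i) := by
          refine if_pos ⟨h', k, hk1, ?_, hk⟩
          rcases hk2.eq_or_lt with rfl | h1
          · exact absurd hk h'
          · exact h1
        simp only [if_neg h', g]
        omega
  · refine ⟨_, hm.abs_cg_bottom_le hq hℓ hi, ?_, ?_⟩
    · intro h
      have h := L1 h
      have hb : ¬ Lft ℓ m i := fun H => by
        have := H.2
        omega
      have d2 := x.dg_le_succ hℓ le_rfl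
      have d3 := x.dg_last_le hℓ
      rw [hm.cgExponent_bottom hi]
      subst hi
      simp only [Label.cost, Label.chosen, if_pos h, if_neg hb, Label.posL, Label.posR]
      by_cases h' : Lft ℓ m ℓ
      · simp only [if_pos h', x.gain_of_lft h']
        omega
      · have g : x.gain m ℓ = 2 * (x.h - x.dg ℓ) := by
          refine if_pos ⟨h', 1, le_rfl, ?_, h⟩
          rcases hℓ.eq_or_lt with rfl | h1
          · exact absurd h h'
          · exact h1
        simp only [if_neg h', g]
        omega
    · rintro h ⟨k, hk1, hk2, hk⟩
      have h := R1 h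
      have hb : ¬ Lft ℓ m i := fun H => by
        have := H.2
        omega
      have d2 := x.dg_le_succ hℓ le_rfl
      have d3 := x.dg_last_le hℓ
      have hkℓ := hk.2
      rw [hm.cgExponent_bottom hi]
      subst hi
      simp only [Label.cost, Label.chosen, if_neg h, if_neg hb, Label.posL, Label.posR]
      by_cases h' : Lft ℓ m ℓ
      · simp only [if_pos h', x.gain_of_lft h']
        omega
      · have g : x.gain m ℓ = 2 * (x.h - x.dg ℓ) := by
          refine if_pos ⟨h', k, hk1, ?_, hk⟩
          rcases hkℓ.eq_or_lt with rfl | h1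
          · exact absurd hk h'
          · exact h1
        simp only [if_neg h', g]
        omega

/-- The constant bounding the coefficients relative to `q ^ h`. -/
def coefBound (ℓ : ℕ) (q : ℝ) : ℝ := qD q * cgBound ℓ q * halfPow q (-2)

theorem coefBound_nonneg (ℓ : ℕ) (hq : q ∈ Set.Ioo (0 : ℝ) 1) : 0 ≤ coefBound ℓ q :=
  mul_nonneg (mul_nonneg (zero_le_one.trans (one_le_qD hq))
    (zero_le_one.trans (one_le_cgBound ℓ hq))) (halfPow_pos hq _).le

/-- The prefactor of the summands with `m 1 = 1` has the order `q ^ h`. -/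
theorem abs_coefUp_le (hq : q ∈ Set.Ioo (0 : ℝ) 1) (hℓ : 1 ≤ ℓ) (hm : Admissible x i m)
    (h1 : m 1 = 1) : |coefUp ℓ q i x m| ≤ coefBound ℓ q * q ^ x.h := by
  obtain ⟨e, he, he1, -⟩ := hm.exists_cg_le hq hℓ
  have he1 := he1 h1
  have hK := zero_le_one.trans (one_le_cgBound ℓ hq)
  have s1 := sqrt_qInt_div_le hq (a := x.n + 1) (c := x.n + x.h + ℓ + 1) (by omega) (by omega)
  have p0 : q ^ (-((ℓ : ℝ) + x.h) / 2) = halfPow q (-(ℓ + x.h)) := by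
    rw [halfPow]
    push_cast
    rfl
  rw [coefUp, p0, pow_eq_halfPow, zpow_eq_halfPow, abs_mul, abs_mul, abs_mul, abs_mul,
    abs_of_pos (halfPow_pos hq _), abs_of_pos (halfPow_pos hq _), abs_of_pos (halfPow_pos hq _),
    abs_of_nonneg (div_nonneg (Real.sqrt_nonneg _) (Real.sqrt_nonneg _))]
  calc _ ≤ halfPow q (-(ℓ + x.h)) * (qD q * halfPow q (x.n + x.h + ℓ + 1 - (x.n + 1))) *
        (halfPow q (2 * (ℓ + x.h : ℕ)) * halfPow q (2 * (1 - i)) *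
          (cgBound ℓ q * halfPow q e)) := by
        have := halfPow_pos hq (-(ℓ + x.h))
        have := halfPow_pos hq (2 * (ℓ + x.h : ℕ))
        have := halfPow_pos hq (2 * (1 - i))
        have s0 := (div_nonneg (Real.sqrt_nonneg _) (Real.sqrt_nonneg _)).trans s1
        gcongr
    _ = qD q * cgBound ℓ q * halfPow q (-(ℓ + x.h) + (x.n + x.h + ℓ + 1 - (x.n + 1)) +
          2 * (ℓ + x.h : ℕ) + 2 * (1 - i) + e) := by
        rw [← halfPow_mul hq, ← halfPow_mul hq, ← halfPow_mul hq, ← halfPow_mul hq]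
        ring
    _ ≤ qD q * cgBound ℓ q * halfPow q (-2 + 2 * x.h) := by
        refine mul_le_mul_of_nonneg_left (halfPow_le hq ?_)
          (mul_nonneg (zero_le_one.trans (one_le_qD hq)) hK)
        push_cast
        omega
    _ = _ := by
        rw [← halfPow_mul hq, coefBound, pow_eq_halfPow]
        ring

/-- The coefficients of the summands with `m 1 = ℓ + 1` are of order `q ^ h` when a first entry is
raised. The hypothesis `1 ≤ h` holds whenever the target is a label, and it excludes the quotient
`0 / 0` of `q`-integers. -/
theorem abs_coefDown_le (hq : q ∈ Set.Ioo (0 : ℝ) 1) (hℓ : 1 ≤ ℓ) (hm : Admissible x i m)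
    (hh : 1 ≤ x.h) (h1 : m 1 ≠ 1) (hk : ∃ k, 1 ≤ k ∧ k ≤ i ∧ Lft ℓ m k) :
    |coefDown ℓ q i x m| ≤ coefBound ℓ q * q ^ x.h := by
  obtain ⟨e, he, -, he1⟩ := hm.exists_cg_le hq hℓ
  have he1 := he1 h1 hk
  have hK := zero_le_one.trans (one_le_cgBound ℓ hq)
  have s1 := sqrt_qInt_div_le hq (a := x.h + ℓ - 1) (c := x.n + x.h + ℓ - 1) (by omega) (by omega)
  have p0 : q ^ (-(x.n : ℝ) / 2) = halfPow q (-x.n) := by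
    rw [halfPow]
    push_cast
    rfl
  rw [coefDown, p0, zpow_eq_halfPow, abs_mul, abs_mul, abs_mul,
    abs_of_pos (halfPow_pos hq _), abs_of_pos (halfPow_pos hq _),
    abs_of_nonneg (div_nonneg (Real.sqrt_nonneg _) (Real.sqrt_nonneg _))]
  calc _ ≤ halfPow q (-x.n) * (qD q * halfPow q (x.n + x.h + ℓ - 1 - (x.h + ℓ - 1))) *
        (halfPow q (2 * (1 - i)) * (cgBound ℓ q * halfPow q e)) := by
        have := halfPow_pos hq (-x.n)
        have := halfPow_pos hq (2 * (1 - i))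
        have s0 := (div_nonneg (Real.sqrt_nonneg _) (Real.sqrt_nonneg _)).trans s1
        gcongr
    _ = qD q * cgBound ℓ q * halfPow q (-x.n + (x.n + x.h + ℓ - 1 - (x.h + ℓ - 1)) +
          2 * (1 - i) + e) := by
        rw [← halfPow_mul hq, ← halfPow_mul hq, ← halfPow_mul hq]
        ring
    _ ≤ qD q * cgBound ℓ q * halfPow q (-2 + 2 * x.h) := by
        refine mul_le_mul_of_nonneg_left (halfPow_le hq ?_)
          (mul_nonneg (zero_le_one.trans (one_le_qD hq)) hK)
        omega
    _ = _ := by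
        rw [← halfPow_mul hq, coefBound, pow_eq_halfPow]
        ring

end Coefficients

/-! ### The leading coefficients -/

section Near

/-- `x` is nonnegative and equal to `1` up to an error `(c - 1) ε`. The constants are normalized so
that they multiply under products. -/
structure Near (ε c x : ℝ) : Prop where
  nonneg : 0 ≤ x
  one_le : 1 ≤ c
  abs_sub_one_le : |x - 1| ≤ (c - 1) * ε

variable {ε c c' x y q : ℝ}

theorem Near.one (ε : ℝ) : Near ε 1 1 := ⟨zero_le_one, le_rfl, by simp⟩

theorem Near.mul (h0 : 0 ≤ ε) (h1 : ε ≤ 1) (hx : Near ε c x) (hy : Near ε c' y) :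
    Near ε (c * c') (x * y) := by
  refine ⟨mul_nonneg hx.nonneg hy.nonneg, one_le_mul_of_one_le_of_one_le hx.one_le hy.one_le, ?_⟩
  have e : x * y - 1 = (x - 1) * y + (y - 1) := by ring
  have hy1 : y ≤ c' := by
    have := (abs_le.1 hy.abs_sub_one_le).2
    nlinarith [hy.one_le]
  have h2 : |(x - 1) * y| ≤ (c - 1) * ε * c' := by
    rw [abs_mul, abs_of_nonneg hy.nonneg]
    exact mul_le_mul hx.abs_sub_one_le hy1 hy.nonneg (mul_nonneg (sub_nonneg.2 hx.one_le) h0)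
  rw [e]
  refine (abs_add_le _ _).trans ((add_le_add h2 hy.abs_sub_one_le).trans (le_of_eq (by ring)))

/-- Square roots of nonnegative numbers are at least as close to `1`. -/
theorem Near.abs_sqrt_sub_one_le (hx : Near ε c x) : |√x - 1| ≤ (c - 1) * ε := by
  refine le_trans ?_ hx.abs_sub_one_le
  have h1 : x - 1 = (√x - 1) * (√x + 1) := by
    have := Real.mul_self_sqrt hx.nonneg
    linear_combination -this
  have h2 : 1 ≤ |√x + 1| := by
    rw [abs_of_nonneg (by positivity)]
    linarith [Real.sqrt_nonneg x]
  rw [h1, abs_mul]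
  exact le_mul_of_one_le_right (abs_nonneg _) h2

theorem near_qPhi_div (hq : q ∈ Set.Ioo (0 : ℝ) 1) {s a b : ℤ} (ha : 1 ≤ a) (hb : 1 ≤ b)
    (hsa : s ≤ a) (hsb : s ≤ b) : Near (q ^ (2 * s)) (1 + qD q) (qPhi q a / qPhi q b) := by
  have hb0 := qPhi_pos hq hb
  have hD := one_le_qD hq
  refine ⟨div_nonneg (qPhi_pos hq ha).le hb0.le, by linarith, ?_⟩
  have e : qPhi q a / qPhi q b - 1 = (qPhi q a - qPhi q b) * (qPhi q b)⁻¹ := by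
    field_simp
  have h1 : |qPhi q a - qPhi q b| ≤ q ^ (2 * s) := by
    have a1 := qPhi_le_one hq a
    have a2 := qPhi_le_one hq b
    have a3 := one_sub_zpow_le_qPhi hq hsa
    have a4 := one_sub_zpow_le_qPhi hq hsb
    rw [abs_le]
    constructor <;> linarith
  have h2 : (qPhi q b)⁻¹ ≤ qD q := inv_anti₀ (one_sub_sq_pos hq) (one_sub_sq_le_qPhi hq hb)
  rw [e, abs_mul, abs_of_pos (inv_pos.2 hb0), add_sub_cancel_left, mul_comm]
  exact mul_le_mul h2 h1 (abs_nonneg _) (by linarith)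

theorem near_one_div_qPhi (hq : q ∈ Set.Ioo (0 : ℝ) 1) {s b : ℤ} (hb : 1 ≤ b) (hsb : s ≤ b) :
    Near (q ^ (2 * s)) (1 + qD q) (1 / qPhi q b) := by
  have hb0 := qPhi_pos hq hb
  have hD := one_le_qD hq
  refine ⟨div_nonneg zero_le_one hb0.le, by linarith, ?_⟩
  have e : 1 / qPhi q b - 1 = (1 - qPhi q b) * (qPhi q b)⁻¹ := by
    field_simp
  have h1 : |1 - qPhi q b| ≤ q ^ (2 * s) := by
    have a2 := qPhi_le_one hq b
    have a4 := one_sub_zpow_le_qPhi hq hsb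
    rw [abs_le]
    constructor <;> linarith
  have h2 : (qPhi q b)⁻¹ ≤ qD q := inv_anti₀ (one_sub_sq_pos hq) (one_sub_sq_le_qPhi hq hb)
  rw [e, abs_mul, abs_of_pos (inv_pos.2 hb0), add_sub_cancel_left, mul_comm]
  exact mul_le_mul h2 h1 (abs_nonneg _) (by linarith)

end Near

section Leading

variable {ℓ : ℕ} {x : Label ℓ} {i : ℕ} {m : ℕ → ℕ} {q : ℝ} {s : ℤ}

theorem exists_near_qInt_div (hq : q ∈ Set.Ioo (0 : ℝ) 1) {a c : ℤ} (s e : ℤ) (ha : 1 ≤ a)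
    (hc : 1 ≤ c) (hsa : s ≤ a) (hsc : s ≤ c) (he : c - a = e) :
    ∃ Φ, Near (q ^ (2 * s)) (1 + qD q) Φ ∧ qInt q a / qInt q c = q ^ e * Φ :=
  ⟨_, near_qPhi_div hq ha hc hsa hsc, he ▸ qInt_div_qInt hq a c⟩

theorem Label.chosen_of_not_lft (x : Label ℓ) {k : ℕ} (h : ¬ Lft ℓ m k) :
    x.chosen m k = x.dg k - (ℓ + 2 - k) := if_neg h

theorem Label.other_of_not_lft (x : Label ℓ) {k : ℕ} (h : ¬ Lft ℓ m k) :
    x.other m k = x.h + x.al k - 1 := if_neg h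

theorem Label.cost_of_not_lft (x : Label ℓ) {k : ℕ} (h : ¬ Lft ℓ m k) :
    x.cost m k = x.h - x.dg k + ℓ - k := if_neg h

/-- When only last entries are raised, a row factor is a power of `q` up to a factor near one. -/
theorem Admissible.rowFactor_near (hq : q ∈ Set.Ioo (0 : ℝ) 1) (hm : Admissible x i m)
    (hR : ∀ k, 1 ≤ k → k ≤ i → ¬ Lft ℓ m k) (hs0 : 0 ≤ s) (hs : ∀ k, 1 ≤ k → k ≤ i → k ≤ ℓ →
      s ≤ x.h - x.dg k)
    {k : ℕ} (hk : 1 ≤ k) (hki : k + 1 ≤ i) (hkℓ : k + 1 ≤ ℓ) :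
    ∃ Φ, Near (q ^ (2 * s)) ((1 + qD q) ^ 3) Φ ∧
      rowFactor ℓ q x.r m k = q ^ (x.cost m k - x.cost m (k + 1)) * Φ := by
  have hq0 : q ≠ 0 := hq.1.ne'
  have hε0 := (zpow_pos hq.1 (2 * s)).le
  have hε1 : q ^ (2 * s) ≤ 1 := zpow_le_one_of_nonneg hq (by omega)
  have h := hR k hk (by omega)
  have h' := hR (k + 1) (by omega) hki
  have lt1 := hm.dg_lt k hk (by omega) (by omega) fun H => h ⟨H, by omega⟩
  have lt2 := hm.dg_lt (k + 1) (by omega) hki hkℓ fun H => h' ⟨H, hkℓ⟩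
  have s1 := hs k hk (by omega) (by omega)
  have s2 := hs (k + 1) (by omega) hki hkℓ
  have a0 := x.al_nonneg (k := k + 1) (by omega)
  have a1 := x.al_succ_le hk
  have d1 := x.dg_le_succ hk (by omega)
  have c1 := x.chosen_of_not_lft h
  have c2 := x.chosen_of_not_lft h'
  have o1 := x.other_of_not_lft h
  have o2 := x.other_of_not_lft h'
  obtain ⟨Φ₁, n1, e1⟩ := exists_near_qInt_div hq (a := x.h - 2 - x.chosen m (k + 1))
    (c := x.h - 2 - x.chosen m k) s (x.chosen m (k + 1) - x.chosen m k)
    (by omega) (by omega) (by omega) (by omega) (by omega)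
  obtain ⟨Φ₂, n2, e2⟩ := exists_near_qInt_div hq (a := x.other m k - x.chosen m (k + 1))
    (c := x.other m k - x.chosen m k) s (x.chosen m (k + 1) - x.chosen m k)
    (by omega) (by omega) (by omega) (by omega) (by omega)
  obtain ⟨Φ₃, n3, e3⟩ := exists_near_qInt_div hq (a := x.other m (k + 1) - x.chosen m k - 1)
    (c := x.other m (k + 1) - x.chosen m (k + 1) - 1) s (x.chosen m k - x.chosen m (k + 1))
    (by omega) (by omega) (by omega) (by omega) (by omega)
  refine ⟨Φ₁ * Φ₂ * Φ₃, ?_, ?_⟩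
  · have := (n1.mul hε0 hε1 n2).mul hε0 hε1 n3
    rwa [← pow_two, ← pow_succ] at this
  · have e4 : x.cost m k - x.cost m (k + 1) = (x.chosen m (k + 1) - x.chosen m k) +
        (x.chosen m (k + 1) - x.chosen m k) + (x.chosen m k - x.chosen m (k + 1)) := by
      rw [x.cost_of_not_lft h, x.cost_of_not_lft h']
      omega
    rw [hm.rowFactor_eq hq hk hki hkℓ, e1, e2, e3, e4, zpow_add₀ hq0, zpow_add₀ hq0,
      mul_mul_mul_comm _ Φ₁ _ Φ₂, mul_mul_mul_comm _ (Φ₁ * Φ₂) _ Φ₃]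

theorem Admissible.prod_rowFactor_near (hq : q ∈ Set.Ioo (0 : ℝ) 1) (hm : Admissible x i m)
    (hR : ∀ k, 1 ≤ k → k ≤ i → ¬ Lft ℓ m k) (hs0 : 0 ≤ s) (hs : ∀ k, 1 ≤ k → k ≤ i → k ≤ ℓ →
      s ≤ x.h - x.dg k) {k : ℕ} (hki : k + 1 ≤ i) (hkℓ : k + 1 ≤ ℓ) :
    ∃ Φ, Near (q ^ (2 * s)) (((1 + qD q) ^ 3) ^ k) Φ ∧
      ∏ j ∈ Finset.Icc 1 k, rowFactor ℓ q x.r m j =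
        q ^ (x.cost m 1 - x.cost m (k + 1)) * Φ := by
  induction k with
  | zero => exact ⟨1, Near.one _, by simp⟩
  | succ k ih =>
    obtain ⟨Φ, h1, h2⟩ := ih (by omega) (by omega)
    obtain ⟨Ψ, h3, h4⟩ := hm.rowFactor_near hq hR hs0 hs (k := k + 1) (by omega) hki hkℓ
    refine ⟨Φ * Ψ, h1.mul (zpow_pos hq.1 _).le (zpow_le_one_of_nonneg hq (by omega)) h3, ?_⟩
    rw [Finset.prod_Icc_succ_top (by omega), h2, h4, mul_mul_mul_comm, ← zpow_add₀ hq.1.ne']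
    congr 2
    ring

/-- The bottom row factor, when only last entries are raised. -/
theorem Admissible.rowFactor_bottom_near (hq : q ∈ Set.Ioo (0 : ℝ) 1) (hℓ : 1 ≤ ℓ)
    (hm : Admissible x i m) (hi : i = ℓ + 1) (hR : ∀ k, 1 ≤ k → k ≤ i → ¬ Lft ℓ m k)
    (hs : s ≤ x.h - x.dg ℓ) (hs' : s ≤ x.h + x.al ℓ - x.dg (ℓ + 1)) :
    ∃ Φ, Near (q ^ (2 * s)) (1 + qD q) Φ ∧
      rowFactor ℓ q x.r m ℓ = q ^ (x.dg (ℓ + 1) - x.dg ℓ + 1) * Φ := by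
  have h := hR ℓ hℓ (by omega)
  have h' := hR (ℓ + 1) (by omega) (by omega)
  have lt1 := hm.dg_lt ℓ hℓ (by omega) le_rfl fun H => h ⟨H, by omega⟩
  have lt2 := hm.dg_last_lt hi fun H => h ⟨H, by omega⟩
  have a0 := x.al_nonneg hℓ
  have c1 := x.chosen_of_not_lft h
  have c2 := x.chosen_of_not_lft h'
  have o1 := x.other_of_not_lft h
  rw [hm.rowFactor_last q hℓ hi]
  exact exists_near_qInt_div hq s _ (by omega) (by omega) (by omega) (by omega) (by omega)

/-- The last factor, when only last entries are raised. -/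
theorem Admissible.lastFactor_near (hq : q ∈ Set.Ioo (0 : ℝ) 1) (hm : Admissible x i m)
    (hi : i ≤ ℓ) (hR : ∀ k, 1 ≤ k → k ≤ i → ¬ Lft ℓ m k) (hs0 : 0 ≤ s)
    (hs : s ≤ x.h - x.dg i) :
    ∃ Φ, Near (q ^ (2 * s)) ((1 + qD q) ^ 2) Φ ∧
      lastFactor ℓ q x.r m i =
        q ^ (x.cost m i + (x.al i - x.al (i + 1) + x.dg i - x.dg (i + 1) + 1)) *
          (qPhi q (x.dg (i + 1) - x.dg i) * Φ) := by
  have hi1 := hm.one_le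
  have h := hR i hi1 le_rfl
  have lt1 := hm.dg_lt i hi1 le_rfl hi fun H => h ⟨H, by omega⟩
  have a0 := x.al_nonneg (k := i + 1) (by omega)
  have a1 := x.al_succ_le hi1
  have c1 := x.chosen_of_not_lft h
  have o1 := x.other_of_not_lft h
  have e0 : x.posR (i + 1) - x.chosen m i - 1 = x.dg (i + 1) - x.dg i := by
    simp only [Label.posR]
    omega
  have e1 : x.posL (i + 1) = x.h + x.al (i + 1) - 1 := rfl
  obtain ⟨Φ, n1, e2⟩ := exists_near_qInt_div hq (a := x.posL (i + 1) - x.chosen m i - 1)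
    (c := x.other m i - x.chosen m i) s (x.al i - x.al (i + 1) + 1)
    (by omega) (by omega) (by omega) (by omega) (by omega)
  have n2 := near_one_div_qPhi hq (s := s) (b := x.h - 2 - x.chosen m i) (by omega) (by omega)
  refine ⟨Φ * (1 / qPhi q (x.h - 2 - x.chosen m i)), ?_, ?_⟩
  · have := n1.mul (zpow_pos hq.1 _).le (zpow_le_one_of_nonneg hq (by omega)) n2
    rwa [← pow_two] at this
  · have e3 : x.cost m i + (x.al i - x.al (i + 1) + x.dg i - x.dg (i + 1) + 1) =
        (x.al i - x.al (i + 1) + 1) + (x.h - 2 - x.chosen m i - (x.dg (i + 1) - x.dg i)) := by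
      rw [x.cost_of_not_lft h]
      omega
    rw [hm.lastFactor_eq hq hi, e0, e2, qInt_div_qInt hq, e3, mul_mul_mul_comm,
      ← zpow_add₀ hq.1.ne', div_eq_mul_one_div (qPhi q (x.dg (i + 1) - x.dg i)),
      mul_left_comm Φ]

/-- The weight of `ρ(z_{ℓ+2-i})^*` on the vector labelled by `x`. -/
def leadWeight (q : ℝ) (x : Label ℓ) (i : ℕ) : ℝ :=
  q ^ x.dg i * √(if i = ℓ + 1 then 1 else qPhi q (x.dg (i + 1) - x.dg i))

/-- The constant bounding the deviation of the leading coefficients. -/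
def leadBound (ℓ : ℕ) (q : ℝ) : ℝ := (1 + qD q) * ((1 + qD q) ^ 3) ^ ℓ * (1 + qD q) ^ 2

theorem Near.mono {ε c c' x : ℝ} (h0 : 0 ≤ ε) (hx : Near ε c x) (hc : c ≤ c') : Near ε c' x :=
  ⟨hx.nonneg, hx.one_le.trans hc,
    hx.abs_sub_one_le.trans (mul_le_mul_of_nonneg_right (by linarith) h0)⟩

/-- A coefficient for which only last entries are raised agrees with the weight of the symbol
representation up to `O(q ^ h)`. -/
theorem abs_coefDown_sub_le (hq : q ∈ Set.Ioo (0 : ℝ) 1) (hℓ : 1 ≤ ℓ) (hm : Admissible x i m)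
    (hR : ∀ k, 1 ≤ k → k ≤ i → ¬ Lft ℓ m k) :
    |coefDown ℓ q i x m - leadWeight q x i| ≤ leadBound ℓ q * q ^ x.h := by
  have hq0 : q ≠ 0 := hq.1.ne'
  have hi1 := hm.one_le
  have hi2 := hm.le
  have hD := one_le_qD hq
  have hD1 : 1 ≤ 1 + qD q := by linarith
  have hD3 : 1 ≤ (1 + qD q) ^ 3 := one_le_pow₀ hD1
  have r1 := hR 1 le_rfl hi1
  have lt1 := hm.dg_lt 1 le_rfl hi1 hℓ fun H => r1 ⟨H, by omega⟩
  rw [x.dg_one] at lt1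
  have dn := x.dg_nonneg hi1 hi2
  -- the `q`-integers whose quotients are compared with powers of `q` have arguments at least `s`,
  -- so the relative error is of order `q ^ (2 s)`; times the leading weight, which is at most
  -- `q ^ (dg i)`, this is at most of order `q ^ h`
  obtain ⟨s, hs⟩ : ∃ s, s = max 0 (x.h - x.dg i) := ⟨_, rfl⟩
  have hs0 : 0 ≤ s := by omega
  have hsk : ∀ k, 1 ≤ k → k ≤ i → k ≤ ℓ → s ≤ x.h - x.dg k := by
    intro k hk hki hkℓ
    have h1 := x.dg_le hk hkℓ
    have h2 := x.dg_mono hk hki hi2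
    omega
  have hε0 := (zpow_pos hq.1 (2 * s)).le
  have hε1 : q ^ (2 * s) ≤ 1 := zpow_le_one_of_nonneg hq (by omega)
  have hsgn : (∏ k ∈ Finset.Icc 1 (i - 1), if m (k + 1) < m k then (1 : ℝ) else -1) = 1 := by
    refine Finset.prod_eq_one fun k hk => if_pos ?_
    rw [Finset.mem_Icc] at hk
    rw [hm.eq_of_not_lft hk.1 (by omega) (hR k hk.1 (by omega)),
      hm.eq_of_not_lft (by omega) (by omega) (hR (k + 1) (by omega) (by omega))]
    omega
  have p0 : q ^ (-(x.n : ℝ) / 2) = halfPow q (-x.n) := by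
    rw [halfPow]
    push_cast
    rfl
  -- all square roots are collected into that of the weight and that of a factor near one
  obtain ⟨Φ, w, E, hΦ, hw0, hw, hE, heq⟩ : ∃ Φ w : ℝ, ∃ E : ℤ,
      Near (q ^ (2 * s)) (((1 + qD q) ^ 3) ^ ℓ * (1 + qD q) ^ 2) Φ ∧ 0 ≤ w ∧
      w = (if i = ℓ + 1 then 1 else qPhi q (x.dg (i + 1) - x.dg i)) ∧
      cgExponent ℓ i x.r m + E + 2 * (1 - i) = 2 * x.dg i ∧
      √(∏ k ∈ Finset.Icc 1 (i - 1), rowFactor ℓ q x.r m k) * √(lastFactor ℓ q x.r m i) =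
        halfPow q E * √w * √Φ := by
    rcases hi2.lt_or_eq with hi | hi
    · have hi : i ≤ ℓ := by omega
      have e : i - 1 + 1 = i := by omega
      obtain ⟨Φ₁, h1, h2⟩ := hm.prod_rowFactor_near hq hR hs0 hsk (k := i - 1) (by omega) (by omega)
      obtain ⟨Φ₂, h3, h4⟩ := hm.lastFactor_near hq hi hR hs0 (hsk i hi1 le_rfl hi)
      have hw : 0 ≤ qPhi q (x.dg (i + 1) - x.dg i) :=
        qPhi_nonneg hq (sub_nonneg.2 (x.dg_le_succ hi1 hi))
      rw [e] at h2
      refine ⟨Φ₁ * Φ₂, qPhi q (x.dg (i + 1) - x.dg i), (x.cost m 1 - x.cost m i) +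
          (x.cost m i + (x.al i - x.al (i + 1) + x.dg i - x.dg (i + 1) + 1)),
        (h1.mono hε0 (pow_le_pow_right₀ hD3 (by omega))).mul hε0 hε1 h3, hw,
        (if_neg (by omega)).symm, ?_, ?_⟩
      · rw [hm.cgExponent_eq hi]
        simp only [Label.chosen, Label.cost, if_neg r1, if_neg (hR i hi1 le_rfl), Label.posR,
          x.dg_one]
        push_cast
        ring
      · rw [h2, h4, Real.sqrt_mul (zpow_pos hq.1 _).le, Real.sqrt_mul (zpow_pos hq.1 _).le,
          Real.sqrt_mul hw, Real.sqrt_mul h1.nonneg, sqrt_zpow hq, sqrt_zpow hq,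
          mul_mul_mul_comm, halfPow_mul hq, mul_left_comm (√Φ₁), mul_assoc (halfPow q _)]
    · have lt2 := hm.dg_last_lt hi fun H => hR ℓ hℓ (by omega) ⟨H, le_rfl⟩
      have a0 := x.al_nonneg hℓ
      have hsℓ := hsk ℓ hℓ (by omega) le_rfl
      obtain ⟨Φ₁, h1, h2⟩ := hm.prod_rowFactor_near hq hR hs0 hsk (k := ℓ - 1) (by omega) (by omega)
      obtain ⟨Φ₂, h3, h4⟩ := hm.rowFactor_bottom_near hq hℓ hi hR hsℓ (by rw [hi] at hs; omega)
      have e : ℓ - 1 + 1 = ℓ := by omega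
      have e2 : Finset.Icc 1 (i - 1) = insert ℓ (Finset.Icc 1 (ℓ - 1)) := by
        ext j
        simp only [Finset.mem_Icc, Finset.mem_insert]
        omega
      rw [e] at h2
      refine ⟨Φ₁ * Φ₂, 1, (x.cost m 1 - x.cost m ℓ) + (x.dg (ℓ + 1) - x.dg ℓ + 1),
        (h1.mono hε0 (pow_le_pow_right₀ hD3 (by omega))).mul hε0 hε1
          (h3.mono hε0 (le_self_pow₀ hD1 (by omega))), zero_le_one, (if_pos hi).symm, ?_, ?_⟩
      · rw [hm.cgExponent_bottom hi]
        subst hi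
        simp only [Label.chosen, Label.cost, if_neg r1, if_neg (hR ℓ hℓ (by omega)),
          if_neg (hR (ℓ + 1) (by omega) le_rfl), Label.posR, x.dg_one]
        push_cast
        ring
      · rw [hm.lastFactor_bottom q hi, e2, Finset.prod_insert (by simp; omega), h2, h4,
          mul_comm, Real.sqrt_one, one_mul, mul_mul_mul_comm, ← zpow_add₀ hq0,
          Real.sqrt_mul (zpow_pos hq.1 _).le, sqrt_zpow hq, mul_one, mul_comm Φ₂]
        congr 2
        ring
  have hpre : √(qInt q (x.h + ℓ - 1)) / √(qInt q (x.n + x.h + ℓ - 1)) =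
      halfPow q x.n * √(qPhi q (x.h + ℓ - 1) / qPhi q (x.n + x.h + ℓ - 1)) := by
    rw [← Real.sqrt_div (qInt_nonneg hq (by omega)), qInt_div_qInt hq,
      Real.sqrt_mul (zpow_pos hq.1 _).le, sqrt_zpow hq]
    congr 2
    ring
  have hΨ := (near_qPhi_div hq (s := s) (a := x.h + ℓ - 1) (b := x.n + x.h + ℓ - 1) (by omega)
    (by omega) (by omega) (by omega)).mul hε0 hε1 hΦ
  have hcoef : coefDown ℓ q i x m = q ^ x.dg i * √w *
      √(qPhi q (x.h + ℓ - 1) / qPhi q (x.n + x.h + ℓ - 1) * Φ) := by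
    rw [coefDown, p0, hpre, cg_eq, hsgn, mul_one, mul_assoc (q ^ _) (√_) (√_), heq,
      zpow_eq_halfPow q (x.dg i), ← hE, Real.sqrt_mul (div_nonneg (qPhi_pos hq (by omega)).le
        (qPhi_pos hq (by omega)).le), zpow_eq_halfPow, ← halfPow_mul hq, ← halfPow_mul hq]
    have h1 : halfPow q (-x.n) * halfPow q x.n = 1 := by
      rw [halfPow_mul hq, neg_add_cancel]
      simp [halfPow]
    change _ * _ * (_ * (halfPow q _ * _)) = _
    linear_combination (√(qPhi q (x.h + ℓ - 1) / qPhi q (x.n + x.h + ℓ - 1)) *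
      halfPow q (2 * (1 - i)) * halfPow q (cgExponent ℓ i x.r m) * halfPow q E * √w * √Φ) * h1
  have hw1 : √w ≤ 1 := by
    refine Real.sqrt_le_one.2 ?_
    rw [hw]
    split_ifs
    · exact le_rfl
    · exact qPhi_le_one hq _
  have hc : 0 ≤ leadBound ℓ q - 1 := by
    have := hΨ.one_le
    rw [leadBound, mul_assoc]
    linarith
  rw [hcoef, leadWeight, ← hw, ← mul_sub_one, abs_mul,
    abs_of_nonneg (mul_nonneg (zpow_pos hq.1 _).le (Real.sqrt_nonneg _))]
  calc _ ≤ q ^ x.dg i * 1 * ((leadBound ℓ q - 1) * q ^ (2 * s)) := by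
        have h1 := hΨ.abs_sqrt_sub_one_le
        rw [← mul_assoc] at h1
        have := zpow_pos hq.1 (x.dg i)
        exact mul_le_mul (mul_le_mul_of_nonneg_left hw1 this.le) h1 (abs_nonneg _) (by linarith)
    _ = (leadBound ℓ q - 1) * q ^ (x.dg i + 2 * s) := by
        rw [zpow_add₀ hq0]
        ring
    _ ≤ (leadBound ℓ q - 1) * q ^ (x.h : ℤ) :=
        mul_le_mul_of_nonneg_left (zpow_le_zpow_right_of_le_one₀ hq.1 hq.2.le (by omega)) hc
    _ ≤ _ := by
        rw [zpow_natCast]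
        exact mul_le_mul_of_nonneg_right (by linarith) (pow_pos hq.1 _).le

end Leading

/-! ### Matrices of operators on `ℓ²` -/

section Matrix

variable {ι κ : Type}

open Classical in
theorem ket_apply (x y : ι) : (ket x : L2 ι) y = if y = x then 1 else 0 := by
  unfold ket
  by_cases h : y = x
  · subst h
    simp
  · simp [h]

theorem inner_ket (y : ι) (v : L2 ι) : inner ℂ (ket y) v = v y := by
  classical
  unfold ket
  rw [lp.inner_single_left]
  simp

theorem hasSum_ket (v : L2 ι) : HasSum (fun x => v x • (ket x : L2 ι)) v := by
  classical
  have h := lp.hasSum_single (E := fun _ : ι => ℂ) (p := 2) (by norm_num) v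
  convert h using 2 with x
  unfold ket
  rw [← lp.single_smul, smul_eq_mul, mul_one]

theorem hasSum_inner_ket {E : Type} [NormedAddCommGroup E] [InnerProductSpace ℂ E]
    (T : L2 ι →L[ℂ] E) (u : E) (v : L2 ι) :
    HasSum (fun x => inner ℂ u (T (ket x)) * v x) (inner ℂ u (T v)) := by
  have h := (hasSum_ket v).mapL ((innerSL ℂ u).comp T)
  simpa [mul_comm] using h

theorem ext_ket {E : Type} [NormedAddCommGroup E] [InnerProductSpace ℂ E]
    {S T : L2 ι →L[ℂ] E} (h : ∀ x, S (ket x) = T (ket x)) : S = T := by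
  ext v
  have h1 := (hasSum_ket v).mapL S
  have h2 := (hasSum_ket v).mapL T
  simp only [map_smul, h] at h1 h2
  exact h1.unique h2

theorem ext_inner_ket {v w : L2 ι} (h : ∀ y, inner ℂ (ket y) v = inner ℂ (ket y) w) : v = w := by
  ext y
  rw [← inner_ket, ← inner_ket, h]

theorem inner_adjoint_ket (T : L2 ι →L[ℂ] L2 κ) (y : ι) (x : κ) :
    inner ℂ (ket y) (ContinuousLinearMap.adjoint T (ket x)) =
      (starRingEnd ℂ) (inner ℂ (ket x) (T (ket y))) := by
  rw [ContinuousLinearMap.adjoint_inner_right, inner_conj_symm]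

/-- A bounded matrix with at most one nonzero element in each row and column is the matrix of a
bounded operator. -/
theorem exists_shift (t : ι → ι → ℂ) (hrow : ∀ y, {x | t y x ≠ 0}.Subsingleton)
    (hcol : ∀ x, {y | t y x ≠ 0}.Subsingleton) {C : ℝ} (hC : ∀ y x, ‖t y x‖ ≤ C) :
    ∃ S : L2 ι →L[ℂ] L2 ι, ∀ y x, inner ℂ (ket y) (S (ket x)) = t y x := by
  classical
  -- the operator is a partial isometry `f` after a diagonal operator on the nonzero columns `s`
  let s : Set ι := {x | ∃ y, t y x ≠ 0}
  let f : s → ι := fun a => a.2.choose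
  have hfs : ∀ a : s, t (f a) a ≠ 0 := fun a => a.2.choose_spec
  have hf : Function.Injective f := by
    intro a b hab
    refine Subtype.ext (hrow (f a) (hfs a) ?_)
    rw [hab]
    exact hfs b
  let D : L2 s →L[ℂ] L2 s :=
    lp.mapCLM 2 (fun a : s => t (f a) a • ContinuousLinearMap.id ℂ ℂ) (le_max_left 0 C) fun a => by
      rw [norm_smul]
      simpa using Or.inr (hC (f a) a)
  have hD : ∀ a : s, D (ket a) = t (f a) a • ket a := by
    intro a
    ext b
    simp only [D, lp.mapCLM_apply_coe, lp.coeFn_smul, Pi.smul_apply, ket_apply]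
    by_cases h : b = a
    · subst h
      simp
    · simp [h]
  let V : L2 s →L[ℂ] L2 ι := shiftIsometry (Subtype.val : s → ι) Subtype.val_injective
  refine ⟨shiftIsometry f hf ∘L D ∘L ContinuousLinearMap.adjoint V, fun y x => ?_⟩
  have hV : ∀ a : s, inner ℂ (ket a) (ContinuousLinearMap.adjoint V (ket x)) =
      if (a : ι) = x then 1 else 0 := by
    intro a
    rw [inner_adjoint_ket, shiftIsometry_ket, inner_ket, ket_apply]
    simp [eq_comm]
  simp only [ContinuousLinearMap.comp_apply]
  by_cases hx : x ∈ s
  · have e : ContinuousLinearMap.adjoint V (ket x) = ket (⟨x, hx⟩ : s) := by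
      refine ext_inner_ket fun a => ?_
      rw [hV, inner_ket, ket_apply]
      simp [Subtype.ext_iff]
    rw [e, hD, map_smul, shiftIsometry_ket, inner_smul_right, inner_ket, ket_apply]
    by_cases hy : y = f ⟨x, hx⟩
    · simp [hy]
    · rw [if_neg hy, mul_zero]
      by_contra h
      exact hy (hcol x (Ne.symm h) (hfs ⟨x, hx⟩))
  · have e : ContinuousLinearMap.adjoint V (ket x) = 0 := by
      refine ext_inner_ket fun a => ?_
      rw [hV, inner_zero_right, if_neg]
      rintro rfl
      exact hx a.2
    rw [e, map_zero, map_zero, inner_zero_right]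
    by_contra h
    exact hx ⟨y, Ne.symm h⟩

/-- The matrix elements of a product with a shift operator. -/
theorem exists_inner_comp_eq {S T : L2 ι →L[ℂ] L2 ι} (hT : IsShift ket T) {y x : ι}
    (h : inner ℂ (ket y) ((S ∘L T) (ket x)) ≠ 0) :
    ∃ z, inner ℂ (ket y) (S (ket z)) ≠ 0 ∧ inner ℂ (ket z) (T (ket x)) ≠ 0 ∧
      inner ℂ (ket y) ((S ∘L T) (ket x)) =
        inner ℂ (ket y) (S (ket z)) * inner ℂ (ket z) (T (ket x)) := by
  have h1 := hasSum_inner_ket S (ket y) (T (ket x))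
  simp only [← inner_ket] at h1
  have hz : ∃ z, inner ℂ (ket z) (T (ket x)) ≠ 0 := by
    by_contra! hz
    simp only [hz, mul_zero] at h1
    exact h (h1.unique hasSum_zero)
  obtain ⟨z, hz⟩ := hz
  have h2 : inner ℂ (ket y) ((S ∘L T) (ket x)) =
      inner ℂ (ket y) (S (ket z)) * inner ℂ (ket z) (T (ket x)) := by
    refine h1.unique (hasSum_single z fun z' hz' => ?_)
    by_contra h3
    exact hz' (hT.2 x (right_ne_zero_of_mul h3) hz)
  refine ⟨z, fun h3 => h ?_, hz, h2⟩
  rw [h2, h3, zero_mul]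

end Matrix

/-! ### Classes of sums of shift operators -/

section Classes

variable {ℓ : ℕ} {d d' : ℤ}

/-- A shift operator on the Hilbert space of the sphere that raises `n - h` by `d` and changes `h`
by a bounded amount. -/
structure IsGradedShift (d : ℤ) (S : H ℓ →L[ℂ] H ℓ) : Prop where
  isShift : IsShift ket S
  graded : ∃ g : ℕ, ∀ y x, inner ℂ (ket y) (S (ket x)) ≠ 0 →
    ((y.n : ℤ) - y.h = x.n - x.h + d ∧ y.h ≤ x.h + g ∧ x.h ≤ y.h + g)

/-- The finite sums of graded shift operators whose weights are, for every `w` in the family `F`,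
bounded by a multiple of `w h`. -/
def shiftClass (ℓ : ℕ) (d : ℤ) (F : Set (ℕ → ℝ)) : AddSubmonoid (H ℓ →L[ℂ] H ℓ) :=
  AddSubmonoid.closure {S | IsGradedShift d S ∧
    ∀ w ∈ F, ∃ C : ℝ, ∀ y x, ‖inner ℂ (ket y) (S (ket x))‖ ≤ C * w x.h}

/-- A weight that changes by a bounded factor under bounded changes of the argument. -/
structure Tempered (w : ℕ → ℝ) : Prop where
  nonneg : ∀ h, 0 ≤ w h
  le_mul : ∀ g : ℕ, ∃ C, 0 ≤ C ∧ ∀ h h' : ℕ, h' ≤ h + g → w h ≤ C * w h'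

theorem tempered_one : Tempered fun _ => (1 : ℝ) :=
  ⟨fun _ => zero_le_one, fun _ => ⟨1, zero_le_one, fun _ _ _ => by simp⟩⟩

theorem tempered_pow {q : ℝ} (hq : q ∈ Set.Ioo (0 : ℝ) 1) : Tempered fun h => q ^ h := by
  refine ⟨fun h => (pow_pos hq.1 h).le, fun g => ⟨(q ^ g)⁻¹, (inv_pos.2 (pow_pos hq.1 g)).le,
    fun h h' hh => ?_⟩⟩
  rw [inv_mul_eq_div, le_div_iff₀ (pow_pos hq.1 g), ← pow_add]
  exact pow_le_pow_of_le_one hq.1.le hq.2.le hh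

theorem shiftClass_mono {F F' : Set (ℕ → ℝ)}
    (h : ∀ w' ∈ F', ∃ w ∈ F, ∃ C : ℝ, ∀ k, w k ≤ C * w' k) (hF : ∀ w ∈ F, ∀ k, 0 ≤ w k) :
    shiftClass ℓ d F ≤ shiftClass ℓ d F' := by
  refine AddSubmonoid.closure_mono fun S hS => ⟨hS.1, fun w' hw' => ?_⟩
  obtain ⟨w, hw, C, hC⟩ := h w' hw'
  obtain ⟨K, hK⟩ := hS.2 w hw
  refine ⟨max K 0 * C, fun y x => (hK y x).trans ?_⟩
  rw [mul_assoc]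
  exact (mul_le_mul_of_nonneg_right (le_max_left K 0) (hF w hw _)).trans
    (mul_le_mul_of_nonneg_left (hC x.h) (le_max_right K 0))

theorem adjoint_mem_shiftClass {w : ℕ → ℝ} (hw : Tempered w) {T : H ℓ →L[ℂ] H ℓ}
    (hT : T ∈ shiftClass ℓ d {w}) :
    ContinuousLinearMap.adjoint T ∈ shiftClass ℓ (-d) {w} := by
  refine AddSubmonoid.closure_induction (motive := fun T _ =>
    ContinuousLinearMap.adjoint T ∈ shiftClass ℓ (-d) {w}) ?_ ?_ ?_ hT
  · rintro S ⟨⟨hS, g, hg⟩, hS3⟩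
    obtain ⟨C, hC⟩ := hS3 w rfl
    obtain ⟨K, hK0, hK⟩ := hw.le_mul g
    have hne : ∀ y x, inner ℂ (ket y) (ContinuousLinearMap.adjoint S (ket x)) ≠ 0 ↔
        inner ℂ (ket x) (S (ket y)) ≠ 0 := by
      intro y x
      rw [inner_adjoint_ket, Ne, map_eq_zero]
    refine AddSubmonoid.subset_closure ⟨⟨⟨fun y => ?_, fun x => ?_⟩, g, fun y x h => ?_⟩, ?_⟩
    · simp only [hne]
      exact hS.2 y
    · simp only [hne]
      exact hS.1 x
    · have := hg x y ((hne y x).1 h)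
      omega
    · rintro _ rfl
      refine ⟨max C 0 * K, fun y x => ?_⟩
      by_cases h : inner ℂ (ket y) (ContinuousLinearMap.adjoint S (ket x)) = 0
      · rw [h, norm_zero]
        exact mul_nonneg (mul_nonneg (le_max_right _ _) hK0) (hw.nonneg _)
      · have h1 := hg x y ((hne y x).1 h)
        have h2 := hC x y
        rw [inner_adjoint_ket, RCLike.norm_conj, mul_assoc]
        refine h2.trans ((mul_le_mul_of_nonneg_right (le_max_left C 0) (hw.nonneg _)).trans
          (mul_le_mul_of_nonneg_left (hK _ _ (by omega)) (le_max_right C 0)))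
  · rw [map_zero]
    exact zero_mem _
  · intro S T _ _ hS hT
    rw [map_add]
    exact add_mem hS hT

theorem isShift_comp {ι : Type} {S T : L2 ι →L[ℂ] L2 ι} (hS : IsShift ket S) (hT : IsShift ket T) :
    IsShift ket (S ∘L T) := by
  refine ⟨fun y x hx x' hx' => ?_, fun x y hy y' hy' => ?_⟩
  · obtain ⟨z, h1, h2, -⟩ := exists_inner_comp_eq hT hx
    obtain ⟨z', h1', h2', -⟩ := exists_inner_comp_eq hT hx'
    obtain rfl := hS.1 y h1 h1'
    exact hT.1 z h2 h2'
  · obtain ⟨z, h1, h2, -⟩ := exists_inner_comp_eq hT hy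
    obtain ⟨z', h1', h2', -⟩ := exists_inner_comp_eq hT hy'
    obtain rfl := hT.2 x h2 h2'
    exact hS.2 z h1 h1'

theorem comp_mem_shiftClass {w w' : ℕ → ℝ} (hw : Tempered w) (hw' : ∀ k, 0 ≤ w' k)
    {S T : H ℓ →L[ℂ] H ℓ} (hS : S ∈ shiftClass ℓ d {w}) (hT : T ∈ shiftClass ℓ d' {w'}) :
    S ∘L T ∈ shiftClass ℓ (d + d') {fun h => w h * w' h} := by
  refine AddSubmonoid.closure_induction (motive := fun S _ =>
    S ∘L T ∈ shiftClass ℓ (d + d') {fun h => w h * w' h}) ?_ ?_ ?_ hS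
  · rintro S ⟨⟨hS, g, hg⟩, hS3⟩
    obtain ⟨C, hC⟩ := hS3 w rfl
    refine AddSubmonoid.closure_induction (motive := fun T _ =>
      S ∘L T ∈ shiftClass ℓ (d + d') {fun h => w h * w' h}) ?_ ?_ ?_ hT
    · rintro T ⟨⟨hT, g', hg'⟩, hT3⟩
      obtain ⟨C', hC'⟩ := hT3 w' rfl
      obtain ⟨K, hK0, hK⟩ := hw.le_mul g'
      refine AddSubmonoid.subset_closure ⟨⟨isShift_comp hS hT, g + g', fun y x h => ?_⟩, ?_⟩
      · obtain ⟨z, h1, h2, -⟩ := exists_inner_comp_eq hT h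
        have h1 := hg _ _ h1
        have h2 := hg' _ _ h2
        omega
      · rintro _ rfl
        refine ⟨max C 0 * K * max C' 0, fun y x => ?_⟩
        by_cases h : inner ℂ (ket y) ((S ∘L T) (ket x)) = 0
        · rw [h, norm_zero]
          exact mul_nonneg (mul_nonneg (mul_nonneg (le_max_right _ _) hK0) (le_max_right _ _))
            (mul_nonneg (hw.nonneg _) (hw' _))
        · obtain ⟨z, h1, h2, h3⟩ := exists_inner_comp_eq hT h
          have h2 := hg' _ _ h2
          have b1 : ‖inner ℂ (ket y) (S (ket z))‖ ≤ max C 0 * (K * w x.h) :=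
            (hC y z).trans ((mul_le_mul_of_nonneg_right (le_max_left C 0) (hw.nonneg _)).trans
              (mul_le_mul_of_nonneg_left (hK _ _ (by omega)) (le_max_right C 0)))
          have b2 : ‖inner ℂ (ket z) (T (ket x))‖ ≤ max C' 0 * w' x.h :=
            (hC' z x).trans (mul_le_mul_of_nonneg_right (le_max_left C' 0) (hw' _))
          rw [h3, norm_mul]
          exact (mul_le_mul b1 b2 (norm_nonneg _) ((norm_nonneg _).trans b1)).trans
            (le_of_eq (by ring))
    · rw [ContinuousLinearMap.comp_zero]
      exact zero_mem _
    · intro T T' _ _ hT hT'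
      rw [ContinuousLinearMap.comp_add]
      exact add_mem hT hT'
  · rw [ContinuousLinearMap.zero_comp]
    exact zero_mem _
  · intro S S' _ _ hS hS'
    rw [ContinuousLinearMap.add_comp]
    exact add_mem hS hS'

theorem isGradedShift_smul {S : H ℓ →L[ℂ] H ℓ} (hS : IsGradedShift d S) (c : ℂ) :
    IsGradedShift d (c • S) := by
  have hne : ∀ y x, inner ℂ (ket y) ((c • S) (ket x)) ≠ 0 → inner ℂ (ket y) (S (ket x)) ≠ 0 := by
    intro y x h h'
    rw [_root_.smul_apply, inner_smul_right, h', mul_zero] at h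
    exact h rfl
  obtain ⟨⟨h1, h2⟩, g, hg⟩ := hS
  exact ⟨⟨fun y x hx x' hx' => h1 y (hne _ _ hx) (hne _ _ hx'),
    fun x y hy y' hy' => h2 x (hne _ _ hy) (hne _ _ hy')⟩, g, fun y x h => hg y x (hne _ _ h)⟩

/-- Splitting shift operators into small multiples makes the constants in the bounds disappear. -/
theorem exists_sum_of_mem_shiftClass {w : ℕ → ℝ} (hw : ∀ k, 0 ≤ w k) {T : H ℓ →L[ℂ] H ℓ}
    (hT : T ∈ shiftClass ℓ d {w}) :
    ∃ (K : ℕ) (S : Fin K → (H ℓ →L[ℂ] H ℓ)),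
      (∀ k, IsGradedShift d (S k) ∧ ∀ y x, ‖inner ℂ (ket y) (S k (ket x))‖ ≤ w x.h) ∧
      T = ∑ k, S k := by
  suffices h : ∃ (κ : Type) (_ : Fintype κ) (S : κ → (H ℓ →L[ℂ] H ℓ)),
      (∀ k, IsGradedShift d (S k) ∧ ∀ y x, ‖inner ℂ (ket y) (S k (ket x))‖ ≤ w x.h) ∧
      T = ∑ k, S k by
    obtain ⟨κ, _, S, hS, rfl⟩ := h
    exact ⟨Fintype.card κ, fun k => S ((Fintype.equivFin κ).symm k), fun k => hS _,
      ((Fintype.equivFin κ).symm.sum_comp S).symm⟩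
  refine AddSubmonoid.closure_induction (motive := fun T _ =>
    ∃ (κ : Type) (_ : Fintype κ) (S : κ → (H ℓ →L[ℂ] H ℓ)),
      (∀ k, IsGradedShift d (S k) ∧ ∀ y x, ‖inner ℂ (ket y) (S k (ket x))‖ ≤ w x.h) ∧
      T = ∑ k, S k) ?_ ?_ ?_ hT
  · rintro S ⟨hS, hS3⟩
    obtain ⟨C, hC⟩ := hS3 w rfl
    obtain ⟨N, hN⟩ := exists_nat_ge C
    have hN0 : (0 : ℝ) < (N + 1 : ℕ) := by positivity
    refine ⟨Fin (N + 1), inferInstance, fun _ => ((N + 1 : ℕ) : ℂ)⁻¹ • S, fun _ =>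
      ⟨isGradedShift_smul hS _, fun y x => ?_⟩, ?_⟩
    · rw [_root_.smul_apply, inner_smul_right, norm_mul, norm_inv, Complex.norm_natCast,
        inv_mul_le_iff₀ hN0]
      refine (hC y x).trans (mul_le_mul_of_nonneg_right (hN.trans ?_) (hw _))
      push_cast
      linarith
    · have hN1 : ((N + 1 : ℕ) : ℂ) ≠ 0 := Nat.cast_ne_zero.2 (by omega)
      rw [Finset.sum_const, Finset.card_univ, Fintype.card_fin, ← Nat.cast_smul_eq_nsmul ℂ,
        smul_smul, mul_inv_cancel₀ hN1, one_smul]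
  · exact ⟨Empty, inferInstance, fun k => k.elim, fun k => k.elim, by simp⟩
  · rintro S T _ _ ⟨κ, _, A, hA, rfl⟩ ⟨κ', _, B, hB, rfl⟩
    refine ⟨κ ⊕ κ', inferInstance, Sum.elim A B, ?_, by simp⟩
    rintro (k | k)
    · exact hA k
    · exact hB k

/-- The matrix elements of the operators in a class. -/
theorem exists_bound_of_mem_shiftClass {w : ℕ → ℝ} {T : H ℓ →L[ℂ] H ℓ}
    (hT : T ∈ shiftClass ℓ d {w}) :
    ∃ (C : ℝ) (g : ℕ), ∀ y x, ‖inner ℂ (ket y) (T (ket x))‖ ≤ C * w x.h ∧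
      (inner ℂ (ket y) (T (ket x)) ≠ 0 → y.h ≤ x.h + g ∧ x.h ≤ y.h + g) := by
  refine AddSubmonoid.closure_induction (motive := fun T _ =>
    ∃ (C : ℝ) (g : ℕ), ∀ y x, ‖inner ℂ (ket y) (T (ket x))‖ ≤ C * w x.h ∧
      (inner ℂ (ket y) (T (ket x)) ≠ 0 → y.h ≤ x.h + g ∧ x.h ≤ y.h + g)) ?_ ?_ ?_ hT
  · rintro S ⟨⟨hS, g, hg⟩, hS3⟩
    obtain ⟨C, hC⟩ := hS3 w rfl
    exact ⟨C, g, fun y x => ⟨hC y x, fun h => (hg y x h).2⟩⟩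
  · exact ⟨0, 0, fun y x => by simp⟩
  · rintro S T _ _ ⟨C, g, h⟩ ⟨C', g', h'⟩
    refine ⟨C + C', g + g', fun y x => ⟨?_, fun hne => ?_⟩⟩
    · rw [_root_.add_apply, inner_add_right, add_mul]
      exact (norm_add_le _ _).trans (add_le_add (h y x).1 (h' y x).1)
    · rw [_root_.add_apply, inner_add_right] at hne
      by_cases h1 : inner ℂ (ket y) (S (ket x)) = 0
      · rw [h1, zero_add] at hne
        have := (h' y x).2 hne
        omega
      · have := (h y x).2 h1
        omega

theorem graded_of_mem_shiftClass {F : Set (ℕ → ℝ)} {T : H ℓ →L[ℂ] H ℓ}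
    (hT : T ∈ shiftClass ℓ d F) {y x : Label ℓ} (h : inner ℂ (ket y) (T (ket x)) ≠ 0) :
    (y.n : ℤ) - y.h = x.n - x.h + d := by
  revert h
  refine AddSubmonoid.closure_induction (motive := fun T _ => inner ℂ (ket y) (T (ket x)) ≠ 0 →
    (y.n : ℤ) - y.h = x.n - x.h + d) ?_ ?_ ?_ hT
  · rintro S ⟨⟨-, g, hg⟩, -⟩ h
    exact (hg y x h).1
  · simp
  · intro S T _ _ hS hT hne
    rw [_root_.add_apply, inner_add_right] at hne
    by_cases h1 : inner ℂ (ket y) (S (ket x)) = 0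
    · rw [h1, zero_add] at hne
      exact hT hne
    · exact hS h1

end Classes

/-! ### The compressed symbol representation -/

section Symbol

variable {ℓ : ℕ} {q : ℝ}

theorem rhoA_ket (hq : q ∈ Set.Ioo (0 : ℝ) 1) (i : ℕ) (z : Lam ℓ) :
    rhoA ℓ hq i (ket z) = ((q ^ (z.b (i - 1) - z.b (i - 2)) : ℝ) : ℂ) • ket z :=
  diagonalOp_ket _ _ z

theorem rhoB_ket (hq : q ∈ Set.Ioo (0 : ℝ) 1) (i : ℕ) (z : Lam ℓ) :
    rhoB ℓ hq i (ket z) =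
      ((√(1 - q ^ (2 * (z.b (i - 1) - z.b (i - 2) + 1))) : ℝ) : ℂ) • ket (z.raise i) := by
  rw [rhoB, ContinuousLinearMap.comp_apply, diagonalOp_ket, map_smul, shiftIsometry_ket]

/-- The partial products of `ρ(z_i)` are weighted shifts: the factors `A` contribute a telescoping
power of `q`. -/
theorem prod_rhoFactor_ket (hq : q ∈ Set.Ioo (0 : ℝ) 1) {i : ℕ} (hi : 1 ≤ i) (z : Lam ℓ) {n : ℕ}
    (hn : i ≤ n) :
    ((List.range n).map fun k => rhoFactor ℓ hq i (k + 1)).prod (ket z) =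
      ((q ^ (z.b (n - 1) - z.b (i - 1)) * (if i = 1 then 1 else
        √(1 - q ^ (2 * (z.b (i - 1) - z.b (i - 2) + 1)))) : ℝ) : ℂ) • ket (z.raise i) := by
  induction n, hn using Nat.le_induction with
  | base =>
    obtain ⟨k, rfl⟩ : ∃ k, i = k + 1 := ⟨i - 1, by omega⟩
    have h1 : ((List.range k).map fun j => rhoFactor ℓ hq (k + 1) (j + 1)).prod = 1 := by
      refine List.prod_eq_one fun T hT => ?_
      obtain ⟨j, hj, rfl⟩ := List.mem_map.1 hT
      rw [List.mem_range] at hj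
      exact if_pos (by omega)
    rw [List.prod_range_succ, h1, one_mul, rhoFactor, if_neg (lt_irrefl _), if_pos rfl, sub_self,
      zpow_zero, one_mul]
    split_ifs with h
    · obtain rfl : k = 0 := by omega
      rw [rhoU, shiftIsometry_ket, Complex.ofReal_one, one_smul]
    · exact rhoB_ket hq _ z
  | succ n hn ih =>
    have e1 : z.b (n + 1 - 1) - z.b (n + 1 - 2) + (z.b (n - 1) - z.b (i - 1)) =
        z.b (n + 1 - 1) - z.b (i - 1) := by
      have e : n + 1 - 2 = n - 1 := by omega
      rw [e]
      ring
    rw [List.prod_range_succ, mul_apply_eq_comp, rhoFactor, if_neg (by omega),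
      if_neg (by omega), rhoA_ket, map_smul, ih, smul_smul, ← Complex.ofReal_mul, ← mul_assoc,
      ← zpow_add₀ hq.1.ne', e1]

theorem rho_ket (hq : q ∈ Set.Ioo (0 : ℝ) 1) {i : ℕ} (hi : 1 ≤ i) (hi' : i ≤ ℓ + 1) (z : Lam ℓ) :
    rho ℓ hq i (ket z) = ((q ^ (z.b ℓ - z.b (i - 1)) * (if i = 1 then 1 else
        √(1 - q ^ (2 * (z.b (i - 1) - z.b (i - 2) + 1)))) : ℝ) : ℂ) • ket (z.raise i) :=
  prod_rhoFactor_ket hq hi z hi'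

/-- The label to which `ρ(z_{ℓ+2-i})` shifts `x`: all entries are raised by one, except for the
last entries of the rows `1, …, i`. -/
def Label.up (hℓ : 1 ≤ ℓ) {i : ℕ} (hi : 1 ≤ i) (x : Label ℓ) : Label ℓ where
  n := x.n
  h := x.h + 1
  r := fun a b => if 1 ≤ a ∧ 1 ≤ b ∧ a + b ≤ ℓ + 2 then
      (if a + b = ℓ + 2 ∧ a ≤ i then x.r a b else x.r a b + 1) else 0
  gt :=
    { out_of_range := fun a b h => if_neg h
      le_up := fun a b ha hb hab => by
        have := x.gt.le_up a b ha hb hab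
        split_ifs <;> omega
      up_right_le := fun a b ha hb hab => by
        have := x.gt.up_right_le a b ha hb hab
        split_ifs <;> omega
      corner := by
        have := x.gt.corner
        split_ifs <;> omega }
  top_first := by
    have := x.top_first
    rw [if_pos (by omega), if_neg (by omega)]
    omega
  top := fun j hj hj' => by
    have := x.top j hj hj'
    rw [if_pos (by omega), if_neg (by omega)]
    omega

theorem Label.toLam_up (hℓ : 1 ≤ ℓ) {i : ℕ} (hi : 1 ≤ i) (hi' : i ≤ ℓ + 1) (x : Label ℓ) :
    (x.up hℓ hi).toLam = x.toLam.raise (ℓ + 2 - i) := by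
  ext k
  · rfl
  · simp [Label.toLam, Label.up, Lam.raise]
  · simp only [Label.toLam, Label.up, Lam.raise]
    split_ifs <;> omega
  · simp only [Label.toLam, Label.up, Lam.raise]
    split_ifs <;> omega

/-- The differences `b (k) - b (k - 1)` in the symbol are differences of last entries. -/
theorem Label.toLam_b (x : Label ℓ) {k : ℕ} (hk : 1 ≤ k) (hk' : k ≤ ℓ + 1) :
    x.toLam.b (ℓ + 1 - k) = x.h - x.dg k := by
  simp only [Label.toLam, Label.dg]
  split_ifs with h
  · obtain rfl : k = 1 := by omega
    have := x.gt.corner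
    have e : ℓ + 2 - 1 = ℓ + 1 := by omega
    rw [e, this, sub_zero]
  · have e1 : ℓ + 1 - (ℓ + 1 - k) = k := by omega
    have e2 : ℓ + 1 - k + 1 = ℓ + 2 - k := by omega
    rw [e1, e2]

theorem Label.dg_up (hℓ : 1 ≤ ℓ) {i : ℕ} (hi : 1 ≤ i) (x : Label ℓ) {k : ℕ} (hk : 1 ≤ k)
    (hk' : k ≤ ℓ + 1) : (x.up hℓ hi).dg k = if k ≤ i then x.dg k else x.dg k + 1 := by
  simp only [Label.up, Label.dg]
  split_ifs <;> omega

/-- The symbol `ρ(z_{ℓ+2-i})` on the range of `W`. -/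
theorem rho_W_ket (hq : q ∈ Set.Ioo (0 : ℝ) 1) (hℓ : 1 ≤ ℓ) {i : ℕ} (hi : 1 ≤ i)
    (hi' : i ≤ ℓ + 1) (x : Label ℓ) :
    rho ℓ hq (ℓ + 2 - i) (W ℓ (ket x)) =
      ((leadWeight q (x.up hℓ hi) i : ℝ) : ℂ) • W ℓ (ket (x.up hℓ hi)) := by
  have e1 : ℓ + 2 - i - 1 = ℓ + 1 - i := by omega
  have e2 : ℓ + 2 - i - 2 = ℓ + 1 - (i + 1) := by omega
  have b1 : x.toLam.b ℓ = x.h := x.toLam.b_top ℓ le_rfl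
  rw [W, shiftIsometry_ket, shiftIsometry_ket, rho_ket hq (by omega) (by omega),
    Label.toLam_up hℓ hi hi', leadWeight, e1, e2, x.toLam_b hi hi', b1, Label.dg_up hℓ hi x hi hi',
    if_pos le_rfl, sub_sub_cancel]
  congr 3
  by_cases h : i = ℓ + 1
  · rw [if_pos h, if_pos (by omega), Real.sqrt_one]
  · rw [if_neg h, if_neg (by omega), x.toLam_b (by omega) (by omega),
      Label.dg_up hℓ hi x (by omega) (by omega), if_neg (by omega), qPhi]
    congr 4
    ring

theorem adjoint_W_W (ℓ : ℕ) (v : H ℓ) : ContinuousLinearMap.adjoint (W ℓ) (W ℓ v) = v := by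
  refine ext_inner_right ℂ fun w => ?_
  rw [ContinuousLinearMap.adjoint_inner_left]
  exact LinearIsometry.inner_map_map _ v w

/-- The compression `W^* ρ(z_i) W` of the symbol of `z_i`. -/
def symb (ℓ : ℕ) (hq : q ∈ Set.Ioo (0 : ℝ) 1) (i : ℕ) : H ℓ →L[ℂ] H ℓ :=
  ContinuousLinearMap.adjoint (W ℓ) ∘L rho ℓ hq i ∘L W ℓ

theorem symb_ket (hq : q ∈ Set.Ioo (0 : ℝ) 1) (hℓ : 1 ≤ ℓ) {i : ℕ} (hi : 1 ≤ i)
    (hi' : i ≤ ℓ + 1) (x : Label ℓ) :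
    symb ℓ hq (ℓ + 2 - i) (ket x) =
      ((leadWeight q (x.up hℓ hi) i : ℝ) : ℂ) • ket (x.up hℓ hi) := by
  rw [symb, ContinuousLinearMap.comp_apply, ContinuousLinearMap.comp_apply, rho_W_ket hq hℓ hi hi',
    map_smul, adjoint_W_W]

/-- The range of `W` is invariant under the symbols of the generators. -/
theorem W_symb (hq : q ∈ Set.Ioo (0 : ℝ) 1) (hℓ : 1 ≤ ℓ) {i : ℕ} (hi : 1 ≤ i)
    (hi' : i ≤ ℓ + 1) (v : H ℓ) : W ℓ (symb ℓ hq i v) = rho ℓ hq i (W ℓ v) := by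
  have e : i = ℓ + 2 - (ℓ + 2 - i) := by omega
  refine congrArg (fun T : H ℓ →L[ℂ] HHat ℓ => T v)
    (ext_ket (S := W ℓ ∘L symb ℓ hq i) (T := rho ℓ hq i ∘L W ℓ) fun x => ?_)
  rw [ContinuousLinearMap.comp_apply, ContinuousLinearMap.comp_apply, e,
    symb_ket hq hℓ (by omega) (by omega), rho_W_ket hq hℓ (by omega) (by omega), map_smul]

end Symbol

/-! ### The left regular representation as a sum of shift operators -/

section LeftRegular

variable {ℓ : ℕ} {q : ℝ} {i : ℕ} {m : ℕ → ℕ} {x y : Label ℓ}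

/-- The label `y` is obtained from `x` by the change of `(n, h; r)` belonging to the tuple `m`. -/
structure MoveRel (i : ℕ) (m : ℕ → ℕ) (x y : Label ℓ) : Prop where
  r_eq : y.r = move ℓ i m x.r
  step : (m 1 = 1 ∧ y.n = x.n + 1 ∧ y.h = x.h) ∨ (m 1 = ℓ + 1 ∧ y.n = x.n ∧ y.h + 1 = x.h)

theorem MoveRel.r_apply (hℓ : 1 ≤ ℓ) (h : MoveRel i m x y) {a b : ℕ} (ha : 1 ≤ a) (hb : 1 ≤ b)
    (hab : a + b ≤ ℓ + 2) :
    y.r a b = (y.h - x.h) + if a ≤ i ∧ b = m a then x.r a b + 1 else x.r a b := by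
  rw [h.r_eq, move, if_pos ⟨ha, hb, hab⟩]
  congr 1
  rcases h.step with h1 | h1
  · rw [if_neg (by omega)]
    omega
  · rw [if_pos h1.1]
    omega

/-- Raising an interior entry does not lead to a tableau, and neither does raising a last entry that
is already maximal. -/
theorem MoveRel.admissible (hℓ : 1 ≤ ℓ) (h : MoveRel i m x y) (hi : 1 ≤ i) (hi' : i ≤ ℓ + 1)
    (hm : ∀ k, 1 ≤ k → k ≤ i → 1 ≤ m k ∧ m k ≤ ℓ + 2 - k) : Admissible x i m := by
  have ends : ∀ k, 1 ≤ k → k ≤ i → m k = 1 ∨ m k = ℓ + 2 - k := by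
    intro k hk hki
    have h1 := hm k hk hki
    by_contra! h2
    have h3 := h.r_apply hℓ (a := k) (b := m k) hk h1.1 (by omega)
    rw [if_pos ⟨hki, rfl⟩, x.interior hk (by omega) (by omega),
      y.interior hk (by omega) (by omega)] at h3
    omega
  have dg : ∀ k, 1 ≤ k → k ≤ i → m k = ℓ + 2 - k → y.dg k = (y.h - x.h) + x.dg k + 1 := by
    intro k hk hki hmk
    have h3 := h.r_apply hℓ (a := k) (b := m k) hk (by omega) (by omega)
    rw [if_pos ⟨hki, rfl⟩, hmk] at h3
    simp only [Label.dg]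
    omega
  refine ⟨hi, hi', ends, fun k hk hki hkℓ hk1 => ?_, fun hiℓ hmℓ => ?_⟩
  · have h1 := dg k hk hki ((ends k hk hki).resolve_left hk1)
    have h2 := y.dg_le hk hkℓ
    omega
  · have h0 := hm (ℓ + 1) (by omega) (by omega)
    have h1 := dg (ℓ + 1) (by omega) (by omega) (by omega)
    have h2 := y.dg_last_le hℓ
    have h3 := h.r_apply hℓ (a := ℓ) (b := 1) hℓ le_rfl (by omega)
    rw [if_neg fun H => hmℓ H.2.symm] at h3
    simp only [Label.al, le_refl, if_true] at h2 ⊢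
    omega

theorem MoveRel.right_unique {y' : Label ℓ} (hℓ : 1 ≤ ℓ) (h : MoveRel i m x y)
    (h' : MoveRel i m x y') : y = y' := by
  have h1 := h.step
  have h2 := h'.step
  refine Label.ext (by omega) (by omega) (h.r_eq.trans h'.r_eq.symm)

theorem MoveRel.left_unique {x' : Label ℓ} (hℓ : 1 ≤ ℓ) (h : MoveRel i m x y)
    (h' : MoveRel i m x' y) : x = x' := by
  have h1 := h.step
  have h2 := h'.step
  refine Label.ext (by omega) (by omega) ?_
  ext a b
  by_cases hab : 1 ≤ a ∧ 1 ≤ b ∧ a + b ≤ ℓ + 2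
  · have e1 := h.r_apply hℓ hab.1 hab.2.1 hab.2.2
    have e2 := h'.r_apply hℓ hab.1 hab.2.1 hab.2.2
    have e3 : (x.h : ℤ) = x'.h := by omega
    split_ifs at e1 e2 <;> omega
  · rw [x.gt.out_of_range a b hab, x'.gt.out_of_range a b hab]

/-- The moves raising only last entries are inverse to `Label.up`. -/
theorem moveRel_iff_eq_up (hℓ : 1 ≤ ℓ) (hi : 1 ≤ i) (hi' : i ≤ ℓ + 1)
    (hm : ∀ k, 1 ≤ k → k ≤ i → m k = ℓ + 2 - k) : MoveRel i m x y ↔ x = y.up hℓ hi := by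
  have m1 := hm 1 le_rfl hi
  have key : MoveRel i m (y.up hℓ hi) y := by
    refine ⟨?_, Or.inr ⟨by omega, rfl, rfl⟩⟩
    ext a b
    simp only [move, Label.up]
    by_cases hab : 1 ≤ a ∧ 1 ≤ b ∧ a + b ≤ ℓ + 2
    · by_cases ha : a ≤ i
      · have := hm a hab.1 ha
        simp only [if_pos hab]
        split_ifs <;> omega
      · simp only [if_pos hab]
        split_ifs <;> omega
    · rw [if_neg hab, y.gt.out_of_range a b hab]
  exact ⟨fun h => h.left_unique hℓ key, fun h => h ▸ key⟩

/-- Operators whose nonzero matrix elements are at the positions of a move are shift operators. -/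
theorem mem_shiftClass_of_moveRel (hℓ : 1 ≤ ℓ) {T : H ℓ →L[ℂ] H ℓ} {w : ℕ → ℝ}
    (hw : ∀ k, 0 ≤ w k) {C : ℝ} (hC : 0 ≤ C)
    (h0 : ∀ y x, inner ℂ (ket y) (T (ket x)) ≠ 0 → MoveRel i m x y)
    (h1 : ∀ y x, MoveRel i m x y → ‖inner ℂ (ket y) (T (ket x))‖ ≤ C * w x.h) :
    T ∈ shiftClass ℓ 1 {w} := by
  refine AddSubmonoid.subset_closure ⟨⟨⟨
    fun y x hx x' hx' => (h0 y x hx).left_unique hℓ (h0 y x' hx'),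
    fun x y hy y' hy' => (h0 y x hy).right_unique hℓ (h0 y' x hy')⟩, 1, fun y x h => ?_⟩, ?_⟩
  · have := (h0 y x h).step
    omega
  · rintro _ rfl
    refine ⟨C, fun y x => ?_⟩
    by_cases h : inner ℂ (ket y) (T (ket x)) = 0
    · rw [h, norm_zero]
      exact mul_nonneg hC (hw _)
    · exact h1 y x (h0 y x h)

/-- The coefficient of the move `m` in `π(z_{ℓ+2-i}^*)`. -/
def moveCoef (ℓ : ℕ) (q : ℝ) (i : ℕ) (x : Label ℓ) (m : ℕ → ℕ) : ℝ :=
  if m 1 = 1 then coefUp ℓ q i x m else coefDown ℓ q i x m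

open Classical in
/-- The matrix of the summand of `π(z_{ℓ+2-i}^*)` belonging to the move `m`. -/
def moveMatrix (ℓ : ℕ) (q : ℝ) (i : ℕ) (m : ℕ → ℕ) (y x : Label ℓ) : ℂ :=
  if MoveRel i m x y then ((moveCoef ℓ q i x m : ℝ) : ℂ) else 0

open Classical in
theorem inner_ket_ketOf (y : Label ℓ) (n h : ℤ) (r : ℕ → ℕ → ℤ) :
    inner ℂ (ket y) (ketOf ℓ n h r) = if (y.n : ℤ) = n ∧ (y.h : ℤ) = h ∧ y.r = r then 1 else 0 := by
  unfold ketOf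
  split_ifs with h1 h2 h2
  · rw [inner_ket, ket_apply, if_pos]
    obtain ⟨a1, a2, a3⟩ := h1.choose_spec
    refine Label.ext ?_ ?_ (h2.2.2.trans a3.symm)
    · have := h2.1
      omega
    · have := h2.2.1
      omega
  · rw [inner_ket, ket_apply, if_neg]
    rintro rfl
    exact h2 h1.choose_spec
  · exact absurd ⟨y, h2⟩ h1
  · rw [inner_zero_right]

theorem inner_ket_zStarKet (hℓ : 1 ≤ ℓ) (y x : Label ℓ) :
    inner ℂ (ket y) (zStarKet ℓ q i x) = ∑ m ∈ Gam ℓ i, moveMatrix ℓ q i (entry m) y x := by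
  classical
  rw [zStarKet, inner_add_right, inner_smul_right, inner_smul_right, inner_sum, inner_sum,
    Finset.mul_sum, Finset.mul_sum, Finset.sum_filter, Finset.sum_filter, ← Finset.sum_add_distrib]
  refine Finset.sum_congr rfl fun m _ => ?_
  rw [inner_smul_right, inner_smul_right, inner_ket_ketOf, inner_ket_ketOf, moveMatrix]
  by_cases h1 : entry m 1 = 1
  · have h2 : entry m 1 ≠ ℓ + 1 := by omega
    have h3 : MoveRel i (entry m) x y ↔
        (y.n : ℤ) = x.n + 1 ∧ (y.h : ℤ) = x.h ∧ y.r = move ℓ i (entry m) x.r := by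
      constructor
      · intro h
        have := h.step
        exact ⟨by omega, by omega, h.r_eq⟩
      · rintro ⟨a1, a2, a3⟩
        exact ⟨a3, Or.inl ⟨h1, by omega, by omega⟩⟩
    rw [if_pos h1, if_neg h2, add_zero, moveCoef, if_pos h1, coefUp]
    simp only [h3]
    split_ifs
    · push_cast
      ring
    · simp
  · by_cases h2 : entry m 1 = ℓ + 1
    · have h3 : MoveRel i (entry m) x y ↔
          (y.n : ℤ) = x.n ∧ (y.h : ℤ) = x.h - 1 ∧ y.r = move ℓ i (entry m) x.r := by
        constructor
        · intro h
          have := h.step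
          exact ⟨by omega, by omega, h.r_eq⟩
        · rintro ⟨a1, a2, a3⟩
          exact ⟨a3, Or.inr ⟨h2, by omega, by omega⟩⟩
      rw [if_pos h2, if_neg h1, zero_add, moveCoef, if_neg h1, coefDown]
      simp only [h3]
      split_ifs
      · push_cast
        ring
      · simp
    · rw [if_neg h1, if_neg h2, add_zero, if_neg]
      intro h
      have := h.step
      omega

/-- The tuple that raises only last entries. -/
def leadTuple (ℓ i : ℕ) : Fin i → ℕ := fun t => ℓ + 1 - t

theorem entry_leadTuple {k : ℕ} (hk : 1 ≤ k) (hki : k ≤ i) :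
    entry (leadTuple ℓ i) k = ℓ + 2 - k := by
  rw [entry, dif_pos ⟨hk, hki⟩, leadTuple]
  simp only
  omega

theorem leadTuple_mem (hi' : i ≤ ℓ + 1) : leadTuple ℓ i ∈ Gam ℓ i := by
  rw [Gam, Fintype.mem_piFinset]
  intro t
  have := t.2
  rw [Finset.mem_Icc, leadTuple]
  omega

theorem entry_mem {m : Fin i → ℕ} (hm : m ∈ Gam ℓ i) (k : ℕ) (hk : 1 ≤ k) (hki : k ≤ i) :
    1 ≤ entry m k ∧ entry m k ≤ ℓ + 2 - k := by
  rw [Gam, Fintype.mem_piFinset] at hm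
  have := Finset.mem_Icc.1 (hm ⟨k - 1, by omega⟩)
  rw [entry, dif_pos ⟨hk, hki⟩]
  simp only at this
  omega

theorem moveMatrix_ne_zero {y x : Label ℓ} (h : moveMatrix ℓ q i m y x ≠ 0) : MoveRel i m x y := by
  by_contra h'
  exact h (if_neg h')

theorem abs_moveCoef_le (hq : q ∈ Set.Ioo (0 : ℝ) 1) (hℓ : 1 ≤ ℓ) (hi : 1 ≤ i) (hi' : i ≤ ℓ + 1)
    {m : Fin i → ℕ} (hm : m ∈ Gam ℓ i) (hne : m ≠ leadTuple ℓ i) (h : MoveRel i (entry m) x y) :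
    |moveCoef ℓ q i x (entry m)| ≤ coefBound ℓ q * q ^ x.h := by
  have ha := h.admissible hℓ hi hi' (entry_mem hm)
  unfold moveCoef
  split_ifs with h1
  · exact abs_coefUp_le hq hℓ ha h1
  · have h2 := h.step
    refine abs_coefDown_le hq hℓ ha (by omega) h1 ?_
    by_contra! hR
    refine hne (funext fun t => ?_)
    have := ha.eq_of_not_lft (k := t + 1) (by omega) (by omega) (hR _ (by omega) (by omega))
    rw [entry, dif_pos ⟨by omega, by omega⟩] at this
    rw [leadTuple]
    simp only [Nat.add_sub_cancel, Fin.eta] at this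
    omega

theorem leadWeight_nonneg (hq : q ∈ Set.Ioo (0 : ℝ) 1) (x : Label ℓ) (i : ℕ) :
    0 ≤ leadWeight q x i :=
  mul_nonneg (zpow_pos hq.1 _).le (Real.sqrt_nonneg _)

theorem leadWeight_le_one (hq : q ∈ Set.Ioo (0 : ℝ) 1) (hi : 1 ≤ i) (hi' : i ≤ ℓ + 1)
    (x : Label ℓ) : leadWeight q x i ≤ 1 := by
  refine mul_le_one₀ (zpow_le_one_of_nonneg hq (x.dg_nonneg hi hi')) (Real.sqrt_nonneg _)
    (Real.sqrt_le_one.2 ?_)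
  split_ifs
  · exact le_rfl
  · exact qPhi_le_one hq _

theorem abs_moveCoef_sub_le (hq : q ∈ Set.Ioo (0 : ℝ) 1) (hℓ : 1 ≤ ℓ) (hi : 1 ≤ i)
    (hi' : i ≤ ℓ + 1) (h : MoveRel i (entry (leadTuple ℓ i)) x y) :
    |moveCoef ℓ q i x (entry (leadTuple ℓ i)) - leadWeight q x i| ≤ leadBound ℓ q * q ^ x.h := by
  have ha := h.admissible hℓ hi hi' (entry_mem (leadTuple_mem hi'))
  have h1 : entry (leadTuple ℓ i) 1 ≠ 1 := by
    rw [entry_leadTuple le_rfl hi]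
    omega
  rw [moveCoef, if_neg h1]
  refine abs_coefDown_sub_le hq hℓ ha fun k hk hki H => ?_
  have h2 := H.1
  have h3 := H.2
  rw [entry_leadTuple hk hki] at h2
  omega

theorem leadBound_nonneg (ℓ : ℕ) (hq : q ∈ Set.Ioo (0 : ℝ) 1) : 0 ≤ leadBound ℓ q := by
  have := one_le_qD hq
  unfold leadBound
  positivity

open Classical in
theorem inner_adjoint_symb (hq : q ∈ Set.Ioo (0 : ℝ) 1) (hℓ : 1 ≤ ℓ) (hi : 1 ≤ i)
    (hi' : i ≤ ℓ + 1) (y x : Label ℓ) :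
    inner ℂ (ket y) (ContinuousLinearMap.adjoint (symb ℓ hq (ℓ + 2 - i)) (ket x)) =
      if MoveRel i (entry (leadTuple ℓ i)) x y then ((leadWeight q x i : ℝ) : ℂ) else 0 := by
  rw [inner_adjoint_ket, symb_ket hq hℓ hi hi', inner_smul_right, inner_ket, ket_apply, map_mul,
    Complex.conj_ofReal]
  have h := moveRel_iff_eq_up (x := x) (y := y) hℓ hi hi' (m := entry (leadTuple ℓ i))
    fun k hk hki => entry_leadTuple hk hki
  by_cases hx : x = y.up hℓ hi
  · rw [if_pos (h.2 hx), if_pos hx, map_one, mul_one, hx]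
  · rw [if_neg (fun H => hx (h.1 H)), if_neg hx, map_zero, mul_zero]

theorem adjoint_symb_mem (hq : q ∈ Set.Ioo (0 : ℝ) 1) (hℓ : 1 ≤ ℓ) (hi : 1 ≤ i)
    (hi' : i ≤ ℓ + 1) :
    ContinuousLinearMap.adjoint (symb ℓ hq (ℓ + 2 - i)) ∈ shiftClass ℓ 1 {fun _ => 1} := by
  refine mem_shiftClass_of_moveRel (i := i) (m := entry (leadTuple ℓ i)) hℓ (fun _ => zero_le_one)
    zero_le_one (fun y x h => ?_) fun y x h => ?_
  · rw [inner_adjoint_symb hq hℓ hi hi'] at h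
    by_contra h'
    exact h (if_neg h')
  · rw [inner_adjoint_symb hq hℓ hi hi', if_pos h, Complex.norm_real, Real.norm_eq_abs,
      abs_of_nonneg (leadWeight_nonneg hq x i), one_mul]
    exact leadWeight_le_one hq hi hi' x

/-- The bounded operator `π(z_{ℓ+2-i}^*)` exists, and it differs from the adjoint of the compressed
symbol by shift operators with weights of order `q ^ h`. -/
theorem exists_zStar (hq : q ∈ Set.Ioo (0 : ℝ) 1) (hℓ : 1 ≤ ℓ) (hi : 1 ≤ i) (hi' : i ≤ ℓ + 1) :
    ∃ Z : H ℓ →L[ℂ] H ℓ, (∀ x, Z (ket x) = zStarKet ℓ q i x) ∧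
      Z - ContinuousLinearMap.adjoint (symb ℓ hq (ℓ + 2 - i)) ∈
        shiftClass ℓ 1 {fun h => q ^ h} := by
  classical
  have hw : ∀ k : ℕ, 0 ≤ q ^ k := fun k => (pow_pos hq.1 k).le
  have hc := coefBound_nonneg ℓ hq
  have hl := leadBound_nonneg ℓ hq
  have hS : ∀ m ∈ Gam ℓ i, ∃ S : H ℓ →L[ℂ] H ℓ, ∀ y x,
      inner ℂ (ket y) (S (ket x)) = moveMatrix ℓ q i (entry m) y x := by
    intro m hm
    refine exists_shift _
      (fun y x hx x' hx' => (moveMatrix_ne_zero hx).left_unique hℓ (moveMatrix_ne_zero hx'))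
      (fun x y hy y' hy' => (moveMatrix_ne_zero hy).right_unique hℓ (moveMatrix_ne_zero hy'))
      (C := coefBound ℓ q + leadBound ℓ q + 1) fun y x => ?_
    unfold moveMatrix
    split_ifs with h
    · have q1 : q ^ x.h ≤ 1 := pow_le_one₀ hq.1.le hq.2.le
      rw [Complex.norm_real, Real.norm_eq_abs]
      by_cases hne : m = leadTuple ℓ i
      · subst hne
        have h1 := abs_moveCoef_sub_le hq hℓ hi hi' h
        have h2 := leadWeight_le_one hq hi hi' x
        have h3 := leadWeight_nonneg hq x i
        have h4 : leadBound ℓ q * q ^ x.h ≤ leadBound ℓ q := mul_le_of_le_one_right hl q1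
        rw [abs_le] at h1 ⊢
        constructor <;> linarith [h1.1, h1.2]
      · have h1 := abs_moveCoef_le hq hℓ hi hi' hm hne h
        have h4 : coefBound ℓ q * q ^ x.h ≤ coefBound ℓ q := mul_le_of_le_one_right hc q1
        linarith
    · rw [norm_zero]
      linarith
  choose! S hS using hS
  refine ⟨∑ m ∈ Gam ℓ i, S m, fun x => ext_inner_ket fun y => ?_, ?_⟩
  · rw [inner_ket_zStarKet hℓ, _root_.sum_apply, inner_sum]
    exact Finset.sum_congr rfl fun m hm => hS m hm y x
  · rw [← Finset.add_sum_erase _ _ (leadTuple_mem hi'), add_sub_right_comm]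
    refine add_mem ?_ (sum_mem fun m hm => ?_)
    · have e : ∀ y x, inner ℂ (ket y) ((S (leadTuple ℓ i) -
          ContinuousLinearMap.adjoint (symb ℓ hq (ℓ + 2 - i))) (ket x)) =
          if MoveRel i (entry (leadTuple ℓ i)) x y then
            ((moveCoef ℓ q i x (entry (leadTuple ℓ i)) - leadWeight q x i : ℝ) : ℂ) else 0 := by
        intro y x
        rw [_root_.sub_apply, inner_sub_right, hS _ (leadTuple_mem hi'),
          inner_adjoint_symb hq hℓ hi hi', moveMatrix]
        split_ifs
        · push_cast
          rfl
        · rw [sub_zero]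
      refine mem_shiftClass_of_moveRel (i := i) (m := entry (leadTuple ℓ i)) hℓ hw hl
        (fun y x h => ?_) fun y x h => ?_
      · rw [e] at h
        by_contra h'
        exact h (if_neg h')
      · rw [e, if_pos h, Complex.norm_real]
        exact abs_moveCoef_sub_le hq hℓ hi hi' h
    · rw [Finset.mem_erase] at hm
      refine mem_shiftClass_of_moveRel (i := i) (m := entry m) hℓ hw hc (fun y x h => ?_)
        fun y x h => ?_
      · rw [hS m hm.2] at h
        exact moveMatrix_ne_zero h
      · rw [hS m hm.2, moveMatrix, if_pos h, Complex.norm_real]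
        exact abs_moveCoef_le hq hℓ hi hi' hm.2 hm.1 h

end LeftRegular

/-! ### Rapidly decreasing weights -/

section Rapid

variable {ℓ : ℕ} {d : ℤ} {q : ℝ}

/-- The weights `(h + 1) ^ (-k)`: a bound by a multiple of each of them is rapid decrease in `h`. -/
def rapid : Set (ℕ → ℝ) := Set.range fun k h : ℕ => (((h : ℝ) + 1) ^ k)⁻¹

theorem exists_pow_le_inv (hq : q ∈ Set.Ioo (0 : ℝ) 1) (k : ℕ) :
    ∃ C : ℝ, 0 ≤ C ∧ ∀ h : ℕ, q ^ h ≤ C * (((h : ℝ) + 1) ^ k)⁻¹ := by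
  obtain ⟨M, hM⟩ := (tendsto_pow_const_mul_const_pow_of_abs_lt_one k
    (abs_lt.2 ⟨by linarith [hq.1], hq.2⟩)).bddAbove_range
  have h1 : ∀ n : ℕ, (n : ℝ) ^ k * q ^ n ≤ M := fun n => hM ⟨n, rfl⟩
  have hM0 : 0 ≤ M := (mul_nonneg (by positivity) (pow_pos hq.1 1).le).trans (h1 1)
  refine ⟨M / q, div_nonneg hM0 hq.1.le, fun h => ?_⟩
  have h2 := h1 (h + 1)
  have h3 : (0 : ℝ) < ((h : ℝ) + 1) ^ k := by positivity
  rw [← div_eq_mul_inv, le_div_iff₀ h3, le_div_iff₀ hq.1]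
  push_cast at h2
  calc q ^ h * ((h : ℝ) + 1) ^ k * q = ((h : ℝ) + 1) ^ k * q ^ (h + 1) := by ring
    _ ≤ M := h2

theorem shiftClass_pow_le_rapid (hq : q ∈ Set.Ioo (0 : ℝ) 1) :
    shiftClass ℓ d {fun h => q ^ h} ≤ shiftClass ℓ d rapid := by
  refine shiftClass_mono ?_ ?_
  · rintro _ ⟨k, rfl⟩
    obtain ⟨C, -, hC⟩ := exists_pow_le_inv hq k
    exact ⟨_, rfl, C, hC⟩
  · rintro _ rfl k
    exact (pow_pos hq.1 k).le

/-- The rapidly decreasing sums of shift operators are stable under multiplying the matrix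
elements by a function that grows at most linearly in `h` at bounded distance from the diagonal. -/
theorem exists_schur_mul {f : Label ℓ → Label ℓ → ℝ}
    (hf : ∀ g : ℕ, ∃ C : ℝ, ∀ y x, y.h ≤ x.h + g → x.h ≤ y.h + g → |f y x| ≤ C * ((x.h : ℝ) + 1))
    {T : H ℓ →L[ℂ] H ℓ} (hT : T ∈ shiftClass ℓ d rapid) :
    ∃ T' ∈ shiftClass ℓ d rapid, ∀ y x,
      inner ℂ (ket y) (T' (ket x)) = (f y x : ℂ) * inner ℂ (ket y) (T (ket x)) := by
  refine AddSubmonoid.closure_induction (motive := fun T _ => ∃ T' ∈ shiftClass ℓ d rapid, ∀ y x,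
    inner ℂ (ket y) (T' (ket x)) = (f y x : ℂ) * inner ℂ (ket y) (T (ket x))) ?_ ?_ ?_ hT
  · rintro S ⟨⟨⟨hrow, hcol⟩, g, hg⟩, hS⟩
    obtain ⟨C, hC⟩ := hf g
    have key : ∀ k : ℕ, ∃ K : ℝ, 0 ≤ K ∧ ∀ y x,
        ‖(f y x : ℂ) * inner ℂ (ket y) (S (ket x))‖ ≤ K * (((x.h : ℝ) + 1) ^ k)⁻¹ := by
      intro k
      obtain ⟨M, hM⟩ := hS _ ⟨k + 1, rfl⟩
      refine ⟨|C| * |M|, by positivity, fun y x => ?_⟩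
      by_cases h : inner ℂ (ket y) (S (ket x)) = 0
      · rw [h, mul_zero, norm_zero]
        positivity
      · have h1 := hg y x h
        have h0 : (0 : ℝ) < (x.h : ℝ) + 1 := by positivity
        have h2 : |f y x| ≤ |C| * ((x.h : ℝ) + 1) := (hC y x h1.2.1 h1.2.2).trans
          (mul_le_mul_of_nonneg_right (le_abs_self C) h0.le)
        have h3 : ‖inner ℂ (ket y) (S (ket x))‖ ≤ |M| * (((x.h : ℝ) + 1) ^ (k + 1))⁻¹ :=
          (hM y x).trans (mul_le_mul_of_nonneg_right (le_abs_self M) (by positivity))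
        rw [norm_mul, Complex.norm_real, Real.norm_eq_abs]
        refine (mul_le_mul h2 h3 (norm_nonneg _) (by positivity)).trans (le_of_eq ?_)
        rw [pow_succ]
        field_simp
    have hne : ∀ y x, (f y x : ℂ) * inner ℂ (ket y) (S (ket x)) ≠ 0 →
        inner ℂ (ket y) (S (ket x)) ≠ 0 := fun y x h => right_ne_zero_of_mul h
    obtain ⟨K, -, hK⟩ := key 0
    obtain ⟨S', hS'⟩ := exists_shift (fun y x => (f y x : ℂ) * inner ℂ (ket y) (S (ket x)))
      (fun y x hx x' hx' => hrow y (hne _ _ hx) (hne _ _ hx'))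
      (fun x y hy y' hy' => hcol x (hne _ _ hy) (hne _ _ hy')) (C := K)
      fun y x => by simpa using hK y x
    refine ⟨S', AddSubmonoid.subset_closure ⟨⟨⟨fun y => ?_, fun x => ?_⟩, g, fun y x h => ?_⟩, ?_⟩,
      hS'⟩
    · simp only [hS']
      exact fun x hx x' hx' => hrow y (hne _ _ hx) (hne _ _ hx')
    · simp only [hS']
      exact fun y hy y' hy' => hcol x (hne _ _ hy) (hne _ _ hy')
    · rw [hS'] at h
      exact hg y x (hne _ _ h)
    · rintro _ ⟨k, rfl⟩
      obtain ⟨K, -, hK⟩ := key k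
      exact ⟨K, fun y x => by rw [hS']; exact hK y x⟩
  · exact ⟨0, zero_mem _, by simp⟩
  · rintro S T _ _ ⟨S', hS', h1⟩ ⟨T', hT', h2⟩
    refine ⟨S' + T', add_mem hS' hT', fun y x => ?_⟩
    rw [_root_.add_apply, _root_.add_apply, inner_add_right, inner_add_right, h1, h2, mul_add]

end Rapid

/-! ### Restriction to the spectral subspaces -/

section Restriction

variable {ℓ N : ℕ} {q : ℝ} {F : Set (ℕ → ℝ)}

theorem mem_HN_iff {v : H ℓ} : v ∈ HN ℓ N ↔ ∀ x : Label ℓ, x.n ≠ x.h + N → v x = 0 := by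
  constructor
  · intro hv x hx
    have h1 : HN ℓ N ≤ LinearMap.ker (innerSL ℂ (ket x : H ℓ)).toLinearMap := by
      refine Submodule.topologicalClosure_minimal _ ?_ (innerSL ℂ (ket x : H ℓ)).isClosed_ker
      rw [Submodule.span_le]
      rintro _ ⟨y, rfl⟩
      change inner ℂ (ket x) (ket y.1) = 0
      rw [inner_ket, ket_apply, if_neg]
      rintro rfl
      exact hx y.2
    have h2 : inner ℂ (ket x) v = 0 := h1 hv
    rwa [inner_ket] at h2
  · intro h
    refine (Submodule.isClosed_topologicalClosure _).mem_of_tendsto (hasSum_ket v)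
      (Eventually.of_forall fun s => sum_mem fun x _ => ?_)
    by_cases hx : x.n = x.h + N
    · exact Submodule.smul_mem _ _
        (Submodule.le_topologicalClosure _ (Submodule.subset_span ⟨⟨x, hx⟩, rfl⟩))
    · rw [h x hx, zero_smul]
      exact zero_mem _

theorem map_mem_HN {T : H ℓ →L[ℂ] H ℓ} (hT : T ∈ shiftClass ℓ 0 F) {v : H ℓ} (hv : v ∈ HN ℓ N) :
    T v ∈ HN ℓ N := by
  rw [mem_HN_iff] at hv ⊢
  intro y hy
  have h1 := hasSum_inner_ket T (ket y) v
  rw [inner_ket] at h1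
  refine h1.unique ?_
  convert hasSum_zero using 2 with x
  by_cases h : inner ℂ (ket y) (T (ket x)) = 0
  · rw [h, zero_mul]
  · have := graded_of_mem_shiftClass hT h
    rw [hv x (by omega), mul_zero]

/-- The restriction to `H_N` of an operator of degree zero. -/
def restr (N : ℕ) (T : H ℓ →L[ℂ] H ℓ) (hT : T ∈ shiftClass ℓ 0 F) : HN ℓ N →L[ℂ] HN ℓ N :=
  (T ∘L (HN ℓ N).subtypeL).codRestrict (HN ℓ N) fun v => map_mem_HN hT v.2

theorem coe_restr {T : H ℓ →L[ℂ] H ℓ} (hT : T ∈ shiftClass ℓ 0 F) (v : HN ℓ N) :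
    (restr N T hT v : H ℓ) = T v := rfl

theorem inner_ketN (y : LabelN ℓ N) (v : HN ℓ N) :
    inner ℂ (ketN y) v = inner ℂ (ket y.1) (v : H ℓ) := rfl

theorem isSumOfShifts_restr {w : ℕ → ℝ} (hw : ∀ k, 0 ≤ w k) {T : H ℓ →L[ℂ] H ℓ}
    (hT : T ∈ shiftClass ℓ 0 {w}) :
    IsSumOfShifts ketN (fun x : LabelN ℓ N => w x.1.h) (restr N T hT) := by
  obtain ⟨K, S, hS, rfl⟩ := exists_sum_of_mem_shiftClass hw hT
  have hS' : ∀ k, S k ∈ shiftClass ℓ 0 {w} := fun k => AddSubmonoid.subset_closure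
    ⟨(hS k).1, by rintro _ rfl; exact ⟨1, fun y x => by rw [one_mul]; exact (hS k).2 y x⟩⟩
  refine ⟨K, fun k => restr N (S k) (hS' k), fun k => ⟨⟨?_, ?_⟩, fun y x => (hS k).2 y.1 x.1⟩, ?_⟩
  · exact fun y x hx x' hx' => Subtype.ext ((hS k).1.isShift.1 y.1 hx hx')
  · exact fun x y hy y' hy' => Subtype.ext ((hS k).1.isShift.2 x.1 hy hy')
  · ext v : 2
    rw [coe_restr, _root_.sum_apply, _root_.sum_apply, Submodule.coe_sum]
    rfl

theorem abs_diracEigenvalue (x : LabelN ℓ N) :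
    |diracEigenvalue x.1| = 2 * (x.1.h : ℝ) + N + 1 := by
  have h := x.2
  unfold diracEigenvalue
  split_ifs with h0
  · have h1 : x.1.h = 0 := by omega
    have h2 : N = 0 := by omega
    simp [h1, h2]
  · rw [abs_of_nonneg (by positivity), h]
    push_cast
    ring

theorem Label.entry_bounds (x : Label ℓ) (i j : ℕ) : 0 ≤ x.r i j ∧ x.r i j ≤ x.n + x.h := by
  by_cases hij : 1 ≤ i ∧ 1 ≤ j ∧ i + j ≤ ℓ + 2
  · obtain ⟨i, rfl⟩ : ∃ k, i = k + 1 := ⟨i - 1, by omega⟩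
    have row : ∀ j, 1 ≤ j → j ≤ ℓ + 1 → 0 ≤ x.r 1 j ∧ x.r 1 j ≤ x.n + x.h := by
      intro j hj hj'
      have h1 := x.top_first
      have h2 := x.top j
      have h3 := x.gt.corner
      by_cases e1 : j = 1
      · subst e1
        omega
      · by_cases e2 : j = ℓ + 1
        · subst e2
          omega
        · have := h2 (by omega) (by omega)
          omega
    have h1 := x.gt.le_top i j hij.2.1 hij.2.2
    have h2 := x.gt.top_le i j hij.2.1 hij.2.2
    have h3 := row j hij.2.1 (by omega)
    have h4 := row (i + j) (by omega) (by omega)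
    omega
  · rw [x.gt.out_of_range i j hij]
    omega

/-- The labels of `H_N` with `h ≤ M`, encoded by the entries of their tableaux. -/
theorem finite_and_ncard_le (M : ℕ) : {x : LabelN ℓ N | x.1.h ≤ M}.Finite ∧
    {x : LabelN ℓ N | x.1.h ≤ M}.ncard ≤ (2 * M + N + 1) ^ ((ℓ + 1) * (ℓ + 1)) := by
  let f : LabelN ℓ N → (Fin (ℓ + 1) × Fin (ℓ + 1) → Fin (2 * M + N + 1)) := fun x p =>
    Fin.ofNat _ (x.1.r (p.1 + 1) (p.2 + 1)).toNat
  have hf : Set.InjOn f {x : LabelN ℓ N | x.1.h ≤ M} := by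
    intro x hx y hy hxy
    rw [Set.mem_ofPred_eq] at hx hy
    have hx2 := x.2
    have hy2 := y.2
    have hr : x.1.r = y.1.r := by
      ext i j
      by_cases hij : 1 ≤ i ∧ 1 ≤ j ∧ i + j ≤ ℓ + 2
      · have h1 := congrArg Fin.val (congrFun hxy (⟨i - 1, by omega⟩, ⟨j - 1, by omega⟩))
        have bx := x.1.entry_bounds i j
        have b := y.1.entry_bounds i j
        have e1 : i - 1 + 1 = i := by omega
        have e2 : j - 1 + 1 = j := by omega
        simp only [f, Fin.val_ofNat, e1, e2] at h1
        rw [Nat.mod_eq_of_lt (by omega), Nat.mod_eq_of_lt (by omega)] at h1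
        omega
      · rw [x.1.gt.out_of_range i j hij, y.1.gt.out_of_range i j hij]
    have h1 := x.1.top_first
    have h2 := y.1.top_first
    rw [hr] at h1
    exact Subtype.ext (Label.ext (by omega) (by omega) hr)
  refine ⟨Set.Finite.of_injOn (Set.mapsTo_univ f _) hf Set.finite_univ, ?_⟩
  refine (Set.ncard_le_ncard_of_injOn f (fun _ _ => Set.mem_univ _) hf Set.finite_univ).trans ?_
  rw [Set.ncard_univ, Nat.card_eq_fintype_card]
  simp

/-- In an enumeration by increasing eigenvalues, positions grow polynomially with `h`. -/
theorem position_le {ε : ℕ ≃ LabelN ℓ N} (hε : Monotone fun s => |diracEigenvalue (ε s).1|)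
    (s : ℕ) : s ≤ (2 * (ε s).1.h + N + 1) ^ ((ℓ + 1) * (ℓ + 1)) := by
  obtain ⟨h1, h2⟩ := finite_and_ncard_le (ℓ := ℓ) (N := N) (ε s).1.h
  refine le_trans ?_ h2
  have h3 : (ε '' (Finset.range s : Set ℕ)).ncard = s := by
    rw [Set.ncard_image_of_injective _ ε.injective, Set.ncard_coe_finset, Finset.card_range]
  rw [← h3]
  conv_rhs => rw [h3]
  refine Set.ncard_le_ncard ?_ h1
  rintro _ ⟨t, ht, rfl⟩
  have ht : t < s := Finset.mem_range.1 ht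
  have h4 := hε ht.le
  simp only [abs_diracEigenvalue] at h4
  have h5 : ((ε t).1.h : ℝ) ≤ (ε s).1.h := by linarith
  exact_mod_cast h5

/-- The number of labels grows polynomially and the weights decrease exponentially in `h`. -/
theorem isRapidDecay_restr (hq : q ∈ Set.Ioo (0 : ℝ) 1) {T : H ℓ →L[ℂ] H ℓ}
    (hT : T ∈ shiftClass ℓ 0 {fun h => q ^ h}) :
    IsRapidDecay ketN (fun x : LabelN ℓ N => |diracEigenvalue x.1|) (restr N T hT) := by
  intro ε hε a b
  obtain ⟨C, g, hCg⟩ := exists_bound_of_mem_shiftClass hT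
  set p : ℕ := (ℓ + 1) * (ℓ + 1)
  obtain ⟨K, hK0, hK⟩ := exists_pow_le_inv hq (p * (a + b) + 1)
  set L : ℝ := 2 * g + N + 2
  have hL : 0 ≤ L := by positivity
  set B : ℝ := L ^ (p * (a + b)) * (|C| * K)
  have bound : ∀ s t : ℕ, inner ℂ (ket (ε s).1) (T (ket (ε t).1)) ≠ 0 →
      (s : ℝ) ^ a * (t : ℝ) ^ b * ‖inner ℂ (ket (ε s).1) (T (ket (ε t).1))‖ ≤
        B / (((ε t).1.h : ℝ) + 1) := by
    intro s t h
    have h1 := (hCg _ _).2 h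
    set k := (ε t).1.h
    have hk : (0 : ℝ) < (k : ℝ) + 1 := by positivity
    have pos : ∀ u : ℕ, (ε u).1.h ≤ k + g → (u : ℝ) ≤ (L * ((k : ℝ) + 1)) ^ p := by
      intro u hu
      have h2 : (u : ℝ) ≤ (2 * ((ε u).1.h : ℝ) + N + 1) ^ p := by exact_mod_cast position_le hε u
      refine h2.trans (pow_le_pow_left₀ (by positivity) ?_ p)
      have h3 : ((ε u).1.h : ℝ) ≤ k + g := by exact_mod_cast hu
      have h4 : 0 ≤ ((2 : ℝ) * g + N) * k := by positivity
      simp only [L]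
      linarith
    have e : ‖inner ℂ (ket (ε s).1) (T (ket (ε t).1))‖ ≤
        |C| * (K * ((((k : ℝ) + 1) ^ (p * (a + b) + 1))⁻¹)) :=
      (hCg _ _).1.trans ((mul_le_mul_of_nonneg_right (le_abs_self C) (pow_pos hq.1 _).le).trans
        (mul_le_mul_of_nonneg_left (hK k) (abs_nonneg C)))
    have es := pow_le_pow_left₀ (Nat.cast_nonneg s) (pos s h1.1) a
    have et := pow_le_pow_left₀ (Nat.cast_nonneg t) (pos t (Nat.le_add_right _ _)) b
    refine (mul_le_mul (mul_le_mul es et (by positivity) (by positivity)) e (norm_nonneg _)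
      (by positivity)).trans (le_of_eq ?_)
    rw [← pow_add, ← pow_mul, mul_pow, pow_succ]
    simp only [B]
    field_simp
  -- entries of size `η` have bounded `h` in the column, hence in the row, and there are finitely
  -- many such labels
  rw [Metric.tendsto_nhds]
  intro η hη
  obtain ⟨M, hM⟩ := exists_nat_ge (B / η)
  refine Set.Finite.subset (Set.Finite.prod
    ((finite_and_ncard_le (ℓ := ℓ) (N := N) (M + g)).1.preimage ε.injective.injOn)
    ((finite_and_ncard_le (ℓ := ℓ) (N := N) M).1.preimage ε.injective.injOn)) ?_
  rintro ⟨s, t⟩ hst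
  rw [Set.mem_compl_iff, Set.mem_ofPred_eq, dist_zero_right, not_lt,
    Real.norm_of_nonneg (by positivity)] at hst
  have h0 : inner ℂ (ket (ε s).1) (T (ket (ε t).1)) ≠ 0 := by
    intro h0
    change η ≤ (s : ℝ) ^ a * (t : ℝ) ^ b * ‖inner ℂ (ket (ε s).1) (T (ket (ε t).1))‖ at hst
    rw [h0, norm_zero, mul_zero] at hst
    linarith
  have h1 := hst.trans (bound s t h0)
  have h2 := (hCg _ _).2 h0
  have ht : (ε t).1.h ≤ M := by
    have hk : (0 : ℝ) < ((ε t).1.h : ℝ) + 1 := by positivity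
    rw [le_div_iff₀ hk] at h1
    rw [div_le_iff₀ hη] at hM
    have h3 : ((ε t).1.h : ℝ) + 1 ≤ M := le_of_mul_le_mul_left (by linarith) hη
    have h4 : ((ε t).1.h : ℝ) ≤ M := by linarith
    exact_mod_cast h4
  exact ⟨h2.1.trans (by omega), ht⟩

/-- The eigenvalue of `|D|` on `H_N`, continued to all labels. -/
def absDirac (N : ℕ) (x : Label ℓ) : ℝ := 2 * (x.h : ℝ) + N + 1

theorem isDiagApply_restr {T T' : H ℓ →L[ℂ] H ℓ} (hT : T ∈ shiftClass ℓ 0 F)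
    (hT' : T' ∈ shiftClass ℓ 0 F)
    (h : ∀ y x, inner ℂ (ket y) (T' (ket x)) = (absDirac N y : ℂ) * inner ℂ (ket y) (T (ket x)))
    (v : HN ℓ N) :
    IsDiagApply ketN (fun x : LabelN ℓ N => |diracEigenvalue x.1|) (restr N T hT v)
      (restr N T' hT' v) := by
  intro y
  beta_reduce
  rw [inner_ketN, inner_ketN, coe_restr, coe_restr, abs_diracEigenvalue]
  have h1 := hasSum_inner_ket T' (ket y.1) v
  have h2 := (hasSum_inner_ket T (ket y.1) v).mul_left (absDirac N y.1 : ℂ)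
  simp only [h, mul_assoc] at h1
  exact h1.unique h2

theorem isDelta_restr {T T' : H ℓ →L[ℂ] H ℓ} (hT : T ∈ shiftClass ℓ 0 F)
    (hT' : T' ∈ shiftClass ℓ 0 F)
    (h : ∀ y x, inner ℂ (ket y) (T' (ket x)) =
      ((absDirac N y - absDirac N x : ℝ) : ℂ) * inner ℂ (ket y) (T (ket x))) :
    IsDelta ketN (fun x : LabelN ℓ N => |diracEigenvalue x.1|) (restr N T hT)
      (restr N T' hT') := by
  intro v w hvw y
  have hw : ∀ x, (w : H ℓ) x = (absDirac N x : ℂ) * (v : H ℓ) x := by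
    intro x
    by_cases hx : x.n = x.h + N
    · have h1 := hvw ⟨x, hx⟩
      beta_reduce at h1
      rwa [abs_diracEigenvalue, inner_ketN, inner_ketN, inner_ket, inner_ket] at h1
    · rw [mem_HN_iff.1 w.2 x hx, mem_HN_iff.1 v.2 x hx, mul_zero]
  beta_reduce
  rw [inner_add_right, inner_ketN, inner_ketN, inner_ketN, coe_restr, coe_restr, coe_restr,
    abs_diracEigenvalue]
  have h1 := (hasSum_inner_ket T' (ket y.1) v).add (hasSum_inner_ket T (ket y.1) w)
  have h2 := (hasSum_inner_ket T (ket y.1) v).mul_left (absDirac N y.1 : ℂ)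
  have e : ∀ x, inner ℂ (ket y.1) (T' (ket x)) * (v : H ℓ) x +
      inner ℂ (ket y.1) (T (ket x)) * (w : H ℓ) x =
        (absDirac N y.1 : ℂ) * (inner ℂ (ket y.1) (T (ket x)) * (v : H ℓ) x) := by
    intro x
    rw [h, hw]
    push_cast
    ring
  simp only [e] at h1
  exact h1.unique h2

/-- Products with `|D|` and commutators with `|D|` multiply the matrix elements by functions that
grow at most linearly near the diagonal, so neither leaves the rapidly decreasing class. -/
theorem isSmoothing_restr {T : H ℓ →L[ℂ] H ℓ} (hT : T ∈ shiftClass ℓ 0 rapid) :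
    IsSmoothing ketN (fun x : LabelN ℓ N => |diracEigenvalue x.1|) (restr N T hT) := by
  have hA : ∀ T : shiftClass ℓ 0 rapid, ∃ T' : shiftClass ℓ 0 rapid, ∀ y x,
      inner ℂ (ket y) (T'.1 (ket x)) = (absDirac N y : ℂ) * inner ℂ (ket y) (T.1 (ket x)) := by
    intro T
    have growth : ∀ g : ℕ, ∃ C : ℝ, ∀ y x : Label ℓ, y.h ≤ x.h + g → x.h ≤ y.h + g →
        |absDirac N y| ≤ C * ((x.h : ℝ) + 1) := by
      refine fun g => ⟨2 * g + N + 2, fun y x hy _ => ?_⟩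
      have h3 : (y.h : ℝ) ≤ x.h + g := by exact_mod_cast hy
      have h4 : 0 ≤ ((2 : ℝ) * g + N) * x.h := by positivity
      unfold absDirac
      rw [abs_of_nonneg (by positivity)]
      linarith
    obtain ⟨T', h1, h2⟩ := exists_schur_mul (f := fun y _ => absDirac N y) growth T.2
    exact ⟨⟨T', h1⟩, h2⟩
  have hB : ∀ T : shiftClass ℓ 0 rapid, ∃ T' : shiftClass ℓ 0 rapid, ∀ y x,
      inner ℂ (ket y) (T'.1 (ket x)) =
        ((absDirac N y - absDirac N x : ℝ) : ℂ) * inner ℂ (ket y) (T.1 (ket x)) := by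
    intro T
    have growth : ∀ g : ℕ, ∃ C : ℝ, ∀ y x : Label ℓ, y.h ≤ x.h + g → x.h ≤ y.h + g →
        |absDirac N y - absDirac N x| ≤ C * ((x.h : ℝ) + 1) := by
      refine fun g => ⟨2 * g, fun y x hy hx => ?_⟩
      have h3 : (y.h : ℝ) ≤ x.h + g := by exact_mod_cast hy
      have h4 : (x.h : ℝ) ≤ y.h + g := by exact_mod_cast hx
      have h5 : 0 ≤ (2 : ℝ) * g * x.h := by positivity
      unfold absDirac
      rw [abs_le]
      constructor <;> linarith
    obtain ⟨T', h1, h2⟩ :=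
      exists_schur_mul (f := fun y x => absDirac N y - absDirac N x) growth T.2
    exact ⟨⟨T', h1⟩, h2⟩
  choose A hA using hA
  choose B hB using hB
  refine ⟨fun k => restr N (A^[k] ⟨T, hT⟩).1 (A^[k] ⟨T, hT⟩).2, rfl, fun k v => ?_, fun k =>
    ⟨fun j => restr N (B^[j] (A^[k] ⟨T, hT⟩)).1 (B^[j] (A^[k] ⟨T, hT⟩)).2, rfl, fun j => ?_⟩⟩
  · refine isDiagApply_restr _ _ ?_ v
    rw [Function.iterate_succ_apply']
    exact hA _
  · refine isDelta_restr _ _ ?_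
    rw [Function.iterate_succ_apply']
    exact hB _

end Restriction

/-! ### Comparison of the two representations -/

section Comparison

variable {ℓ : ℕ} {q : ℝ} {π : Fin (ℓ + 1) → (H ℓ →L[ℂ] H ℓ)}

theorem existsUnique_isLeftRegular (hq : q ∈ Set.Ioo (0 : ℝ) 1) (hℓ : 1 ≤ ℓ) :
    ∃! π : Fin (ℓ + 1) → (H ℓ →L[ℂ] H ℓ), IsLeftRegular ℓ q π := by
  have h : ∀ j : Fin (ℓ + 1), ∃ Z : H ℓ →L[ℂ] H ℓ, ∀ x,
      Z (ket x) = zStarKet ℓ q (ℓ + 1 - (j : ℕ)) x := fun j =>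
    (exists_zStar hq hℓ (by omega) (by omega)).imp fun _ h => h.1
  choose Z hZ using h
  refine ⟨fun j => ContinuousLinearMap.adjoint (Z j), fun j x => ?_, fun π hπ => funext fun j => ?_⟩
  · rw [ContinuousLinearMap.adjoint_adjoint, hZ]
  · have e : ContinuousLinearMap.adjoint (π j) = Z j := ext_ket fun x => by rw [hπ, hZ]
    rw [← e, ContinuousLinearMap.adjoint_adjoint]

theorem adjoint_sub_symb_mem (hq : q ∈ Set.Ioo (0 : ℝ) 1) (hℓ : 1 ≤ ℓ) (hπ : IsLeftRegular ℓ q π)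
    (j : Fin (ℓ + 1)) :
    ContinuousLinearMap.adjoint (π j) - ContinuousLinearMap.adjoint (symb ℓ hq ((j : ℕ) + 1)) ∈
      shiftClass ℓ 1 {fun h => q ^ h} := by
  obtain ⟨Z, h1, h2⟩ := exists_zStar (i := ℓ + 1 - (j : ℕ)) hq hℓ (by omega) (by omega)
  have e : ContinuousLinearMap.adjoint (π j) = Z := ext_ket fun x => by rw [hπ, h1]
  have e2 : ℓ + 2 - (ℓ + 1 - (j : ℕ)) = j + 1 := by omega
  rwa [e2, ← e] at h2

theorem sub_symb_mem (hq : q ∈ Set.Ioo (0 : ℝ) 1) (hℓ : 1 ≤ ℓ) (hπ : IsLeftRegular ℓ q π)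
    (j : Fin (ℓ + 1)) : π j - symb ℓ hq ((j : ℕ) + 1) ∈ shiftClass ℓ (-1) {fun h => q ^ h} := by
  have h := adjoint_mem_shiftClass (tempered_pow hq) (adjoint_sub_symb_mem hq hℓ hπ j)
  rwa [map_sub, ContinuousLinearMap.adjoint_adjoint, ContinuousLinearMap.adjoint_adjoint] at h

theorem symb_mem (hq : q ∈ Set.Ioo (0 : ℝ) 1) (hℓ : 1 ≤ ℓ) (j : Fin (ℓ + 1)) :
    ContinuousLinearMap.adjoint (symb ℓ hq ((j : ℕ) + 1)) ∈ shiftClass ℓ 1 {fun _ => 1} ∧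
      symb ℓ hq ((j : ℕ) + 1) ∈ shiftClass ℓ (-1) {fun _ => 1} := by
  have h := adjoint_symb_mem (i := ℓ + 1 - (j : ℕ)) hq hℓ (by omega) (by omega)
  have e2 : ℓ + 2 - (ℓ + 1 - (j : ℕ)) = j + 1 := by omega
  rw [e2] at h
  refine ⟨h, ?_⟩
  have h' := adjoint_mem_shiftClass tempered_one h
  rwa [ContinuousLinearMap.adjoint_adjoint] at h'

theorem shiftClass_pow_le_one {d : ℤ} (hq : q ∈ Set.Ioo (0 : ℝ) 1) :
    shiftClass ℓ d {fun h => q ^ h} ≤ shiftClass ℓ d {fun _ => 1} := by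
  refine shiftClass_mono ?_ ?_
  · rintro _ rfl
    exact ⟨_, rfl, 1, fun k => by rw [one_mul]; exact pow_le_one₀ hq.1.le hq.2.le⟩
  · rintro _ rfl k
    exact (pow_pos hq.1 k).le

theorem mem_shiftClass_one (hq : q ∈ Set.Ioo (0 : ℝ) 1) (hℓ : 1 ≤ ℓ) (hπ : IsLeftRegular ℓ q π)
    (j : Fin (ℓ + 1)) : π j ∈ shiftClass ℓ (-1) {fun _ => 1} := by
  have h := add_mem (shiftClass_pow_le_one hq (sub_symb_mem hq hℓ hπ j)) (symb_mem hq hℓ j).2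
  rwa [sub_add_cancel] at h

theorem symb_adjoint_comp_mem (hq : q ∈ Set.Ioo (0 : ℝ) 1) (hℓ : 1 ≤ ℓ) (i j : Fin (ℓ + 1)) :
    ContinuousLinearMap.adjoint (symb ℓ hq ((i : ℕ) + 1)) ∘L symb ℓ hq ((j : ℕ) + 1) ∈
      shiftClass ℓ 0 {fun _ => 1} := by
  have h := comp_mem_shiftClass tempered_one (fun _ => zero_le_one) (symb_mem hq hℓ i).1
    (symb_mem hq hℓ j).2
  simpa using h

theorem adjoint_comp_sub_mem (hq : q ∈ Set.Ioo (0 : ℝ) 1) (hℓ : 1 ≤ ℓ) (hπ : IsLeftRegular ℓ q π)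
    (i j : Fin (ℓ + 1)) :
    ContinuousLinearMap.adjoint (π i) ∘L π j -
        ContinuousLinearMap.adjoint (symb ℓ hq ((i : ℕ) + 1)) ∘L symb ℓ hq ((j : ℕ) + 1) ∈
      shiftClass ℓ 0 {fun h => q ^ h} := by
  have h1 := comp_mem_shiftClass (tempered_pow hq) (fun _ => zero_le_one)
    (adjoint_sub_symb_mem hq hℓ hπ i) (mem_shiftClass_one hq hℓ hπ j)
  have h2 := comp_mem_shiftClass tempered_one (fun k => (pow_pos hq.1 k).le) (symb_mem hq hℓ i).1
    (sub_symb_mem hq hℓ hπ j)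
  simp only [mul_one, one_mul, add_neg_cancel] at h1 h2
  have h := add_mem h1 h2
  rwa [ContinuousLinearMap.sub_comp, ContinuousLinearMap.comp_sub, sub_add_sub_cancel] at h

/-- Since `W W^*` acts trivially on the range of `ρ(z_j) W`, compressing a product of symbols is
the same as multiplying compressed symbols. -/
theorem adjoint_symb_comp_symb (hq : q ∈ Set.Ioo (0 : ℝ) 1) (hℓ : 1 ≤ ℓ) (i j : Fin (ℓ + 1))
    (v : H ℓ) :
    ContinuousLinearMap.adjoint (symb ℓ hq ((i : ℕ) + 1)) (symb ℓ hq ((j : ℕ) + 1) v) =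
      ContinuousLinearMap.adjoint (W ℓ) (ContinuousLinearMap.adjoint (rho ℓ hq ((i : ℕ) + 1))
        (rho ℓ hq ((j : ℕ) + 1) (W ℓ v))) := by
  rw [← W_symb hq hℓ (by omega) (by omega) v]
  refine ext_inner_left ℂ fun u => ?_
  rw [ContinuousLinearMap.adjoint_inner_right, ContinuousLinearMap.adjoint_inner_right,
    ContinuousLinearMap.adjoint_inner_right, ← W_symb hq hℓ (by omega) (by omega) u]
  exact (LinearIsometry.inner_map_map _ _ _).symm

end Comparison

end QSphere

end

theorem mainTheorem11 (ℓ : ℕ) (hℓ : 1 ≤ ℓ) (q : ℝ) (hq : q ∈ Set.Ioo (0 : ℝ) 1) :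
    (∃! π : Fin (ℓ + 1) → (QSphere.H ℓ →L[ℂ] QSphere.H ℓ), QSphere.IsLeftRegular ℓ q π) ∧
    ∀ π : Fin (ℓ + 1) → (QSphere.H ℓ →L[ℂ] QSphere.H ℓ), QSphere.IsLeftRegular ℓ q π →
      (∀ i : Fin (ℓ + 1),
        QSphere.IsSumOfShifts QSphere.ket (fun x : QSphere.Label ℓ => q ^ x.h)
          (π i - ContinuousLinearMap.adjoint (QSphere.W ℓ) ∘L
            QSphere.rho ℓ hq ((i : ℕ) + 1) ∘L QSphere.W ℓ)) ∧
      (∀ (N : ℕ) (i j : Fin (ℓ + 1)),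
        ∃ P R : QSphere.HN ℓ N →L[ℂ] QSphere.HN ℓ N,
          (∀ v : QSphere.HN ℓ N,
            (P v : QSphere.H ℓ) = ContinuousLinearMap.adjoint (π i) (π j v)) ∧
          (∀ v : QSphere.HN ℓ N,
            (R v : QSphere.H ℓ) = ContinuousLinearMap.adjoint (QSphere.W ℓ)
              (ContinuousLinearMap.adjoint (QSphere.rho ℓ hq ((i : ℕ) + 1))
                (QSphere.rho ℓ hq ((j : ℕ) + 1) (QSphere.W ℓ v)))) ∧
          QSphere.IsSumOfShifts QSphere.ketN
            (fun x : QSphere.LabelN ℓ N => q ^ x.1.h) (P - R) ∧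
          QSphere.IsRapidDecay QSphere.ketN
            (fun x : QSphere.LabelN ℓ N => |QSphere.diracEigenvalue x.1|) (P - R) ∧
          QSphere.IsSmoothing QSphere.ketN
            (fun x : QSphere.LabelN ℓ N => |QSphere.diracEigenvalue x.1|) (P - R)) := by
  refine ⟨QSphere.existsUnique_isLeftRegular hq hℓ, fun π hπ => ⟨fun i => ?_, fun N i j => ?_⟩⟩
  · obtain ⟨K, S, hS, h⟩ := QSphere.exists_sum_of_mem_shiftClass (fun k => (pow_pos hq.1 k).le)
      (QSphere.sub_symb_mem hq hℓ hπ i)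
    exact ⟨K, S, fun k => ⟨(hS k).1.isShift, (hS k).2⟩, h⟩
  · have hT := QSphere.adjoint_comp_sub_mem hq hℓ hπ i j
    have hR := QSphere.symb_adjoint_comp_mem hq hℓ i j
    have hP := add_mem (QSphere.shiftClass_pow_le_one hq hT) hR
    rw [sub_add_cancel] at hP
    refine ⟨QSphere.restr N _ hP, QSphere.restr N _ hR, fun v => rfl,
      fun v => QSphere.adjoint_symb_comp_symb hq hℓ i j v, ?_⟩
    have e : QSphere.restr N _ hP - QSphere.restr N _ hR = QSphere.restr N _ hT := rfl
    rw [e]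
    exact ⟨QSphere.isSumOfShifts_restr (fun k => (pow_pos hq.1 k).le) hT,
      QSphere.isRapidDecay_restr hq hT,
      QSphere.isSmoothing_restr (QSphere.shiftClass_pow_le_rapid hq hT)⟩
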